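/- Let $n\ge 1$, $I=\mathbb Z/n\mathbb Z$, and let $V=\bigoplus_{i\in I}V_i$ be a finite-dimensional $I$-graded complex vector space, $d_i=\dim V_i$. Let $E_V=\bigoplus_{i\in I}\mathrm{Hom}(V_i,V_{i-1})$, on which $G_V=\prod_i GL(V_i)$ acts by conjugation, and let $\mathcal N_V\subseteq E_V$ be the closed subvariety of those $x$ that are nilpotent in $\mathrm{End}(V)$. An $I$-tuple of partitions $\boldsymbol\lambda=(\lambda^{(i)})_{i\in I}$ is regarded as an $I$-labelled Young diagram: the rows of $\lambda^{(i)}$ start with the label $i$, and labels increase by $1$ from left to right along each row. Let $d_i(\boldsymbol\lambda)$ be the number of boxes labelled $i$, let $\boldsymbol\lambda^{\le k}$ be obtained from $\boldsymbol\lambda$ by deleting all but the first $k$ columns, and let $l$ be the number of columns of $\boldsymbol\lambda$. Suppose $d_i(\boldsymbol\lambda)=d_i$ for all $i$. Let $\mathcal O_{\boldsymbol\lambda}\subseteq\mathcal N_V$ be the corresponding $G_V$-orbit: it consists of the $x$ for which there are bases of the $V_i$, indexed by the boxes labelled $i$, such that $x$ sends each box to the box on its left, or to $0$ if it is in the first column.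 Put $$\mathcal F_{\boldsymbol\lambda}=\{0=W^{(0)}\subseteq W^{(1)}\subseteq\cdots\subseteq W^{(l)}=V \mid W^{(k)}\ I\text{-graded},\ \dim W^{(k)}_i=d_i(\boldsymbol\lambda^{\le k})\},$$ $$\widetilde{\overline{\mathcal O_{\boldsymbol\lambda}}}=\{(x,(W^{(k)}))\in\mathcal N_V\times\mathcal F_{\boldsymbol\lambda}\mid x(W^{(k)})\subseteq W^{(k-1)},\ 1\le k\le l\},$$ $$\epsilon(\boldsymbol\lambda)=\sum_{\text{rows }R\text{ of }\boldsymbol\lambda} d_{\text{last label of }R}(\boldsymbol\lambda^{\le |R|}).$$ 1. $\mathcal F_{\boldsymbol\lambda}$ is a smooth irreducible projective variety, and $$\dim\mathcal F_{\boldsymbol\lambda}=\sum_{i\in I}\Big[\binom{d_i}{2}-\sum_{k=1}^{l}\binom{d_i(\boldsymbol\lambda^{\le k})-d_i(\boldsymbol\lambda^{\le k-1})}{2}\Big].$$ 2. The second projection $\widetilde{\overline{\mathcal O_{\boldsymbol\lambda}}}\to\mathcal F_{\boldsymbol\lambda}$ is a vector bundle (the linear structure of the fibres being that of $E_V$), with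 fibres of dimension $$\sum_{i\in I}\Big[\binom{d_i}{2}+\sum_{k=1}^{l}\binom{d_i(\boldsymbol\lambda^{\le k})-d_i(\boldsymbol\lambda^{\le k-1})+1}{2}\Big]-\epsilon(\boldsymbol\lambda).$$ Moreover $\epsilon(\boldsymbol\lambda)=\sum_{i\in I}\sum_{p=1}^{\ell(\lambda^{(i)})}d_{i+\lambda^{(i)}_p-1}(\boldsymbol\lambda^{\le\lambda^{(i)}_p})$. 3. The first projection $p_{\boldsymbol\lambda}:\widetilde{\overline{\mathcal O_{\boldsymbol\lambda}}}\to\mathcal N_V$ has image $\overline{\mathcal O_{\boldsymbol\lambda}}$ and is an isomorphism over $\mathcal O_{\boldsymbol\lambda}$. It is a resolution of $\overline{\mathcal O_{\boldsymbol\lambda}}$ (a proper birational morphism onto it from a smooth variety), and $$\dim\mathcal O_{\boldsymbol\lambda}=\dim\overline{\mathcal O_{\boldsymbol\lambda}}=\dim\widetilde{\overline{\mathcal O_{\boldsymbol\lambda}}}=\sum_{i\in I}d_i^2-\epsilon(\boldsymbol\lambda).$$ If $\boldsymbol\mu$ is another $I$-tuple of partitions with $d_i(\boldsymbol\mu)=d_i$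 for all $i$ and $\mathcal O_{\boldsymbol\mu}\subseteq\overline{\mathcal O_{\boldsymbol\lambda}}$, then the codimension of $\mathcal O_{\boldsymbol\mu}$ in $\overline{\mathcal O_{\boldsymbol\lambda}}$ is $\epsilon(\boldsymbol\mu)-\epsilon(\boldsymbol\lambda)$. -/

import Mathlib

open Topology Module

noncomputable section

universe u v w

/-! ## Spaces with functions and complex algebraic varieties -/

/-- A space with (complex valued) functions: a topological space with a sheaf of `ℂ`-algebras of
`ℂ`-valued functions such that, for a regular function `f`, the locus `f ≠ 0` is open and `1 / f` is
regular there. The sheaf is recorded by the predicate `RegAt f x`, "`f` is regular in some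
neighbourhood of `x`"; a function is regular on an open set `U` if it is regular at all points
of `U`. -/
structure FSpace where
  carrier : Type u
  top : TopologicalSpace carrier
  RegAt : (carrier → ℂ) → carrier → Prop
  regAt_congr : ∀ {f g : carrier → ℂ} {x : carrier}, f =ᶠ[𝓝 x] g → RegAt f x → RegAt g x
  regAt_eventually : ∀ {f : carrier → ℂ} {x : carrier}, RegAt f x → ∀ᶠ y in 𝓝 x, RegAt f y
  regAt_const : ∀ (c : ℂ) (x : carrier), RegAt (fun _ => c) x
  regAt_add : ∀ {f g : carrier → ℂ} {x : carrier}, RegAt f x → RegAt g x → RegAt (f + g) x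
  regAt_mul : ∀ {f g : carrier → ℂ} {x : carrier}, RegAt f x → RegAt g x → RegAt (f * g) x
  eventually_ne : ∀ {f : carrier → ℂ} {x : carrier}, RegAt f x → f x ≠ 0 → ∀ᶠ y in 𝓝 x, f y ≠ 0
  regAt_inv : ∀ {f : carrier → ℂ} {x : carrier}, RegAt f x → f x ≠ 0 → RegAt f⁻¹ x

namespace FSpace

instance : CoeSort FSpace.{u} (Type u) := ⟨FSpace.carrier⟩

instance (X : FSpace.{u}) : TopologicalSpace X.carrier := X.top

/-- Morphisms: continuous maps that pull regular functions back to regular functions. -/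
def IsMorphism {X : FSpace.{u}} {Y : FSpace.{v}} (f : X → Y) : Prop :=
  Continuous f ∧ ∀ (x : X) (g : Y → ℂ), Y.RegAt g (f x) → X.RegAt (g ∘ f) x

/-- Isomorphisms: morphisms with an inverse that is a morphism. -/
def IsIsom {X : FSpace.{u}} {Y : FSpace.{v}} (f : X → Y) : Prop :=
  IsMorphism f ∧ ∃ g : Y → X, IsMorphism g ∧ Function.LeftInverse g f ∧ Function.RightInverse g f

/-- The subspace carried by a subset: induced topology, and regular functions are those which
extend locally to regular functions of the ambient space. -/
def sub (X : FSpace.{u}) (S : Set X) : FSpace.{u} where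
  carrier := S
  top := inferInstance
  RegAt f x := ∃ F : X → ℂ, X.RegAt F x.1 ∧ f =ᶠ[𝓝 x] fun y => F y.1
  regAt_congr := by
    rintro f g x h ⟨F, hF, hf⟩
    exact ⟨F, hF, h.symm.trans hf⟩
  regAt_eventually := by
    rintro f x ⟨F, hF, hf⟩
    have h1 := (continuous_subtype_val.tendsto x).eventually (X.regAt_eventually hF)
    filter_upwards [h1, hf.eventuallyEq_nhds] with y hy hy'
    exact ⟨F, hy, hy'⟩
  regAt_const c x := ⟨fun _ => c, X.regAt_const c _, Filter.EventuallyEq.rfl⟩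
  regAt_add := by
    rintro f g x ⟨F, hF, hf⟩ ⟨G, hG, hg⟩
    exact ⟨F + G, X.regAt_add hF hG, hf.add hg⟩
  regAt_mul := by
    rintro f g x ⟨F, hF, hf⟩ ⟨G, hG, hg⟩
    exact ⟨F * G, X.regAt_mul hF hG, hf.mul hg⟩
  eventually_ne := by
    rintro f x ⟨F, hF, hf⟩ hx
    have hx' : F x.1 ≠ 0 := by rwa [hf.eq_of_nhds] at hx
    have h1 := (continuous_subtype_val.tendsto x).eventually (X.eventually_ne hF hx')
    filter_upwards [h1, hf] with y hy hy'
    rwa [hy']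
  regAt_inv := by
    rintro f x ⟨F, hF, hf⟩ hx
    have hx' : F x.1 ≠ 0 := by rwa [hf.eq_of_nhds] at hx
    exact ⟨F⁻¹, X.regAt_inv hF hx', hf.inv⟩

/-- The quotient structure on the target of a map `π`: a set is open if its preimage is open, and a
function is regular on an open set `U` if its pull-back is regular on the preimage of `U`. -/
def quotient (X : FSpace.{u}) {Y : Type v} (π : X → Y) : FSpace.{v} where
  carrier := Y
  top := TopologicalSpace.coinduced π X.top
  RegAt f y := ∃ U : Set Y, IsOpen (π ⁻¹' U) ∧ y ∈ U ∧ ∀ x, π x ∈ U → X.RegAt (f ∘ π) x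
  regAt_congr := by
    let _ : TopologicalSpace Y := TopologicalSpace.coinduced π X.top
    rintro f g y h ⟨U, hU, hy, hf⟩
    obtain ⟨O, hO, hO', hyO⟩ := mem_nhds_iff.1 h
    refine ⟨U ∩ O, hU.inter (isOpen_coinduced.1 hO'), ⟨hy, hyO⟩, fun x hx => ?_⟩
    refine X.regAt_congr ?_ (hf x hx.1)
    filter_upwards [(isOpen_coinduced.1 hO').mem_nhds hx.2] with z hz using hO hz
  regAt_eventually := by
    let _ : TopologicalSpace Y := TopologicalSpace.coinduced π X.top
    rintro f y ⟨U, hU, hy, hf⟩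
    filter_upwards [(isOpen_coinduced.2 hU).mem_nhds hy] with z hz
    exact ⟨U, hU, hz, hf⟩
  regAt_const c y := ⟨Set.univ, isOpen_univ, trivial, fun x _ => X.regAt_const c x⟩
  regAt_add := by
    rintro f g y ⟨U, hU, hy, hf⟩ ⟨U', hU', hy', hg⟩
    exact ⟨U ∩ U', hU.inter hU', ⟨hy, hy'⟩, fun x hx => X.regAt_add (hf x hx.1) (hg x hx.2)⟩
  regAt_mul := by
    rintro f g y ⟨U, hU, hy, hf⟩ ⟨U', hU', hy', hg⟩
    exact ⟨U ∩ U', hU.inter hU', ⟨hy, hy'⟩, fun x hx => X.regAt_mul (hf x hx.1) (hg x hx.2)⟩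
  eventually_ne := by
    let _ : TopologicalSpace Y := TopologicalSpace.coinduced π X.top
    rintro f y ⟨U, hU, hy, hf⟩ hfy
    have key : IsOpen (π ⁻¹' {z | z ∈ U ∧ f z ≠ 0}) := by
      refine isOpen_iff_mem_nhds.2 fun x hx => ?_
      filter_upwards [hU.mem_nhds hx.1, X.eventually_ne (hf x hx.1) hx.2] with z hz hz'
      exact ⟨hz, hz'⟩
    filter_upwards [(isOpen_coinduced.2 key).mem_nhds ⟨hy, hfy⟩] with z hz using hz.2
  regAt_inv := by
    rintro f y ⟨U, hU, hy, hf⟩ hfy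
    have key : IsOpen (π ⁻¹' {z | z ∈ U ∧ f z ≠ 0}) := by
      refine isOpen_iff_mem_nhds.2 fun x hx => ?_
      filter_upwards [hU.mem_nhds hx.1, X.eventually_ne (hf x hx.1) hx.2] with z hz hz'
      exact ⟨hz, hz'⟩
    exact ⟨_, key, ⟨hy, hfy⟩, fun x hx => X.regAt_inv (hf x hx.1) hx.2⟩

/-- A family of subsets `dom i` covering `X`, each with an algebra `alg i` of functions (only their
values on `dom i` matter), compatible with intersections. -/
structure FunctionBase (X : Type u) where
  ι : Type u
  dom : ι → Set X
  alg : ι → Subalgebra ℂ (X → ℂ)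
  inf : ι → ι → ι
  dom_inf : ∀ i j, dom (inf i j) = dom i ∩ dom j
  alg_left : ∀ i j, alg i ≤ alg (inf i j)
  alg_right : ∀ i j, alg j ≤ alg (inf i j)
  cover : ∀ x, ∃ i, x ∈ dom i

/-- The space with functions whose open sets are generated by the sets
`{x ∈ dom i | h x ≠ 0}` with `h ∈ alg i`, and whose regular functions are locally
of the form `a / b` with `a, b ∈ alg i`. -/
def ofBase {X : Type u} (𝓑 : FunctionBase X) : FSpace.{u} where
  carrier := X
  top := TopologicalSpace.generateFrom
    {s | ∃ i, ∃ h ∈ 𝓑.alg i, s = {x | x ∈ 𝓑.dom i ∧ h x ≠ 0}}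
  RegAt f x := ∃ i, x ∈ 𝓑.dom i ∧ ∃ a ∈ 𝓑.alg i, ∃ b ∈ 𝓑.alg i, b x ≠ 0 ∧
    f =ᶠ[@nhds X (TopologicalSpace.generateFrom
      {s | ∃ i, ∃ h ∈ 𝓑.alg i, s = {x | x ∈ 𝓑.dom i ∧ h x ≠ 0}}) x] a / b
  regAt_congr := by
    rintro f g x h ⟨i, hx, a, ha, b, hb, hbx, hf⟩
    exact ⟨i, hx, a, ha, b, hb, hbx, h.symm.trans hf⟩
  regAt_eventually := by
    let _ : TopologicalSpace X := TopologicalSpace.generateFrom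
      {s | ∃ i, ∃ h ∈ 𝓑.alg i, s = {x | x ∈ 𝓑.dom i ∧ h x ≠ 0}}
    rintro f x ⟨i, hx, a, ha, b, hb, hbx, hf⟩
    have ho : IsOpen {x | x ∈ 𝓑.dom i ∧ b x ≠ 0} :=
      TopologicalSpace.isOpen_generateFrom_of_mem ⟨i, b, hb, rfl⟩
    filter_upwards [ho.mem_nhds ⟨hx, hbx⟩, hf.eventuallyEq_nhds] with y hy hy'
    exact ⟨i, hy.1, a, ha, b, hb, hy.2, hy'⟩
  regAt_const c x := by
    obtain ⟨i, hi⟩ := 𝓑.cover x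
    refine ⟨i, hi, algebraMap ℂ (X → ℂ) c, Subalgebra.algebraMap_mem _ c, 1, one_mem _, by simp,
      Filter.Eventually.of_forall fun y => ?_⟩
    simp
  regAt_add := by
    rintro f g x ⟨i, hx, a, ha, b, hb, hbx, hf⟩ ⟨j, hx', a', ha', b', hb', hbx', hg⟩
    let _ : TopologicalSpace X := TopologicalSpace.generateFrom
      {s | ∃ i, ∃ h ∈ 𝓑.alg i, s = {x | x ∈ 𝓑.dom i ∧ h x ≠ 0}}
    have h1 := 𝓑.alg_left i j
    have h2 := 𝓑.alg_right i j
    have ho : IsOpen {x | x ∈ 𝓑.dom i ∧ b x ≠ 0} :=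
      TopologicalSpace.isOpen_generateFrom_of_mem ⟨i, b, hb, rfl⟩
    have ho' : IsOpen {x | x ∈ 𝓑.dom j ∧ b' x ≠ 0} :=
      TopologicalSpace.isOpen_generateFrom_of_mem ⟨j, b', hb', rfl⟩
    refine ⟨𝓑.inf i j, by rw [𝓑.dom_inf]; exact ⟨hx, hx'⟩, a * b' + b * a',
      add_mem (mul_mem (h1 ha) (h2 hb')) (mul_mem (h1 hb) (h2 ha')), b * b',
      mul_mem (h1 hb) (h2 hb'), mul_ne_zero hbx hbx', ?_⟩
    filter_upwards [hf, hg, ho.mem_nhds ⟨hx, hbx⟩, ho'.mem_nhds ⟨hx', hbx'⟩] with y e1 e2 e3 e4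
    have e3 := e3.2
    have e4 := e4.2
    simp only [Pi.add_apply, Pi.div_apply, Pi.mul_apply, e1, e2]
    exact div_add_div _ _ e3 e4
  regAt_mul := by
    rintro f g x ⟨i, hx, a, ha, b, hb, hbx, hf⟩ ⟨j, hx', a', ha', b', hb', hbx', hg⟩
    have h1 := 𝓑.alg_left i j
    have h2 := 𝓑.alg_right i j
    refine ⟨𝓑.inf i j, by rw [𝓑.dom_inf]; exact ⟨hx, hx'⟩, a * a',
      mul_mem (h1 ha) (h2 ha'), b * b',
      mul_mem (h1 hb) (h2 hb'), mul_ne_zero hbx hbx', ?_⟩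
    filter_upwards [hf, hg] with y e1 e2
    simp only [Pi.div_apply, Pi.mul_apply, e1, e2]
    exact div_mul_div_comm _ _ _ _
  eventually_ne := by
    let _ : TopologicalSpace X := TopologicalSpace.generateFrom
      {s | ∃ i, ∃ h ∈ 𝓑.alg i, s = {x | x ∈ 𝓑.dom i ∧ h x ≠ 0}}
    rintro f x ⟨i, hx, a, ha, b, hb, hbx, hf⟩ hfx
    have hax : (a * b) x ≠ 0 := by
      rw [hf.eq_of_nhds] at hfx
      exact mul_ne_zero (fun h => hfx (by simp [h])) hbx
    have ho : IsOpen {x | x ∈ 𝓑.dom i ∧ (a * b) x ≠ 0} :=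
      TopologicalSpace.isOpen_generateFrom_of_mem ⟨i, a * b, mul_mem ha hb, rfl⟩
    filter_upwards [ho.mem_nhds ⟨hx, hax⟩, hf] with y hy hy'
    rw [hy']
    exact div_ne_zero (left_ne_zero_of_mul hy.2) (right_ne_zero_of_mul hy.2)
  regAt_inv := by
    let _ : TopologicalSpace X := TopologicalSpace.generateFrom
      {s | ∃ i, ∃ h ∈ 𝓑.alg i, s = {x | x ∈ 𝓑.dom i ∧ h x ≠ 0}}
    rintro f x ⟨i, hx, a, ha, b, hb, hbx, hf⟩ hfx
    have hax : a x ≠ 0 := by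
      rw [hf.eq_of_nhds] at hfx
      exact fun h => hfx (by simp [h])
    refine ⟨i, hx, b, hb, a, ha, hax, ?_⟩
    filter_upwards [hf] with y hy
    simp only [Pi.inv_apply, Pi.div_apply, hy, inv_div]

/-- A vector space `E` as an affine space: Zariski topology, and regular functions are locally
quotients of polynomial functions. -/
def affine (E : Type u) [AddCommGroup E] [Module ℂ E] : FSpace.{u} :=
  ofBase
    { ι := PUnit
      dom := fun _ => Set.univ
      alg := fun _ => Algebra.adjoin ℂ (Set.range fun φ : Dual ℂ E => (φ : E → ℂ))
      inf := fun _ _ => PUnit.unit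
      dom_inf := fun _ _ => by simp
      alg_left := fun _ _ => le_rfl
      alg_right := fun _ _ => le_rfl
      cover := fun _ => ⟨PUnit.unit, trivial⟩ }

/-- The product (in the category of spaces with functions) of `X` and `Y`: the functions on
`U × V` it is generated by are the finite sums of `f(x) g(y)` with `f` regular on `U` and `g`
regular on `V`. -/
def prod (X : FSpace.{u}) (Y : FSpace.{v}) : FSpace.{max u v} :=
  ofBase (X := X.carrier × Y.carrier)
    { ι := TopologicalSpace.Opens X × TopologicalSpace.Opens Y
      dom := fun i => (i.1 : Set X) ×ˢ (i.2 : Set Y)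
      alg := fun i => Algebra.adjoin ℂ
        ({h | ∃ f : X → ℂ, (∀ x ∈ i.1, X.RegAt f x) ∧ h = fun z => f z.1} ∪
         {h | ∃ g : Y → ℂ, (∀ y ∈ i.2, Y.RegAt g y) ∧ h = fun z => g z.2})
      inf := fun i j => (i.1 ⊓ j.1, i.2 ⊓ j.2)
      dom_inf := fun i j => by
        simp only [TopologicalSpace.Opens.coe_inf, Set.prod_inter_prod]
      alg_left := fun i j => by
        refine Algebra.adjoin_mono (Set.union_subset_union ?_ ?_)
        · rintro h ⟨f, hf, rfl⟩
          exact ⟨f, fun x hx => hf x hx.1, rfl⟩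
        · rintro h ⟨f, hf, rfl⟩
          exact ⟨f, fun x hx => hf x hx.1, rfl⟩
      alg_right := fun i j => by
        refine Algebra.adjoin_mono (Set.union_subset_union ?_ ?_)
        · rintro h ⟨f, hf, rfl⟩
          exact ⟨f, fun x hx => hf x hx.2, rfl⟩
        · rintro h ⟨f, hf, rfl⟩
          exact ⟨f, fun x hx => hf x hx.2, rfl⟩
      cover := fun _ => ⟨(⊤, ⊤), trivial, trivial⟩ }

/-- Projective space `ℙ^N`, as the quotient of `ℂ^(N+1) ∖ {0}` by scalars. -/
def projectiveSpace (N : ℕ) : FSpace.{0} :=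
  ((affine (Fin (N + 1) → ℂ)).sub {v : Fin (N + 1) → ℂ | v ≠ 0}).quotient
    (Projectivization.mk' ℂ (V := Fin (N + 1) → ℂ))

/-- Affine varieties: spaces isomorphic to a Zariski closed subset of some `ℂ^N`. -/
def IsAffineVariety (X : FSpace.{u}) : Prop :=
  ∃ (N : ℕ) (Z : Set (affine (Fin N → ℂ))), IsClosed Z ∧
    ∃ f : X → (affine (Fin N → ℂ)).sub Z, IsIsom f

/-- Complex algebraic varieties (not necessarily irreducible): separated spaces with functions that
are covered by finitely many open affine varieties. -/
def IsVariety (X : FSpace.{u}) : Prop :=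
  IsClosed {z : X.prod X | z.1 = z.2} ∧
  ∃ (m : ℕ) (U : Fin m → Set X), (∀ j, IsOpen (U j) ∧ IsAffineVariety (X.sub (U j))) ∧
    ⋃ j, U j = Set.univ

/-- Projective varieties: spaces isomorphic to a closed subset of some `ℙ^N`. -/
def IsProjectiveVariety (X : FSpace.{u}) : Prop :=
  ∃ (N : ℕ) (Z : Set (projectiveSpace N)), IsClosed Z ∧
    ∃ f : X → (projectiveSpace N).sub Z, IsIsom f

/-- The local ring at `x`: germs at `x` of functions regular in a neighbourhood of `x`. -/
def localRing (X : FSpace.{u}) (x : X) : Subring (Filter.Germ (𝓝 x) ℂ) where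
  carrier := {g | ∃ f : X → ℂ, X.RegAt f x ∧ (f : Filter.Germ (𝓝 x) ℂ) = g}
  mul_mem' := by
    rintro _ _ ⟨f, hf, rfl⟩ ⟨g, hg, rfl⟩
    exact ⟨f * g, X.regAt_mul hf hg, rfl⟩
  add_mem' := by
    rintro _ _ ⟨f, hf, rfl⟩ ⟨g, hg, rfl⟩
    exact ⟨f + g, X.regAt_add hf hg, rfl⟩
  zero_mem' := ⟨fun _ => 0, X.regAt_const 0 x, rfl⟩
  one_mem' := ⟨fun _ => 1, X.regAt_const 1 x, rfl⟩
  neg_mem' := by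
    rintro _ ⟨f, hf, rfl⟩
    refine ⟨(fun _ => -1) * f, X.regAt_mul (X.regAt_const (-1) x) hf, ?_⟩
    have h : (fun _ => -1) * f = -f := by
      funext y
      simp
    rw [h]
    rfl

/-- Smoothness: all local rings are regular. -/
def IsSmooth (X : FSpace.{u}) : Prop :=
  ∀ x : X, IsRegularLocalRing (X.localRing x)

/-- `X` has (Krull) dimension the integer `m`. -/
def HasDim (X : FSpace.{u}) (m : ℤ) : Prop :=
  ∃ N : ℕ, (N : ℤ) = m ∧ topologicalKrullDim X = N

/-- The closure of `S` is irreducible and has codimension the integer `c` in `Y`: the supremum of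
the lengths of chains of irreducible closed subsets of `Y` starting with the closure of `S`
is `c`. -/
def HasCodim (Y : FSpace.{u}) (S : Set Y) (c : ℤ) : Prop :=
  ∃ Z : TopologicalSpace.IrreducibleCloseds Y, (Z : Set Y) = closure S ∧
    ∃ N : ℕ, (N : ℤ) = c ∧ Order.coheight Z = N

/-- A morphism (of varieties) is proper if it is universally closed. -/
def IsProperMorphism {X : FSpace.{u}} {Y : FSpace.{v}} (f : X → Y) : Prop :=
  IsMorphism f ∧ ∀ Z : FSpace.{0}, IsVariety Z →
    ∀ C : Set (X.prod Z), IsClosed C →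
      IsClosed {w : Y.prod Z | ∃ z ∈ C, w = (f z.1, z.2)}

/-- The map `f` restricts to an isomorphism from the preimage of `U` to `U`. -/
def IsIsomOver {X : FSpace.{u}} {Y : FSpace.{v}} (f : X → Y) (U : Set Y) : Prop :=
  IsIsom (X := X.sub (f ⁻¹' U)) (Y := Y.sub U) (U.restrictPreimage f)

/-- Resolutions of singularities: proper birational morphisms `X → Y` of varieties with
`X` smooth. -/
def IsResolution {X : FSpace.{u}} {Y : FSpace.{v}} (f : X → Y) : Prop :=
  IsVariety X ∧ IsVariety Y ∧ X.IsSmooth ∧ IsProperMorphism f ∧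
    ∃ U : Set Y, IsOpen U ∧ Dense U ∧ Dense (f ⁻¹' U) ∧ IsIsomOver f U

/-- The morphism `q : X → B` is a vector bundle of rank `r`, where the linear structure on the
fibres of `q` is that of the vector space `E`, in which they are embedded by means of
`vec : X → E`: locally on `B` there is an isomorphism with the product with `ℂ^r`, over `B` and
linear on the fibres. (In particular `vec` maps each fibre bijectively to a linear subspace of
dimension `r`.) -/
def IsVectorBundle {X : FSpace.{u}} {B : FSpace.{v}} {E : Type w} [AddCommGroup E] [Module ℂ E]
    (q : X → B) (vec : X → E) (r : ℕ) : Prop :=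
  IsMorphism q ∧ (∀ z z' : X, q z = q z' → vec z = vec z' → z = z') ∧
  ∀ b : B, ∃ U : Set B, IsOpen U ∧ b ∈ U ∧
    ∃ φ : (B.sub U).prod (affine (Fin r → ℂ)) → X.sub (q ⁻¹' U), IsIsom φ ∧
      (∀ (y : U) (c : Fin r → ℂ), q (φ (y, c)).1 = y.1) ∧
      ∀ y : U, IsLinearMap ℂ fun c : Fin r → ℂ => vec (φ (y, c)).1

end FSpace

/-! ## Multisegments -/

namespace CyclicQuiver

variable {n : ℕ}

/-- Delete all but the first `k` columns of every member of a tuple of Young diagrams. -/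
def firstCols (lam : ZMod n → YoungDiagram) (k : ℕ) : ZMod n → YoungDiagram := fun j =>
  { cells := (lam j).cells.filter fun c => c.2 < k
    isLowerSet := by
      intro a b hba ha
      simp only [Finset.coe_filter, Set.mem_ofPred_eq] at ha ⊢
      exact ⟨(lam j).isLowerSet hba ha.1, lt_of_le_of_lt hba.2 ha.2⟩ }

/-- The number `d_i(lam)` of boxes labelled `i`. The rows of `lam j` start with the label `j` and
labels increase by `1` along rows, so that box `(a, b)` (row `a`, column `b`, starting
from `0`) of `lam j` has label `j + b`. -/
def dimVec [NeZero n] (lam : ZMod n → YoungDiagram) (i : ZMod n) : ℕ :=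
  ∑ j : ZMod n, ((lam j).cells.filter fun c => j + (c.2 : ZMod n) = i).card

/-- The number of columns. -/
def numCols [NeZero n] (lam : ZMod n → YoungDiagram) : ℕ :=
  Finset.univ.sup fun j => (lam j).rowLen 0

/-- The number of boxes labelled `i` in the column `k` (the columns being numbered from `0`). -/
def colCount [NeZero n] (lam : ZMod n → YoungDiagram) (i : ZMod n) (k : ℕ) : ℕ :=
  dimVec (firstCols lam (k + 1)) i - dimVec (firstCols lam k) i

/-- The sum over the rows `R`, represented by their last boxes `c`, of the number of boxes
in the first `|R| = c.2 + 1` columns with the same label as `c`. -/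
def epsilon [NeZero n] (lam : ZMod n → YoungDiagram) : ℕ :=
  ∑ j : ZMod n, ∑ c ∈ (lam j).cells.filter fun c => (c.1, c.2 + 1) ∉ (lam j).cells,
    dimVec (firstCols lam (c.2 + 1)) (j + (c.2 : ZMod n))

/-- The boxes labelled `i`: triples `(j, a, b)` where `(a, b)` is a box of `lam j` with label `i`. -/
def Box (lam : ZMod n → YoungDiagram) (i : ZMod n) : Type :=
  {c : ZMod n × ℕ × ℕ // c.2 ∈ lam c.1 ∧ c.1 + (c.2.2 : ZMod n) = i}

/-! ## Representations of the cyclic quiver -/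

variable (V : ZMod n → Type u) [∀ i, AddCommGroup (V i)] [∀ i, Module ℂ (V i)]

/-- The space of representations on `V` of the cyclic quiver with arrows `i + 1 → i`. -/
abbrev Rep : Type u := ∀ i, V (i + 1) →ₗ[ℂ] V i

variable {V} in
/-- A representation as an endomorphism of the direct sum of the `V i`. -/
def Rep.toEnd (x : Rep V) : Module.End ℂ (∀ i, V i) :=
  LinearMap.pi fun i => x i ∘ₗ LinearMap.proj (i + 1)

/-- The variety of nilpotent representations. -/
def nilpVariety : FSpace.{u} :=
  (FSpace.affine (Rep V)).sub {x : Rep V | IsNilpotent x.toEnd}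

/-- The orbit of the nilpotent representations isomorphic to the direct sum of the segments of
`lam`: those having bases of the `V i` indexed by the boxes labelled `i`, such that each box is
mapped to the box on its left, or to `0` if it is in the first column. -/
def orbit (lam : ZMod n → YoungDiagram) : Set (nilpVariety V) :=
  {x | ∃ e : ∀ i, Basis (Box lam i) ℂ (V i), ∀ (i : ZMod n) (c : Box lam (i + 1)),
    (c.1.2.2 = 0 → x.1 i (e (i + 1) c) = 0) ∧
    ∀ c' : Box lam i, c.1 = (c'.1.1, c'.1.2.1, c'.1.2.2 + 1) → x.1 i (e (i + 1) c) = e i c'}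

variable [NeZero n]

/-- Graded partial flags `0 = W^(0) ⊆ ⋯ ⊆ W^(l) = V` such that `W^(k)` has the dimension vector
of the first `k` columns of `lam`. -/
structure GradedFlag (lam : ZMod n → YoungDiagram) where
  W : Fin (numCols lam + 1) → ∀ i, Submodule ℂ (V i)
  zero : W 0 = ⊥
  last : W (Fin.last _) = ⊤
  mono : Monotone W
  finrank_eq : ∀ k i, finrank ℂ (W k i) = dimVec (firstCols lam k) i

/-- The variety of graded frames of `V`, which is isomorphic to `∏ GL(V i)`. -/
def frames : FSpace.{u} :=
  (FSpace.affine (∀ i, Fin (finrank ℂ (V i)) → V i)).sub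
    {b : ∀ i, Fin (finrank ℂ (V i)) → V i | ∀ i, LinearIndependent ℂ (b i)}

theorem dimVec_mono {lam mu : ZMod n → YoungDiagram} (h : ∀ j, (lam j).cells ⊆ (mu j).cells)
    (i : ZMod n) : dimVec lam i ≤ dimVec mu i :=
  Finset.sum_le_sum fun j _ => Finset.card_le_card (Finset.filter_subset_filter _ (h j))

theorem firstCols_numCols (lam : ZMod n → YoungDiagram) : firstCols lam (numCols lam) = lam := by
  funext j
  ext c
  simp only [firstCols, Finset.mem_filter, and_iff_left_iff_imp]
  intro hc
  have h1 : (c.1, c.2) ∈ lam j := hc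
  have h2 := YoungDiagram.mem_iff_lt_rowLen.1 h1
  have h3 := (lam j).rowLen_anti 0 c.1 (Nat.zero_le _)
  have h4 : (lam j).rowLen 0 ≤ numCols lam :=
    Finset.le_sup (f := fun j => (lam j).rowLen 0) (Finset.mem_univ j)
  omega

variable {V}

/-- The flag spanned by initial parts of a frame. -/
def flagOfFrame [∀ i, FiniteDimensional ℂ (V i)] (lam : ZMod n → YoungDiagram)
    (hlam : ∀ i, dimVec lam i = finrank ℂ (V i)) (b : frames V) : GradedFlag V lam :=
  have key : ∀ k i, finrank ℂ (Submodule.span ℂ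
      (b.1 i '' {j | (j : ℕ) < dimVec (firstCols lam k) i})) = dimVec (firstCols lam k) i := by
    intro k i
    have hle : dimVec (firstCols lam k) i ≤ finrank ℂ (V i) := by
      rw [← hlam]
      exact dimVec_mono (fun j => Finset.filter_subset _ _) i
    have hb : LinearIndependent ℂ (b.1 i) := b.2 i
    have h1 : b.1 i '' {j | (j : ℕ) < dimVec (firstCols lam k) i} =
        Set.range (b.1 i ∘ Fin.castLE hle) := by
      rw [Set.range_comp]
      congr 1
      ext j
      constructor
      · intro hj
        exact ⟨⟨j, hj⟩, rfl⟩
      · rintro ⟨j', rfl⟩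
        exact j'.2
    rw [h1, finrank_span_eq_card (hb.comp _ (Fin.castLE_injective hle)), Fintype.card_fin]
  { W := fun k i => Submodule.span ℂ (b.1 i '' {j | (j : ℕ) < dimVec (firstCols lam k) i})
    zero := by
      funext i
      have h0 : dimVec (firstCols lam 0) i = 0 := by simp [dimVec, firstCols]
      simp [h0]
    last := by
      funext i
      apply Submodule.eq_top_of_finrank_eq
      rw [key, Fin.val_last, firstCols_numCols, hlam]
    mono := by
      intro k k' hk i
      refine Submodule.span_mono (Set.image_mono fun j hj => ?_)
      refine lt_of_lt_of_le (show (j : ℕ) < _ from hj) ?_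
      refine dimVec_mono (fun j c hc => ?_) i
      simp only [firstCols, Finset.mem_filter] at hc ⊢
      exact ⟨hc.1, lt_of_lt_of_le hc.2 hk⟩
    finrank_eq := fun k i => key k i }

/-- The graded partial flag variety, as the homogeneous space `∏ GL(V i) / P`: the quotient of the
variety of frames by the map that sends a frame to the flag it spans. -/
def flagVariety [∀ i, FiniteDimensional ℂ (V i)] (lam : ZMod n → YoungDiagram)
    (hlam : ∀ i, dimVec lam i = finrank ℂ (V i)) : FSpace.{u} :=
  (frames V).quotient (flagOfFrame lam hlam)

/-- The variety of pairs of a nilpotent representation `x` and a flag `(W^(k))` such that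
`x (W^(k)) ⊆ W^(k-1)` for all `k ≥ 1`. -/
def resolution [∀ i, FiniteDimensional ℂ (V i)] (lam : ZMod n → YoungDiagram)
    (hlam : ∀ i, dimVec lam i = finrank ℂ (V i)) : FSpace.{u} :=
  ((nilpVariety V).prod (flagVariety lam hlam)).sub
    {z : nilpVariety V × GradedFlag V lam | ∀ (k : Fin (numCols lam)) (i : ZMod n),
      ∀ w ∈ z.2.W k.succ (i + 1), z.1.1 i w ∈ z.2.W k.castSucc i}

/-- The first projection. -/
def projRep [∀ i, FiniteDimensional ℂ (V i)] (lam : ZMod n → YoungDiagram)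
    (hlam : ∀ i, dimVec lam i = finrank ℂ (V i)) (z : resolution lam hlam) : nilpVariety V :=
  z.1.1

/-- The representation `x` underlying a pair `(x, (W^(k)))`, as a vector of the space of all
representations. -/
def repPart [∀ i, FiniteDimensional ℂ (V i)] (lam : ZMod n → YoungDiagram)
    (hlam : ∀ i, dimVec lam i = finrank ℂ (V i)) (z : resolution lam hlam) : Rep V :=
  (projRep lam hlam z).1

/-- The second projection. -/
def projFlag [∀ i, FiniteDimensional ℂ (V i)] (lam : ZMod n → YoungDiagram)
    (hlam : ∀ i, dimVec lam i = finrank ℂ (V i)) (z : resolution lam hlam) :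
    flagVariety lam hlam :=
  z.1.2

end CyclicQuiver

end

open FSpace CyclicQuiver Module

set_option linter.unusedSectionVars false

/-! Call a basis of every `V i` a frame. A frame spans a flag of type `lam`, and every flag arises
in this way. Fix a frame `b0`. The flags whose steps have a non-zero minor on the first rows, in
coordinates of `b0`, form an open cell. Each of them is spanned by exactly one normal frame: its
vector `j` is the `j`-th vector of `b0` plus an arbitrary combination of the vectors of index at
least the dimension of the first step that contains `j`. Cells are therefore affine spaces. Over a
cell, a representation with `x W^(k) ⊆ W^(k-1)` is a matrix in the normal frame in which column `j`
is free above a certain height and zero below it. This trivialises the incidence variety as a vector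
bundle. Smoothness and both dimensions follow, the dimensions as numbers of free matrix entries.
Irreducibility holds because both varieties are images of open subsets of vector spaces.

Products of maximal minors, one for each step and each degree, embed the flag variety as a closed
subset of projective space. Projective varieties are complete by elimination theory, so the first
projection is proper and its image is closed.

If `x` lowers the flag, then `W^(k) ⊆ ker x^k`, so the kernels have dimension at least
`d_i(lam^{≤k})`. The orbit is exactly the set of `x` with equality for all `k` and `i`
(`mem_orbit_iff`): a Jordan basis is built from the last column to the first. So over the orbit the
flag must be that of the kernels, and it depends regularly on `x` because the kernels have constant
dimension there (`isMorphism_orbitFlag`). Kernel dimensions are upper semicontinuous, so the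
preimage of the orbit is open, hence dense in the irreducible incidence variety. Being closed, the
image is the closure of the orbit (`range_projRep`), and the orbit is open in it.

Dimensions are handled by `LocDim`: all points have the same codimension. This is a local notion,
invariant under isomorphism, and it holds for irreducible affine varieties. It carries the dimension
from the incidence variety to the orbit and then to its closure. Codimensions come from the identity
height + dimension of the quotient = dimension for finitely generated domains
(`height_add_maxHeights`). The remaining identities count boxes: weighing each box by the number of
boxes with its label up to its own column, row ends contribute `epsilon` and the other boxes the
rank of the bundle (`epsilon_add`). -/

noncomputable section

namespace FSpace

/-! ### Pointwise morphisms -/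

section MorAt

variable {X : FSpace.{u}} {Y : FSpace.{v}} {Z : FSpace.{w}}

/-- `f` is a morphism near `x`, in the sense of germs: it is continuous at `x` and pulls functions
regular at `f x` back to functions regular at `x`. -/
def MorAt {X : FSpace.{u}} {Y : FSpace.{v}} (f : X → Y) (x : X) : Prop :=
  ContinuousAt f x ∧ ∀ g : Y → ℂ, Y.RegAt g (f x) → X.RegAt (g ∘ f) x

theorem isMorphism_iff {f : X → Y} : IsMorphism f ↔ ∀ x, MorAt f x :=
  ⟨fun h x => ⟨h.1.continuousAt, h.2 x⟩,
    fun h => ⟨continuous_iff_continuousAt.2 fun x => (h x).1, fun x => (h x).2⟩⟩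

theorem IsMorphism.morAt {f : X → Y} (h : IsMorphism f) (x : X) : MorAt f x :=
  isMorphism_iff.1 h x

theorem MorAt.comp {f : X → Y} {g : Y → Z} {x : X} (hg : MorAt g (f x)) (hf : MorAt f x) :
    MorAt (fun y => g (f y)) x :=
  ⟨ContinuousAt.comp hg.1 hf.1, fun h hh => hf.2 (h ∘ g) (hg.2 h hh)⟩

theorem IsMorphism.comp {f : X → Y} {g : Y → Z} (hg : IsMorphism g) (hf : IsMorphism f) :
    IsMorphism (fun y => g (f y)) :=
  isMorphism_iff.2 fun x => (hg.morAt _).comp (hf.morAt x)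

theorem MorAt.congr {f f' : X → Y} {x : X} (hf : MorAt f x) (h : f =ᶠ[𝓝 x] f') : MorAt f' x := by
  refine ⟨hf.1.congr h, fun g hg => ?_⟩
  rw [← h.eq_of_nhds] at hg
  exact X.regAt_congr (h.fun_comp g) (hf.2 g hg)

theorem morAt_id (x : X) : MorAt (fun y : X => y) x :=
  ⟨continuousAt_id, fun _ h => h⟩

theorem isMorphism_id : IsMorphism (fun y : X => y) := isMorphism_iff.2 morAt_id

theorem morAt_const (y : Y) (x : X) : MorAt (fun _ : X => y) x :=
  ⟨continuousAt_const, fun g _ => X.regAt_const (g y) x⟩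

theorem MorAt.regAt {f : X → Y} {x : X} (hf : MorAt f x) {g : Y → ℂ} (hg : Y.RegAt g (f x)) :
    X.RegAt (fun y => g (f y)) x := hf.2 g hg

theorem morAt_val {S : Set X} (x : X.sub S) : MorAt (fun y : X.sub S => (y.1 : X)) x :=
  ⟨continuous_subtype_val.continuousAt, fun g hg => ⟨g, hg, Filter.EventuallyEq.rfl⟩⟩

theorem isMorphism_val {S : Set X} : IsMorphism (fun y : X.sub S => (y.1 : X)) :=
  isMorphism_iff.2 morAt_val

/-- Regular functions on a subspace are local restrictions of ambient ones, so nothing is lost by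
testing after the inclusion. All morphisms into subspaces are checked in this way. -/
theorem morAt_sub_iff {S : Set Y} {f : X → Y.sub S} {x : X} :
    MorAt f x ↔ MorAt (fun y => ((f y).1 : Y)) x := by
  refine ⟨fun h => (morAt_val _).comp h, fun h => ⟨?_, ?_⟩⟩
  · exact (IsInducing.subtypeVal.continuousAt_iff (f := f)).2 h.1
  · rintro g ⟨G, hG, hg⟩
    have hc : ContinuousAt f x := (IsInducing.subtypeVal.continuousAt_iff (f := f)).2 h.1
    refine X.regAt_congr ?_ (h.2 G hG)
    exact (hc.eventually hg).mono fun y hy => hy.symm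

theorem isMorphism_sub_iff {S : Set Y} {f : X → Y.sub S} :
    IsMorphism f ↔ IsMorphism (fun y => ((f y).1 : Y)) := by
  simp only [isMorphism_iff, morAt_sub_iff]

/-- Openness is essential: neighbourhoods of a point in `U` are then neighbourhoods in `X`, so an
extension that agrees with `F` on `U` has the same germ. -/
theorem regAt_of_open {U : Set X} (hU : IsOpen U) {F : X → ℂ} {z : X.sub U}
    (h : (X.sub U).RegAt (fun y => F y.1) z) : X.RegAt F z.1 := by
  obtain ⟨G, hG, hF⟩ := h
  refine X.regAt_congr ?_ hG
  have h1 := map_nhds_subtype_coe_eq_nhds z.2 (hU.mem_nhds z.2)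
  have h2 : ∀ᶠ y in Filter.map (Subtype.val : U → X) (𝓝 (⟨z.1, z.2⟩ : U)), G y = F y :=
    Filter.eventually_map.2 (hF.mono fun y hy => hy.symm)
  rwa [h1] at h2

theorem morAt_of_open {U : Set X} (hU : IsOpen U) {f : X → Y} {z : X.sub U}
    (h : MorAt (fun y : X.sub U => f y.1) z) : MorAt f z.1 := by
  refine ⟨?_, fun g hg => regAt_of_open hU (h.2 g hg)⟩
  have h1 := map_nhds_subtype_coe_eq_nhds z.2 (hU.mem_nhds z.2)
  have h2 := h.1
  unfold ContinuousAt at h2 ⊢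
  have h3 : Filter.Tendsto f (Filter.map (Subtype.val : U → X) (𝓝 (⟨z.1, z.2⟩ : U)))
    (𝓝 (f z.1)) := Filter.tendsto_map'_iff.2 h2
  rwa [h1] at h3

theorem MorAt.restrict {S : Set X} {f : X → Y} {z : X.sub S} (h : MorAt f z.1) :
    MorAt (fun y : X.sub S => f y.1) z :=
  MorAt.comp (f := fun y : X.sub S => y.1) h (morAt_val z)

end MorAt

/-! ### Regular functions -/

section RegAt

variable {X : FSpace.{u}} {x : X}

theorem regAt_add' {f g : X → ℂ} (hf : X.RegAt f x) (hg : X.RegAt g x) :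
    X.RegAt (fun y => f y + g y) x := X.regAt_add hf hg

theorem regAt_mul' {f g : X → ℂ} (hf : X.RegAt f x) (hg : X.RegAt g x) :
    X.RegAt (fun y => f y * g y) x := X.regAt_mul hf hg

theorem regAt_neg {f : X → ℂ} (hf : X.RegAt f x) : X.RegAt (fun y => -f y) x := by
  have := regAt_mul' (X.regAt_const (-1) x) hf
  simpa using this

theorem regAt_sub {f g : X → ℂ} (hf : X.RegAt f x) (hg : X.RegAt g x) :
    X.RegAt (fun y => f y - g y) x := by
  have := regAt_add' hf (regAt_neg hg)
  simpa [sub_eq_add_neg] using this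

theorem regAt_div {f g : X → ℂ} (hf : X.RegAt f x) (hg : X.RegAt g x) (h : g x ≠ 0) :
    X.RegAt (fun y => f y / g y) x := by
  have := regAt_mul' hf (X.regAt_inv hg h)
  simpa [div_eq_mul_inv] using this

theorem regAt_sum {ι : Type*} (s : Finset ι) {f : ι → X → ℂ} (h : ∀ i ∈ s, X.RegAt (f i) x) :
    X.RegAt (fun y => ∑ i ∈ s, f i y) x := by
  classical
  induction s using Finset.induction_on with
  | empty => simpa using X.regAt_const 0 x
  | insert a s ha ih =>
    simp only [Finset.sum_insert ha]
    exact regAt_add' (h a (Finset.mem_insert_self _ _))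
      (ih fun i hi => h i (Finset.mem_insert_of_mem hi))

theorem regAt_prod {ι : Type*} (s : Finset ι) {f : ι → X → ℂ} (h : ∀ i ∈ s, X.RegAt (f i) x) :
    X.RegAt (fun y => ∏ i ∈ s, f i y) x := by
  classical
  induction s using Finset.induction_on with
  | empty => simpa using X.regAt_const 1 x
  | insert a s ha ih =>
    simp only [Finset.prod_insert ha]
    exact regAt_mul' (h a (Finset.mem_insert_self _ _))
      (ih fun i hi => h i (Finset.mem_insert_of_mem hi))

theorem regAt_det {m : Type*} [Fintype m] [DecidableEq m] {M : X → Matrix m m ℂ}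
    (h : ∀ i j, X.RegAt (fun y => M y i j) x) : X.RegAt (fun y => (M y).det) x := by
  simp only [Matrix.det_apply']
  exact regAt_sum _ fun σ _ => regAt_mul' (X.regAt_const _ x) (regAt_prod _ fun i _ => h _ _)

theorem regAt_matrix_mul {l m n : Type*} [Fintype m] {M : X → Matrix l m ℂ} {N : X → Matrix m n ℂ}
    (h : ∀ i j, X.RegAt (fun y => M y i j) x) (h' : ∀ i j, X.RegAt (fun y => N y i j) x)
    (i : l) (j : n) : X.RegAt (fun y => (M y * N y) i j) x := by
  simp only [Matrix.mul_apply]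
  exact regAt_sum _ fun k _ => regAt_mul' (h _ _) (h' _ _)

/-- By Cramer's rule the entries are determinants divided by the determinant. The regularity of
normal frames, of coordinates in moving frames and of transported kernels rests on this. -/
theorem regAt_matrix_inv {m : Type*} [Fintype m] [DecidableEq m] {M : X → Matrix m m ℂ}
    (h : ∀ i j, X.RegAt (fun y => M y i j) x) (h0 : (M x).det ≠ 0) (i j : m) :
    X.RegAt (fun y => (M y)⁻¹ i j) x := by
  simp only [Matrix.inv_def, Ring.inverse_eq_inv', Matrix.smul_apply, smul_eq_mul]
  refine regAt_mul' (X.regAt_inv (regAt_det h) h0) ?_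
  simp only [Matrix.adjugate_apply]
  refine regAt_det fun a b => ?_
  by_cases ha : a = j
  · subst ha
    simpa using X.regAt_const _ x
  · simpa [Matrix.updateRow_ne ha] using h a b

/-- The algebra of functions regular at `x`. -/
def regAlg (X : FSpace.{u}) (x : X) : Subalgebra ℂ (X → ℂ) where
  carrier := {f | X.RegAt f x}
  mul_mem' := X.regAt_mul
  add_mem' := X.regAt_add
  algebraMap_mem' c := X.regAt_const c x

theorem isClosed_of_local {T : Type*} [TopologicalSpace T] {C : Set T}
    (h : ∀ t, t ∉ C → ∃ U : Set T, IsOpen U ∧ t ∈ U ∧ ∀ y ∈ U, y ∉ C) : IsClosed C := by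
  rw [← isOpen_compl_iff, isOpen_iff_forall_mem_open]
  intro t ht
  obtain ⟨U, hU, htU, hUC⟩ := h t ht
  exact ⟨U, hUC, hU, htU⟩

theorem isOpen_ne_zero {f : X → ℂ} (h : ∀ x, X.RegAt f x) : IsOpen {x : X | f x ≠ 0} :=
  isOpen_iff_mem_nhds.2 fun x hx => X.eventually_ne (h x) hx

/-- Closedness can be checked on the members of an open cover, where the set is cut out by regular
functions. -/
theorem isClosed_of_locally_zeros {C : Set X}
    (h : ∀ x : X, ∃ U : Set X, IsOpen U ∧ x ∈ U ∧ ∃ (ι : Type) (F : ι → X → ℂ),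
      (∀ i, ∀ y ∈ U, X.RegAt (F i) y) ∧ ∀ y ∈ U, y ∈ C ↔ ∀ i, F i y = 0) : IsClosed C := by
  refine isClosed_of_local fun x hx => ?_
  obtain ⟨U, hU, hxU, ι, F, hF, hC⟩ := h x
  obtain ⟨i, hi⟩ : ∃ i, F i x ≠ 0 := by
    by_contra hcon
    push Not at hcon
    exact hx ((hC x hxU).2 hcon)
  refine ⟨U ∩ {y | F i y ≠ 0}, ?_, ⟨hxU, hi⟩, fun y hy hyC => hy.2 ((hC y hy.1).1 hyC i)⟩
  refine isOpen_iff_mem_nhds.2 fun y hy => ?_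
  exact Filter.inter_mem (hU.mem_nhds hy.1) (X.eventually_ne (hF i y hy.1) hy.2)

end RegAt

/-! ### Spaces given by a base; affine spaces; products; quotients -/

section Constructions

variable {X : FSpace.{u}} {Y : FSpace.{v}} {Z : FSpace.{w}}

/-- Both the open sets and the regular functions of `ofBase` are expressed through the algebras `alg
i`, so pulling these back suffices; the quotients `a / b` then follow. -/
theorem morAt_ofBase {T : Type u} (𝓑 : FunctionBase T) {f : Z → ofBase 𝓑} {z : Z}
    (h : ∀ i, f z ∈ 𝓑.dom i → (∀ᶠ y in 𝓝 z, f y ∈ 𝓑.dom i) ∧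
      ∀ g ∈ 𝓑.alg i, Z.RegAt (fun y => g (f y)) z) : MorAt f z := by
  have hc : ContinuousAt f z := by
    refine TopologicalSpace.tendsto_nhds_generateFrom_iff.2 ?_
    rintro s ⟨i, g, hg, rfl⟩ ⟨hz, hz'⟩
    obtain ⟨h1, h2⟩ := h i hz
    filter_upwards [h1, Z.eventually_ne (h2 g hg) hz'] with y hy hy' using ⟨hy, hy'⟩
  refine ⟨hc, ?_⟩
  rintro g ⟨i, hi, a, ha, b, hb, hbz, hg⟩
  obtain ⟨h1, h2⟩ := h i hi
  refine Z.regAt_congr ?_ (regAt_div (h2 a ha) (h2 b hb) hbz)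
  exact (hc.eventually hg).mono fun y hy => hy.symm

theorem isOpen_ofBase {T : Type u} (𝓑 : FunctionBase T) {i : 𝓑.ι} {g : T → ℂ} (hg : g ∈ 𝓑.alg i) :
    IsOpen (X := ofBase 𝓑) {x | x ∈ 𝓑.dom i ∧ g x ≠ 0} :=
  TopologicalSpace.isOpen_generateFrom_of_mem ⟨i, g, hg, rfl⟩

/-- The polynomial functions on a vector space. -/
def polyFun (E : Type u) [AddCommGroup E] [Module ℂ E] : Subalgebra ℂ (E → ℂ) :=
  Algebra.adjoin ℂ (Set.range fun φ : Dual ℂ E => (φ : E → ℂ))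

variable {E : Type v} [AddCommGroup E] [Module ℂ E]

theorem regAt_polyFun {g : E → ℂ} (hg : g ∈ polyFun E) (x : affine E) : (affine E).RegAt g x :=
  ⟨PUnit.unit, trivial, g, hg, 1, one_mem _, one_ne_zero (α := ℂ), by simp⟩

theorem regAt_dual (φ : Dual ℂ E) (x : affine E) : (affine E).RegAt (fun y => φ y) x :=
  regAt_polyFun (Algebra.subset_adjoin ⟨φ, rfl⟩) x

/-- The functions with regular pull-back form a subalgebra, so it is enough to treat linear forms,
which generate the polynomial functions. -/
theorem morAt_affine {f : X → affine E} {x : X}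
    (h : ∀ φ : Dual ℂ E, X.RegAt (fun y => φ (f y)) x) : MorAt f x := by
  refine morAt_ofBase _ fun i _ => ⟨Filter.univ_mem, fun g hg => ?_⟩
  let ψ : (E → ℂ) →ₐ[ℂ] (X → ℂ) :=
    { toFun := fun g y => g (f y)
      map_one' := rfl
      map_mul' := fun _ _ => rfl
      map_zero' := rfl
      map_add' := fun _ _ => rfl
      commutes' := fun _ => rfl }
  have : Algebra.adjoin ℂ (Set.range fun φ : Dual ℂ E => (φ : E → ℂ)) ≤
      (regAlg X x).comap ψ := by
    rw [Algebra.adjoin_le_iff]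
    rintro _ ⟨φ, rfl⟩
    exact h φ
  exact this hg

theorem morAt_affine_iff {f : X → affine E} {x : X} :
    MorAt f x ↔ ∀ φ : Dual ℂ E, X.RegAt (fun y => φ (f y)) x :=
  ⟨fun h φ => h.regAt (regAt_dual φ _), morAt_affine⟩

/-- Morphisms to an affine space with coordinates. -/
theorem morAt_affine_basis {ι : Type*} [Fintype ι] (b : Basis ι ℂ E) {f : X → affine E} {x : X} :
    MorAt f x ↔ ∀ i, X.RegAt (fun y => b.repr (f y) i) x := by
  rw [morAt_affine_iff]
  refine ⟨fun h i => h (b.coord i), fun h φ => ?_⟩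
  have : (fun y => φ (f y)) = fun y => ∑ i, φ (b i) * b.repr (f y) i := by
    funext y
    conv_lhs => rw [← b.sum_repr (f y)]
    simp [mul_comm]
  rw [this]
  exact regAt_sum _ fun i _ => regAt_mul' (X.regAt_const _ _) (h i)

theorem morAt_affine_pi {ι : Type*} [Finite ι] {f : X → affine (ι → ℂ)} {x : X} :
    MorAt f x ↔ ∀ i, X.RegAt (fun y => f y i) x := by
  have := Fintype.ofFinite ι
  exact morAt_affine_basis (Pi.basisFun ℂ ι)

theorem isMorphism_linearMap {E' : Type w} [AddCommGroup E'] [Module ℂ E'] (L : E →ₗ[ℂ] E') :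
    IsMorphism (X := affine E) (Y := affine E') L :=
  isMorphism_iff.2 fun x => morAt_affine fun φ => regAt_dual (φ ∘ₗ L) x

theorem isMorphism_fst : IsMorphism (X := X.prod Y) (Y := X) (fun z => z.1) := by
  refine isMorphism_iff.2 fun z => ⟨?_, fun g hg => ?_⟩
  · refine continuousAt_def.2 fun A hA => ?_
    obtain ⟨U, hUA, hU, hzU⟩ := mem_nhds_iff.1 hA
    have := (isOpen_ofBase (FunctionBase.mk _ _ _ _ _ _ _ _ : FunctionBase (X.carrier × Y.carrier))
      (i := ((⟨U, hU⟩, ⊤) : TopologicalSpace.Opens X × TopologicalSpace.Opens Y))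
      (one_mem _)).mem_nhds (x := z) ⟨⟨hzU, trivial⟩, one_ne_zero (α := ℂ)⟩
    exact Filter.mem_of_superset this fun y hy => hUA hy.1.1
  · obtain ⟨U, hUg, hU, hzU⟩ := eventually_nhds_iff.1 (X.regAt_eventually hg)
    exact ⟨(⟨U, hU⟩, ⊤), ⟨hzU, trivial⟩, fun z => g z.1,
      Algebra.subset_adjoin (Or.inl ⟨g, fun x hx => hUg x hx, rfl⟩), 1, one_mem _,
      one_ne_zero (α := ℂ), by rw [div_one]; rfl⟩

theorem isMorphism_snd : IsMorphism (X := X.prod Y) (Y := Y) (fun z => z.2) := by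
  refine isMorphism_iff.2 fun z => ⟨?_, fun g hg => ?_⟩
  · refine continuousAt_def.2 fun A hA => ?_
    obtain ⟨U, hUA, hU, hzU⟩ := mem_nhds_iff.1 hA
    have := (isOpen_ofBase (FunctionBase.mk _ _ _ _ _ _ _ _ : FunctionBase (X.carrier × Y.carrier))
      (i := ((⊤, ⟨U, hU⟩) : TopologicalSpace.Opens X × TopologicalSpace.Opens Y))
      (one_mem _)).mem_nhds (x := z) ⟨⟨trivial, hzU⟩, one_ne_zero (α := ℂ)⟩
    exact Filter.mem_of_superset this fun y hy => hUA hy.1.2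
  · obtain ⟨U, hUg, hU, hzU⟩ := eventually_nhds_iff.1 (Y.regAt_eventually hg)
    exact ⟨(⊤, ⟨U, hU⟩), ⟨trivial, hzU⟩, fun z => g z.2,
      Algebra.subset_adjoin (Or.inr ⟨g, fun x hx => hUg x hx, rfl⟩), 1, one_mem _,
      one_ne_zero (α := ℂ), by rw [div_one]; rfl⟩

/-- The universal property of the product: functions with regular pull-back form a subalgebra that
contains both families of generators. -/
theorem morAt_prod {f : Z → X.prod Y} {z : Z} (h1 : MorAt (Y := X) (fun y => (f y).1) z)
    (h2 : MorAt (Y := Y) (fun y => (f y).2) z) : MorAt f z := by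
  refine morAt_ofBase _ fun i hi => ⟨?_, fun g hg => ?_⟩
  · filter_upwards [h1.1.eventually (i.1.2.mem_nhds hi.1),
      h2.1.eventually (i.2.2.mem_nhds hi.2)] with y hy hy' using ⟨hy, hy'⟩
  · let ψ : (X.carrier × Y.carrier → ℂ) →ₐ[ℂ] (Z → ℂ) :=
      { toFun := fun g y => g (f y)
        map_one' := rfl
        map_mul' := fun _ _ => rfl
        map_zero' := rfl
        map_add' := fun _ _ => rfl
        commutes' := fun _ => rfl }
    have : Algebra.adjoin ℂ
        ({h : X.carrier × Y.carrier → ℂ |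
          ∃ f : X → ℂ, (∀ x ∈ i.1, X.RegAt f x) ∧ h = fun z => f z.1} ∪
         {h | ∃ g : Y → ℂ, (∀ y ∈ i.2, Y.RegAt g y) ∧ h = fun z => g z.2}) ≤
        (regAlg Z z).comap ψ := by
      rw [Algebra.adjoin_le_iff]
      rintro _ (⟨g, hg, rfl⟩ | ⟨g, hg, rfl⟩)
      · exact h1.regAt (hg _ hi.1)
      · exact h2.regAt (hg _ hi.2)
    exact this hg

theorem isMorphism_prod {f : Z → X.prod Y} (h1 : IsMorphism (Y := X) (fun y => (f y).1))
    (h2 : IsMorphism (Y := Y) (fun y => (f y).2)) : IsMorphism f :=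
  isMorphism_iff.2 fun z => morAt_prod (h1.morAt z) (h2.morAt z)

section Quotient

variable {T : Type v} {π : X → T}

theorem isOpen_quotient {U : Set (X.quotient π)} : IsOpen U ↔ IsOpen (π ⁻¹' U) := Iff.rfl

theorem isMorphism_quotient_mk : IsMorphism (X := X) (Y := X.quotient π) π := by
  refine isMorphism_iff.2 fun x => ⟨?_, ?_⟩
  · refine continuousAt_def.2 fun A hA => ?_
    obtain ⟨U, hUA, hU, hxU⟩ := mem_nhds_iff.1 hA
    exact Filter.mem_of_superset ((isOpen_quotient.1 hU).mem_nhds hxU) fun y hy => hUA hy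
  · rintro g ⟨U, hU, hxU, hg⟩
    exact hg x hxU

/-- Openness and regularity on a quotient are defined by pull-back along `π`, so a map out of it may
be tested upstairs over an open set. -/
theorem morAt_quotient {f : X.quotient π → Z} {U : Set (X.quotient π)} (hU : IsOpen U)
    (h : ∀ x, π x ∈ U → MorAt (fun y => f (π y)) x) {y : X.quotient π} (hy : y ∈ U) :
    MorAt f y := by
  have hc : ∀ A : Set Z, IsOpen A → IsOpen (U ∩ f ⁻¹' A) := by
    intro A hA
    refine isOpen_quotient.2 (isOpen_iff_mem_nhds.2 fun x hx => ?_)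
    exact Filter.inter_mem ((isOpen_quotient.1 hU).mem_nhds hx.1) ((h x hx.1).1 (hA.mem_nhds hx.2))
  refine ⟨?_, fun g hg => ?_⟩
  · refine continuousAt_def.2 fun A hA => ?_
    obtain ⟨B, hBA, hB, hyB⟩ := mem_nhds_iff.1 hA
    exact Filter.mem_of_superset ((hc B hB).mem_nhds ⟨hy, hyB⟩) fun z hz => hBA hz.2
  · obtain ⟨B, hBg, hB, hyB⟩ := eventually_nhds_iff.1 (Z.regAt_eventually hg)
    exact ⟨U ∩ f ⁻¹' B, hc B hB, ⟨hy, hyB⟩, fun x hx => (h x hx.1).2 g (hBg _ hx.2)⟩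

theorem regAt_quotient {f : X.quotient π → ℂ} {U : Set (X.quotient π)} (hU : IsOpen U)
    (h : ∀ x, π x ∈ U → X.RegAt (fun y => f (π y)) x) {y : X.quotient π} (hy : y ∈ U) :
    (X.quotient π).RegAt f y :=
  ⟨U, hU, hy, h⟩

end Quotient

end Constructions

/-! ### Isomorphisms -/

section Iso

variable {X : FSpace.{u}} {Y : FSpace.{v}} {Z : FSpace.{w}}

/-- Two spaces with functions are isomorphic. -/
def Iso (X : FSpace.{u}) (Y : FSpace.{v}) : Prop := ∃ f : X → Y, IsIsom f

theorem IsIsom.mk' {f : X → Y} {g : Y → X} (hf : IsMorphism f) (hg : IsMorphism g)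
    (h1 : ∀ x, g (f x) = x) (h2 : ∀ y, f (g y) = y) : IsIsom f := ⟨hf, g, hg, h1, h2⟩

theorem IsIsom.comp {f : X → Y} {g : Y → Z} (hg : IsIsom g) (hf : IsIsom f) :
    IsIsom (fun x => g (f x)) := by
  obtain ⟨hf, f', hf', h1, h2⟩ := hf
  obtain ⟨hg, g', hg', h3, h4⟩ := hg
  exact .mk' (hg.comp hf) (hf'.comp hg') (fun x => by simp [h3 _, h1 _]) fun y => by
    simp [h2 _, h4 _]

theorem Iso.refl (X : FSpace.{u}) : Iso X X :=
  ⟨fun x => x, .mk' isMorphism_id isMorphism_id (fun _ => rfl) fun _ => rfl⟩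

theorem Iso.symm (h : Iso X Y) : Iso Y X := by
  obtain ⟨f, hf, f', hf', h1, h2⟩ := h
  exact ⟨f', hf', f, hf, h2, h1⟩

theorem Iso.trans (h : Iso X Y) (h' : Iso Y Z) : Iso X Z := by
  obtain ⟨f, hf⟩ := h
  obtain ⟨g, hg⟩ := h'
  exact ⟨_, hg.comp hf⟩

theorem IsIsom.isHomeomorph {f : X → Y} (hf : IsIsom f) : IsHomeomorph f := by
  obtain ⟨hf, g, hg, h1, h2⟩ := hf
  exact (Homeomorph.mk ⟨f, g, h1, h2⟩ hf.1 hg.1).isHomeomorph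

theorem IsIsom.sub {f : X → Y} (hf : IsIsom f) {S : Set X} {T : Set Y}
    (h : ∀ x, x ∈ S ↔ f x ∈ T) :
    IsIsom (X := X.sub S) (Y := Y.sub T) (fun x => ⟨f x.1, (h x.1).1 x.2⟩) := by
  obtain ⟨hf, g, hg, h1, h2⟩ := hf
  refine .mk' (g := fun y => ⟨g y.1, (h _).2 ((h2 y.1).symm ▸ y.2)⟩)
    (isMorphism_sub_iff.2 (hf.comp isMorphism_val)) (isMorphism_sub_iff.2 (hg.comp isMorphism_val))
    (fun x => Subtype.ext (h1 _)) fun y => Subtype.ext (h2 _)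

theorem iso_sub_univ (X : FSpace.{u}) : Iso X (X.sub Set.univ) :=
  ⟨fun x => ⟨x, trivial⟩, .mk' (g := fun x => x.1) (isMorphism_sub_iff.2 isMorphism_id)
    isMorphism_val (fun _ => rfl) fun _ => rfl⟩

theorem iso_sub_sub {S : Set X} (T : Set (X.sub S)) :
    Iso ((X.sub S).sub T) (X.sub {x | ∃ h : x ∈ S, (⟨x, h⟩ : X.sub S) ∈ T}) :=
  ⟨fun x => ⟨x.1.1, x.1.2, x.2⟩, .mk' (g := fun x => ⟨⟨x.1, x.2.1⟩, x.2.2⟩)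
    (isMorphism_sub_iff.2 (IsMorphism.comp (Y := X.sub S) (Z := X) isMorphism_val isMorphism_val))
    (isMorphism_sub_iff.2 (isMorphism_sub_iff.2 isMorphism_val)) (fun _ => rfl) fun _ => rfl⟩

theorem iso_sub_sub' {S T : Set X} :
    Iso ((X.sub S).sub {x : X.sub S | x.1 ∈ T}) ((X.sub T).sub {x : X.sub T | x.1 ∈ S}) :=
  ⟨fun x => ⟨⟨x.1.1, x.2⟩, x.1.2⟩, .mk' (g := fun x => ⟨⟨x.1.1, x.2⟩, x.1.2⟩)
    (isMorphism_sub_iff.2 (isMorphism_sub_iff.2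
      (IsMorphism.comp (Y := X.sub S) (Z := X) isMorphism_val isMorphism_val)))
    (isMorphism_sub_iff.2 (isMorphism_sub_iff.2
      (IsMorphism.comp (Y := X.sub T) (Z := X) isMorphism_val isMorphism_val)))
    (fun _ => rfl) fun _ => rfl⟩

theorem iso_prod_sub (S : Set X) (T : Set Y) :
    Iso ((X.sub S).prod (Y.sub T)) ((X.prod Y).sub {z : X.prod Y | z.1 ∈ S ∧ z.2 ∈ T}) :=
  ⟨fun z => ⟨(z.1.1, z.2.1), z.1.2, z.2.2⟩, .mk' (g := fun z => (⟨z.1.1, z.2.1⟩, ⟨z.1.2, z.2.2⟩))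
    (isMorphism_sub_iff.2 (isMorphism_prod (isMorphism_val.comp isMorphism_fst)
      (isMorphism_val.comp isMorphism_snd)))
    (isMorphism_prod (isMorphism_sub_iff.2 (isMorphism_fst.comp isMorphism_val))
      (isMorphism_sub_iff.2 (isMorphism_snd.comp isMorphism_val))) (fun _ => rfl) fun _ => rfl⟩

theorem Iso.prod {X' : FSpace} {Y' : FSpace} (h : Iso X X') (h' : Iso Y Y') :
    Iso (X.prod Y) (X'.prod Y') := by
  obtain ⟨f, hf, f', hf', h1, h2⟩ := h
  obtain ⟨g, hg, g', hg', h3, h4⟩ := h'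
  exact ⟨fun z => (f z.1, g z.2), .mk' (g := fun z => (f' z.1, g' z.2))
    (isMorphism_prod (hf.comp isMorphism_fst) (hg.comp isMorphism_snd))
    (isMorphism_prod (hf'.comp isMorphism_fst) (hg'.comp isMorphism_snd))
    (fun z => Prod.ext (h1 _) (h3 _)) fun z => Prod.ext (h2 _) (h4 _)⟩

variable {E : Type v} [AddCommGroup E] [Module ℂ E] {E' : Type w} [AddCommGroup E'] [Module ℂ E']

theorem isIsom_linearEquiv (e : E ≃ₗ[ℂ] E') : IsIsom (X := affine E) (Y := affine E') e :=
  .mk' (isMorphism_linearMap e.toLinearMap) (isMorphism_linearMap e.symm.toLinearMap)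
    e.symm_apply_apply e.apply_symm_apply

theorem iso_affine_prod : Iso ((affine E).prod (affine E')) (affine (E × E')) := by
  refine ⟨fun z => ((z.1, z.2) : E × E'), .mk' (g := fun z => (z.1, z.2)) ?_ ?_
    (fun _ => rfl) fun _ => rfl⟩
  · refine isMorphism_iff.2 fun z => morAt_affine fun φ => ?_
    have : (fun y : (affine E).prod (affine E') => φ (y.1, y.2)) = fun y =>
        (φ ∘ₗ LinearMap.inl ℂ E E') y.1 + (φ ∘ₗ LinearMap.inr ℂ E E') y.2 := by
      have key : ∀ (a : E) (b : E'), φ (a, b) =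
          (φ ∘ₗ LinearMap.inl ℂ E E') a + (φ ∘ₗ LinearMap.inr ℂ E E') b := fun a b => by
        rw [LinearMap.comp_apply, LinearMap.comp_apply, ← map_add, LinearMap.inl_apply,
          LinearMap.inr_apply, Prod.mk_add_mk, add_zero, zero_add]
      exact funext fun y => key _ _
    exact this ▸ regAt_add' ((isMorphism_fst.morAt z).regAt (regAt_dual _ _))
      ((isMorphism_snd.morAt z).regAt (regAt_dual _ _))
  · exact isMorphism_prod (X := affine E) (Y := affine E')
      (isMorphism_linearMap (LinearMap.fst ℂ E E')) (isMorphism_linearMap (LinearMap.snd ℂ E E'))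

end Iso

/-! ### Affine varieties and varieties -/

section Variety

variable {X : FSpace.{u}} {Y : FSpace.{v}} {Z : FSpace.{w}}

theorem IsAffineVariety.of_iso (hY : IsAffineVariety Y) (h : Iso X Y) : IsAffineVariety X := by
  obtain ⟨N, Z, hZ, hf⟩ := hY
  exact ⟨N, Z, hZ, h.trans hf⟩

theorem isAffineVariety_closed {E : Type v} [AddCommGroup E] [Module ℂ E] [FiniteDimensional ℂ E]
    {Z : Set (affine E)} (hZ : IsClosed Z) : IsAffineVariety ((affine E).sub Z) := by
  let e : E ≃ₗ[ℂ] (Fin (finrank ℂ E) → ℂ) := (finBasis ℂ E).equivFun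
  refine ⟨_, (fun y => e.symm y) ⁻¹' Z,
    hZ.preimage (isMorphism_linearMap e.symm.toLinearMap).1, _,
    (isIsom_linearEquiv e).sub (S := Z) fun x => ?_⟩
  have key : ∀ x : E, e.symm (e x) = x := e.symm_apply_apply
  exact iff_of_eq (congrArg (· ∈ Z) (key x).symm)

theorem IsAffineVariety.closed_sub (hX : IsAffineVariety X) {S : Set X} (hS : IsClosed S) :
    IsAffineVariety (X.sub S) := by
  obtain ⟨N, Z, hZ, f, hf⟩ := hX
  have h1 := hf.isHomeomorph
  have h2 : Iso (X.sub S) (((affine (Fin N → ℂ)).sub Z).sub (f '' S)) :=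
    ⟨_, hf.sub fun x => (h1.injective.mem_set_image).symm⟩
  refine IsAffineVariety.of_iso ?_ (h2.trans (iso_sub_sub _))
  refine isAffineVariety_closed ?_
  obtain ⟨C, hC, hC'⟩ := isClosed_induced_iff.1 (h1.isClosedMap _ hS)
  convert hC.inter hZ using 1
  ext x
  constructor
  · rintro ⟨h, hx⟩
    rw [← hC'] at hx
    exact ⟨hx, h⟩
  · rintro ⟨hx, h⟩
    refine ⟨h, ?_⟩
    rw [← hC']
    exact hx

theorem IsAffineVariety.prod (hX : IsAffineVariety X) (hY : IsAffineVariety Y) :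
    IsAffineVariety (X.prod Y) := by
  obtain ⟨N, Z, hZ, hf⟩ := hX
  obtain ⟨M, Z', hZ', hg⟩ := hY
  have h1 : IsAffineVariety ((affine (Fin N → ℂ)).prod (affine (Fin M → ℂ))) :=
    (isAffineVariety_closed isClosed_univ).of_iso (iso_affine_prod.trans (iso_sub_univ _))
  refine (h1.closed_sub ?_).of_iso ((Iso.prod hf hg).trans (iso_prod_sub Z Z'))
  exact (hZ.preimage isMorphism_fst.1).inter (hZ'.preimage isMorphism_snd.1)

/-- The diagonal is closed. -/
def IsSep (X : FSpace.{u}) : Prop := IsClosed {z : X.prod X | z.1 = z.2}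

theorem IsSep.isClosed_eq (hY : IsSep Y) {f g : X → Y} (hf : IsMorphism f) (hg : IsMorphism g) :
    IsClosed {x | f x = g x} :=
  IsClosed.preimage (isMorphism_prod (Z := X) (X := Y) (Y := Y) (f := fun x => (f x, g x)) hf hg).1
    hY

theorem IsSep.of_injective (hY : IsSep Y) {f : X → Y} (hf : IsMorphism f)
    (h : Function.Injective f) : IsSep X := by
  have := hY.isClosed_eq (hf.comp (isMorphism_fst (X := X) (Y := X)))
    (hf.comp (isMorphism_snd (X := X) (Y := X)))
  simp only [h.eq_iff] at this
  exact this

theorem IsSep.prod (hX : IsSep X) (hY : IsSep Y) : IsSep (X.prod Y) := by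
  have h1 := hX.isClosed_eq (isMorphism_fst.comp (isMorphism_fst (X := X.prod Y) (Y := X.prod Y)))
    (isMorphism_fst.comp (isMorphism_snd (X := X.prod Y) (Y := X.prod Y)))
  have h2 := hY.isClosed_eq (isMorphism_snd.comp (isMorphism_fst (X := X.prod Y) (Y := X.prod Y)))
    (isMorphism_snd.comp (isMorphism_snd (X := X.prod Y) (Y := X.prod Y)))
  unfold IsSep
  convert h1.inter h2 using 1
  ext z
  exact Prod.ext_iff

theorem isSep_affine_fin (N : ℕ) : IsSep (affine (Fin N → ℂ)) := by
  refine isClosed_of_locally_zeros fun z => ⟨Set.univ, isOpen_univ, trivial, Fin N,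
    fun i z => z.1 i - z.2 i, fun i y _ => ?_, fun y _ => ?_⟩
  · exact regAt_sub ((isMorphism_fst.morAt y).regAt (regAt_dual (LinearMap.proj i) _))
      ((isMorphism_snd.morAt y).regAt (regAt_dual (LinearMap.proj i) _))
  · simp only [sub_eq_zero]
    exact funext_iff

theorem IsAffineVariety.isSep (hX : IsAffineVariety X) : IsSep X := by
  obtain ⟨N, Z, hZ, f, hf⟩ := hX
  exact ((isSep_affine_fin N).of_injective isMorphism_val Subtype.val_injective).of_injective hf.1
    hf.isHomeomorph.injective

theorem IsAffineVariety.isVariety (hX : IsAffineVariety X) : IsVariety X :=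
  ⟨hX.isSep, 1, fun _ => Set.univ, fun _ => ⟨isOpen_univ, hX.of_iso (iso_sub_univ X).symm⟩,
    Set.iUnion_const _⟩

theorem IsVariety.of_isIsom (hY : IsVariety Y) (h : Iso X Y) : IsVariety X := by
  obtain ⟨f, hf⟩ := h
  obtain ⟨h1, m, U, hU, hcov⟩ := hY
  refine ⟨IsSep.of_injective h1 hf.1 hf.isHomeomorph.injective, m, fun j => f ⁻¹' U j, fun j =>
    ⟨(hU j).1.preimage hf.1.1, (hU j).2.of_iso ⟨_, hf.sub fun x => Iff.rfl⟩⟩, ?_⟩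
  rw [← Set.preimage_iUnion, hcov, Set.preimage_univ]

theorem IsVariety.closed_sub (hX : IsVariety X) {S : Set X} (hS : IsClosed S) :
    IsVariety (X.sub S) := by
  obtain ⟨h1, m, U, hU, hcov⟩ := hX
  refine ⟨IsSep.of_injective h1 isMorphism_val Subtype.val_injective, m,
    fun j => {x | x.1 ∈ U j}, fun j => ⟨(hU j).1.preimage isMorphism_val.1, ?_⟩, ?_⟩
  · exact ((hU j).2.closed_sub (hS.preimage isMorphism_val.1)).of_iso iso_sub_sub'
  · ext x
    have : x.1 ∈ ⋃ j, U j := hcov ▸ trivial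
    simpa using this

theorem IsVariety.prod (hX : IsVariety X) (hY : IsVariety Y) : IsVariety (X.prod Y) := by
  obtain ⟨h1, m, U, hU, hcov⟩ := hX
  obtain ⟨h2, m', U', hU', hcov'⟩ := hY
  refine ⟨IsSep.prod h1 h2, m * m', fun j => {z | z.1 ∈ U (finProdFinEquiv.symm j).1 ∧
    z.2 ∈ U' (finProdFinEquiv.symm j).2}, fun j => ⟨?_, ?_⟩, ?_⟩
  · exact ((hU _).1.preimage isMorphism_fst.1).inter ((hU' _).1.preimage isMorphism_snd.1)
  · exact ((hU _).2.prod (hU' _).2).of_iso (iso_prod_sub _ _).symm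
  · ext z
    have h3 : z.1 ∈ ⋃ j, U j := hcov ▸ trivial
    have h4 : z.2 ∈ ⋃ j, U' j := hcov' ▸ trivial
    rw [Set.mem_iUnion] at h3 h4
    obtain ⟨a, ha⟩ := h3
    obtain ⟨b, hb⟩ := h4
    simp only [Set.mem_iUnion, Set.mem_univ, iff_true]
    exact ⟨finProdFinEquiv (a, b), by simpa using ha, by simpa using hb⟩

end Variety

/-! ### Local rings -/

section LocalRing

variable {X : FSpace.{u}} {Y : FSpace.{v}}

/-- Pull-back of germs along a local isomorphism. -/
theorem nonempty_localRing_equiv {f : X → Y} {x : X} (hf : MorAt f x)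
    (hemb : Filter.map f (𝓝 x) = 𝓝 (f x))
    (hinv : ∀ g : X → ℂ, X.RegAt g x → ∃ G, Y.RegAt G (f x) ∧ G ∘ f =ᶠ[𝓝 x] g) :
    Nonempty (Y.localRing (f x) ≃+* X.localRing x) := by
  let φ : Y.localRing (f x) →+* X.localRing x :=
    { toFun := fun g => ⟨g.1.compTendsto f hf.1, by
        obtain ⟨_, G, hG, rfl⟩ := g
        exact ⟨G ∘ f, hf.2 G hG, rfl⟩⟩
      map_one' := rfl
      map_zero' := rfl
      map_mul' := by
        rintro ⟨_, G, hG, rfl⟩ ⟨_, H, hH, rfl⟩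
        rfl
      map_add' := by
        rintro ⟨_, G, hG, rfl⟩ ⟨_, H, hH, rfl⟩
        rfl }
  refine ⟨RingEquiv.ofBijective φ ⟨?_, ?_⟩⟩
  · rintro ⟨_, G, hG, rfl⟩ ⟨_, H, hH, rfl⟩ h
    have h1 : G ∘ f =ᶠ[𝓝 x] H ∘ f := Filter.Germ.coe_eq.1 (Subtype.ext_iff.1 h)
    refine Subtype.ext (Filter.Germ.coe_eq.2 ?_)
    rw [← hemb]
    exact Filter.eventually_map.2 h1
  · rintro ⟨_, g, hg, rfl⟩
    obtain ⟨G, hG, h⟩ := hinv g hg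
    exact ⟨⟨_, G, hG, rfl⟩, Subtype.ext (Filter.Germ.coe_eq.2 h)⟩

theorem isRegularLocalRing_of_isIsom {f : X → Y} (hf : IsIsom f) {x : X}
    (h : IsRegularLocalRing (Y.localRing (f x))) : IsRegularLocalRing (X.localRing x) := by
  have hh := hf.isHomeomorph
  obtain ⟨hf, g, hg, h1, h2⟩ := hf
  obtain ⟨e⟩ := nonempty_localRing_equiv (hf.morAt x) (hh.isOpenEmbedding.map_nhds_eq x)
    (fun G hG => ⟨G ∘ g, (hg.morAt (f x)).2 G (by rwa [h1 x]), by
      simp [Function.comp_assoc, h1.comp_eq_id]⟩)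
  exact IsRegularLocalRing.of_ringEquiv e

theorem isRegularLocalRing_of_open {U : Set X} (hU : IsOpen U) {x : X.sub U}
    (h : IsRegularLocalRing ((X.sub U).localRing x)) : IsRegularLocalRing (X.localRing x.1) := by
  obtain ⟨e⟩ := nonempty_localRing_equiv (morAt_val x)
    (hU.isOpenEmbedding_subtypeVal.map_nhds_eq x)
    (fun G ⟨F, hF, h⟩ => ⟨F, hF, h.symm⟩)
  exact IsRegularLocalRing.of_ringEquiv e.symm

theorem IsSmooth.of_cover (h : ∀ x : X, ∃ U : Set X, IsOpen U ∧ x ∈ U ∧ ∃ Y : FSpace.{v},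
    IsSmooth Y ∧ Iso (X.sub U) Y) : IsSmooth X := by
  intro x
  obtain ⟨U, hU, hx, Y, hY, f, hf⟩ := h x
  exact isRegularLocalRing_of_open hU (x := ⟨x, hx⟩) (isRegularLocalRing_of_isIsom hf (hY _))

end LocalRing

end FSpace

/-! ### Dimension theory of finitely generated domains over a field -/

section Dimension

/-- All maximal ideals have height `d`. -/
def MaxHeights (A : Type*) [CommRing A] (d : ℕ) : Prop :=
  ∀ m : Ideal A, m.IsMaximal → m.height = d

theorem MaxHeights.of_ringEquiv {A B : Type*} [CommRing A] [CommRing B] {d : ℕ}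
    (h : MaxHeights A d) (e : A ≃+* B) : MaxHeights B d := by
  intro m hm
  rw [← e.height_comap m]
  exact h _ (Ideal.comap_isMaximal_of_equiv e)

theorem MaxHeights.unique {A : Type*} [CommRing A] [Nontrivial A] {d e : ℕ}
    (h : MaxHeights A d) (h' : MaxHeights A e) : d = e := by
  obtain ⟨m, hm⟩ := Ideal.exists_maximal A
  exact_mod_cast (h m hm).symm.trans (h' m hm)

theorem MaxHeights.ringKrullDim_le {A : Type*} [CommRing A] {d : ℕ} (h : MaxHeights A d) :
    ringKrullDim A ≤ d :=
  (ringKrullDim_le_iff_isMaximal_height_le _).2 fun m hm => by rw [h m hm]; rfl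

/-- Over a Jacobson ring a maximal ideal of the polynomial ring contracts to a maximal ideal, and
adjoining one variable raises the height by exactly one. -/
theorem maxHeights_mvPolynomial (k : Type*) [Field k] (n : ℕ) :
    MaxHeights (MvPolynomial (Fin n) k) n := by
  induction n with
  | zero =>
    intro m hm
    have e := MvPolynomial.isEmptyRingEquiv k (Fin 0)
    have h1 := e.symm.height_comap m
    have h2 : (m.comap e.symm) = ⊥ := by
      have := (Ideal.comap_isMaximal_of_equiv e.symm (p := m))
      exact (eq_bot_or_eq_top _).resolve_right this.ne_top
    rw [h2, Ideal.height_bot] at h1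
    rw [← h1]
    rfl
  | succ n ih =>
    refine MaxHeights.of_ringEquiv ?_ (MvPolynomial.finSuccEquiv k n).toRingEquiv.symm
    intro m hm
    have h1 : (m.under (MvPolynomial (Fin n) k)).IsMaximal :=
      Polynomial.isMaximal_comap_C_of_isJacobsonRing m
    rw [Polynomial.height_eq_height_add_one (m.under (MvPolynomial (Fin n) k)) m, ih _ h1]
    push_cast
    rfl

/-- Going-down writes the height of `m` as the height of its contraction plus the height of its
image in the fibre ring. The second term vanishes by incomparability: in an integral extension no
prime strictly below `m` has the same contraction. -/
theorem height_eq_of_isIntegral {B A : Type*} [CommRing B] [CommRing A] [IsDomain A] [Algebra B A]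
    [FaithfulSMul B A] [Algebra.IsIntegral B A] [IsIntegrallyClosed B] [IsNoetherianRing B]
    [IsNoetherianRing A] (m : Ideal A) [m.IsMaximal] : m.height = (m.under B).height := by
  have h := Ideal.height_eq_height_add_of_liesOver_of_hasGoingDown (m.under B) m
  rw [h]
  convert add_zero _
  set I := (m.under B).map (algebraMap B A)
  have hIm : I ≤ m := Ideal.map_comap_le
  have hmax : (m.map (Ideal.Quotient.mk I)).IsMaximal := by
    refine .map_of_surjective_of_ker_le Ideal.Quotient.mk_surjective ?_
    rwa [Ideal.mk_ker]
  rw [Ideal.height_eq_zero_iff]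
  refine ⟨⟨hmax.isPrime, bot_le⟩, fun q hq hqm => ?_⟩
  have hq' := hq.1
  have h1 : q.comap (Ideal.Quotient.mk I) ≤ m := by
    refine (Ideal.comap_mono hqm).trans ?_
    rw [Ideal.comap_map_of_surjective _ Ideal.Quotient.mk_surjective, ← RingHom.ker_eq_comap_bot,
      Ideal.mk_ker]
    exact sup_le le_rfl hIm
  have h2 : m.under B = (q.comap (Ideal.Quotient.mk I)).under B := by
    have hmm : (m.under B).IsMaximal := inferInstance
    refine hmm.eq_of_le (Ideal.IsPrime.ne_top inferInstance) ?_
    refine Ideal.le_comap_map.trans (Ideal.comap_mono ?_)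
    show I ≤ _
    rw [← Ideal.map_le_iff_le_comap]
    simp
  have h3 : q.comap (Ideal.Quotient.mk I) = m := by
    by_contra hne
    exact absurd h2 (Ideal.comap_lt_comap_of_integral_mem_sdiff h1
      (SetLike.exists_of_lt (lt_of_le_of_ne h1 hne)).choose_spec
      (Algebra.IsIntegral.isIntegral _)).ne'
  rw [← h3, Ideal.map_comap_of_surjective _ Ideal.Quotient.mk_surjective]

/-- Noether normalisation reduces to a polynomial ring, where all maximal ideals have the same
height. -/
theorem exists_maxHeights (k A : Type*) [Field k] [CommRing A] [IsDomain A] [Algebra k A]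
    [Algebra.FiniteType k A] : ∃ s, MaxHeights A s := by
  obtain ⟨s, g, hg, hg'⟩ := exists_integral_inj_algHom_of_fg k A
  have : IsNoetherianRing A := Algebra.FiniteType.isNoetherianRing k A
  refine ⟨s, fun m hm => ?_⟩
  algebraize [g.toRingHom]
  have : FaithfulSMul (MvPolynomial (Fin s) k) A := (faithfulSMul_iff_algebraMap_injective _ _).2 hg
  rw [height_eq_of_isIntegral (B := MvPolynomial (Fin s) k) m]
  exact maxHeights_mvPolynomial k s _ inferInstance

/-- The height of a maximal ideal drops by at most one modulo `a`. To compare `A / (a)` with `A /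
q`, a maximal ideal is chosen that lies on the component of `q` and on no other component of the
zero locus of `a`. -/
theorem maxHeights_le_succ_of_minimalPrimes {k A : Type*} [Field k] [CommRing A] [IsDomain A]
    [Algebra k A] [Algebra.FiniteType k A] {d e : ℕ} (hd : MaxHeights A d) {a : A}
    {q : Ideal A} (hq : q ∈ (Ideal.span {a}).minimalPrimes) (he : MaxHeights (A ⧸ q) e) :
    d ≤ e + 1 := by
  have : IsNoetherianRing A := Algebra.FiniteType.isNoetherianRing k A
  have : IsJacobsonRing A := isJacobsonRing_of_finiteType (A := k)
  have hqp : q.IsPrime := hq.1.1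
  have hfin := (Ideal.span {a}).finite_minimalPrimes_of_isNoetherianRing
  -- The element `g` lies in all other minimal primes over `a` but not in `q`; it serves to avoid
  -- the other components.
  obtain ⟨g, hg, hgq⟩ : ∃ g ∈ (hfin.toFinset.erase q).inf id, g ∉ q := by
    by_contra hcon
    push Not at hcon
    obtain ⟨q', hq', hle⟩ := (Ideal.IsPrime.inf_le' hqp).1 (show (hfin.toFinset.erase q).inf id ≤ q
      from hcon)
    rw [Finset.mem_erase, Set.Finite.mem_toFinset] at hq'
    exact hq'.1 (le_antisymm hle (hq.2 hq'.2.1 hle))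
  -- In a Jacobson ring `q` is the intersection of the maximal ideals above it, so one of them
  -- misses `g`.
  obtain ⟨m, hm, hqm, hgm⟩ : ∃ m : Ideal A, m.IsMaximal ∧ q ≤ m ∧ g ∉ m := by
    have h1 : q.jacobson = q := IsJacobsonRing.out ‹IsJacobsonRing A› hqp.isRadical
    rw [← h1, Ideal.jacobson, Ideal.mem_sInf] at hgq
    push Not at hgq
    obtain ⟨m, ⟨h2, h3⟩, h4⟩ := hgq
    exact ⟨m, h3, h2, h4⟩
  have ham : a ∈ m := hqm (hq.1.2 (Ideal.mem_span_singleton_self a))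
  have h1 := Ideal.height_le_height_add_one_of_mem ham
  rw [hd m hm] at h1
  set I := Ideal.span {a}
  have hmax : (m.map (Ideal.Quotient.mk I)).IsMaximal := by
    refine .map_of_surjective_of_ker_le Ideal.Quotient.mk_surjective ?_
    rw [Ideal.mk_ker]
    exact (Ideal.span_singleton_le_iff_mem _).2 ham
  have h2 : (m.map (Ideal.Quotient.mk I)).height ≤ e := by
    let M : PrimeSpectrum (A ⧸ I) := ⟨_, hmax.isPrime⟩
    have h3 : (Order.height M : WithBot ℕ∞) = Order.krullDim (Set.Iic M) :=
      Order.height_eq_krullDim_Iic M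
    have hcomap : m = (m.map (Ideal.Quotient.mk I)).comap (Ideal.Quotient.mk I) := by
      rw [Ideal.comap_map_of_surjective _ Ideal.Quotient.mk_surjective, ← RingHom.ker_eq_comap_bot,
        Ideal.mk_ker]
      exact (sup_eq_left.2 ((Ideal.span_singleton_le_iff_mem _).2 ham)).symm
    -- A prime below `m` that contains `a` contains a minimal prime over `a`; any such minimal prime
    -- other than `q` would force `g ∈ m`.
    have key : ∀ x : Set.Iic M, q ≤ x.1.asIdeal.comap (Ideal.Quotient.mk I) := by
      intro x
      have hI : I ≤ x.1.asIdeal.comap (Ideal.Quotient.mk I) := by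
        rw [← Ideal.map_le_iff_le_comap]
        simp
      obtain ⟨q', hq', hle⟩ := Ideal.exists_minimalPrimes_le hI
      by_cases hqq : q' = q
      · rwa [← hqq]
      · exfalso
        have h5 : q' ≤ m := by
          rw [hcomap]
          exact hle.trans (Ideal.comap_mono x.2)
        exact hgm (h5 ((Finset.inf_le (f := id) (Finset.mem_erase.2
          ⟨hqq, hfin.mem_toFinset.2 hq'⟩)) hg))
    let f : Set.Iic M → PrimeSpectrum (A ⧸ q) := fun x =>
      (Ideal.primeSpectrumQuotientOrderIsoZeroLocus q).symm
        ⟨PrimeSpectrum.comap (Ideal.Quotient.mk I) x.1, key x⟩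
    have hf : StrictMono f := by
      intro x y hxy
      refine (OrderIso.lt_iff_lt _).2 ?_
      exact RingHom.strictMono_comap_of_surjective Ideal.Quotient.mk_surjective hxy
    have h4 := (Order.krullDim_le_of_strictMono f hf).trans he.ringKrullDim_le
    rw [← h3, ← PrimeSpectrum.height_eq_orderHeight] at h4
    exact_mod_cast h4
  have h5 : (d : ℕ∞) ≤ e + 1 := h1.trans (by gcongr)
  exact_mod_cast h5

/-- A chain of primes from `q` to `p` can be extended below by the zero ideal. -/
theorem height_map_quotient_add_one_le {A : Type*} [CommRing A] [IsDomain A] [IsNoetherianRing A]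
    {p q : Ideal A} [p.IsPrime] [q.IsPrime] (hqp : q ≤ p) (hq : q ≠ ⊥) :
    (p.map (Ideal.Quotient.mk q)).height + 1 ≤ p.height := by
  have hP : (p.map (Ideal.Quotient.mk q)).IsPrime :=
    Ideal.map_isPrime_of_surjective Ideal.Quotient.mk_surjective (by rwa [Ideal.mk_ker])
  obtain ⟨l, hl, hlen⟩ := (p.map (Ideal.Quotient.mk q)).exists_ltSeries_length_eq_height
  let l' := l.map (PrimeSpectrum.comap (Ideal.Quotient.mk q))
    (RingHom.strictMono_comap_of_surjective Ideal.Quotient.mk_surjective)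
  have hbot : (⟨⊥, Ideal.isPrime_bot⟩ : PrimeSpectrum A) < l'.head := by
    rw [← PrimeSpectrum.asIdeal_lt_asIdeal]
    refine lt_of_lt_of_le (bot_lt_iff_ne_bot.2 hq) ?_
    show q ≤ (RelSeries.head l').asIdeal
    rw [LTSeries.head_map, PrimeSpectrum.comap_asIdeal, ← Ideal.map_le_iff_le_comap]
    simp
  have hlast : (l'.cons _ hbot).last = ⟨p, inferInstance⟩ := by
    rw [RelSeries.last_cons]
    show RelSeries.last l' = _
    rw [LTSeries.last_map, hl]
    ext1
    simp only [PrimeSpectrum.comap_asIdeal]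
    rw [Ideal.comap_map_of_surjective _ Ideal.Quotient.mk_surjective, ← RingHom.ker_eq_comap_bot,
      Ideal.mk_ker]
    exact sup_eq_left.2 hqp
  rw [← hlen, show p.height = Order.height (⟨p, inferInstance⟩ : PrimeSpectrum A) from
    PrimeSpectrum.height_eq_orderHeight ⟨p, inferInstance⟩, ← hlast]
  refine le_trans (le_of_eq ?_) (Order.length_le_height_last (p := l'.cons _ hbot))
  rw [RelSeries.cons_length]
  push_cast
  rfl

/-- Induction on a bound for the height, with the ring varying. Choose a non-zero `a` in `p` and a
minimal prime `q` over `a` inside `p`. In `A / q` the dimension has dropped by at most one, and the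
height of the image of `p` by at least one. -/
theorem le_height_add_maxHeights {k : Type*} [Field k] (n : ℕ) : ∀ {A : Type u} [CommRing A]
    [IsDomain A] [Algebra k A] [Algebra.FiniteType k A] {d e : ℕ}, MaxHeights A d →
    ∀ (p : Ideal A) [p.IsPrime], MaxHeights (A ⧸ p) e → p.height ≤ n →
      (d : ℕ∞) ≤ p.height + e := by
  induction n with
  | zero =>
    intro A _ _ _ _ d e hd p _ he hp
    have hbot : p = ⊥ := Ideal.height_eq_zero_iff_eq_bot.1 (le_antisymm (by simpa using hp) bot_le)
    subst hbot
    rw [(he.of_ringEquiv (RingEquiv.quotientBot A)).unique hd]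
    exact le_add_self
  | succ n ih =>
    intro A _ _ _ _ d e hd p _ he hp
    have : IsNoetherianRing A := Algebra.FiniteType.isNoetherianRing k A
    by_cases hbot : p = ⊥
    · subst hbot
      rw [(he.of_ringEquiv (RingEquiv.quotientBot A)).unique hd]
      exact le_add_self
    obtain ⟨a, hap, ha⟩ := Submodule.exists_mem_ne_zero_of_ne_bot hbot
    obtain ⟨q, hq, hqp⟩ := Ideal.exists_minimalPrimes_le
      ((Ideal.span_singleton_le_iff_mem p).2 hap)
    have hqprime : q.IsPrime := hq.1.1
    have hq0 : q ≠ ⊥ := fun h => ha (by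
      have := hq.1.2 (Ideal.mem_span_singleton_self a)
      rwa [h] at this)
    have hP : (p.map (Ideal.Quotient.mk q)).IsPrime :=
      Ideal.map_isPrime_of_surjective Ideal.Quotient.mk_surjective (by rwa [Ideal.mk_ker])
    have h1 := height_map_quotient_add_one_le hqp hq0
    obtain ⟨b, hb⟩ := exists_maxHeights k (A ⧸ q)
    have h2 := maxHeights_le_succ_of_minimalPrimes (k := k) hd hq hb
    have h3 : (p.map (Ideal.Quotient.mk q)).height ≤ n := by
      have := h1.trans hp
      push_cast at this
      exact (ENat.add_le_add_iff_right ENat.one_ne_top).1 this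
    have h4 := ih hb (p.map (Ideal.Quotient.mk q))
      (he.of_ringEquiv (DoubleQuot.quotQuotEquivQuotOfLE hqp).symm) h3
    calc (d : ℕ∞) ≤ b + 1 := by exact_mod_cast h2
      _ ≤ ((p.map (Ideal.Quotient.mk q)).height + e) + 1 := by gcongr
      _ = ((p.map (Ideal.Quotient.mk q)).height + 1) + e := by ring
      _ ≤ p.height + e := by gcongr

/-- One inequality joins a chain below `p` to a chain above `p` that ends in a maximal ideal; the
other is the preceding induction. -/
theorem height_add_maxHeights {k A : Type*} [Field k] [CommRing A]
    [IsDomain A] [Algebra k A] [Algebra.FiniteType k A] {d e : ℕ} (hd : MaxHeights A d)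
    (p : Ideal A) [p.IsPrime] (he : MaxHeights (A ⧸ p) e) : p.height + e = d := by
  have : IsNoetherianRing A := Algebra.FiniteType.isNoetherianRing k A
  refine le_antisymm ?_ ?_
  · obtain ⟨M, hM⟩ := Ideal.exists_maximal (A ⧸ p)
    rw [← he M hM]
    obtain ⟨lp, hlp, hlenp⟩ := p.exists_ltSeries_length_eq_height
    obtain ⟨lq, hlq, hlenq⟩ := M.exists_ltSeries_length_eq_height
    let l' := lq.map (PrimeSpectrum.comap (Ideal.Quotient.mk p))
      (RingHom.strictMono_comap_of_surjective Ideal.Quotient.mk_surjective)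
    have hm : (M.comap (Ideal.Quotient.mk p)).IsMaximal :=
      Ideal.comap_isMaximal_of_surjective _ Ideal.Quotient.mk_surjective
    have h1 : lp.last ≤ l'.head := by
      rw [hlp, ← PrimeSpectrum.asIdeal_le_asIdeal, LTSeries.head_map, PrimeSpectrum.comap_asIdeal,
        ← Ideal.map_le_iff_le_comap]
      simp
    rw [← hd _ hm, ← hlenp, ← hlenq]
    have h2 : l'.last = ⟨M.comap (Ideal.Quotient.mk p), hm.isPrime⟩ := by
      rw [LTSeries.last_map, hlq]
      rfl
    rw [show (M.comap (Ideal.Quotient.mk p)).height =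
      Order.height (⟨M.comap (Ideal.Quotient.mk p), hm.isPrime⟩ : PrimeSpectrum A) from
      PrimeSpectrum.height_eq_orderHeight ⟨_, hm.isPrime⟩, ← h2]
    have h3 : (lp.length : ℕ∞) ≤ Order.height l'.head :=
      (Order.length_le_height_last (p := lp)).trans (Order.height_mono h1)
    -- Chains are glued at a common endpoint, so `lp` is replaced by a chain of the same length that
    -- ends exactly at the head of `l'`.
    obtain ⟨lh, hlh, hlen⟩ := Order.exists_series_of_le_height _ h3
    have h4 := Order.length_le_height_last (p := lh.smash l' hlh)
    rw [RelSeries.last_smash] at h4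
    refine le_trans (le_of_eq ?_) h4
    rw [RelSeries.smash_length, hlen]
    push_cast
    rfl
  · obtain ⟨n, hn⟩ := ENat.ne_top_iff_exists.1 (Ideal.height_ne_top_of_isPrime (I := p))
    exact le_height_add_maxHeights (k := k) n hd p he hn.symm.le

end Dimension

/-! ### Affine varieties: closed sets, prime ideals, codimension -/

section Model

open TopologicalSpace

/-- `A` is the algebra of regular functions on the affine variety `Y` (described in terms of the
topological space). -/
structure IsAffineModel {Y : Type u} [TopologicalSpace Y] (A : Subalgebra ℂ (Y → ℂ)) : Prop where
  fg : Algebra.FiniteType ℂ A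
  closed : ∀ C : Set Y, IsClosed C ↔ ∀ x, x ∉ C → ∃ f ∈ A, f x ≠ 0 ∧ ∀ y ∈ C, f y = 0
  point : ∀ χ : A →ₐ[ℂ] ℂ, ∃ y, ∀ f : A, χ f = f.1 y

variable {Y : Type u} (A : Subalgebra ℂ (Y → ℂ))

/-- The ideal of functions vanishing on `S`. -/
def vIdeal (S : Set Y) : Ideal A where
  carrier := {f | ∀ y ∈ S, f.1 y = 0}
  add_mem' {f g} hf hg y hy := by
    show f.1 y + g.1 y = 0
    rw [hf y hy, hg y hy, add_zero]
  zero_mem' _ _ := rfl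
  smul_mem' c f hf y hy := by
    show c.1 y * f.1 y = 0
    rw [hf y hy, mul_zero]

/-- The zero locus of an ideal. -/
def zLocus (p : Ideal A) : Set Y := {y | ∀ f ∈ p, f.1 y = 0}

variable {A}

theorem mem_zLocus {p : Ideal A} {y : Y} : y ∈ zLocus A p ↔ ∀ f ∈ p, f.1 y = 0 := Iff.rfl

/-- Zariski's lemma: the residue field is finite over `ℂ`, hence equal to it. -/
theorem exists_algHom_of_isMaximal {B : Type*} [CommRing B] [Algebra ℂ B] [Algebra.FiniteType ℂ B]
    (M : Ideal B) [M.IsMaximal] : ∃ χ : B →ₐ[ℂ] ℂ, ∀ f, f ∈ M ↔ χ f = 0 := by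
  let _ := Ideal.Quotient.field M
  have hfin : Module.Finite ℂ (B ⧸ M) := finite_of_finite_type_of_isJacobsonRing ℂ (B ⧸ M)
  have hbij : Function.Bijective (algebraMap ℂ (B ⧸ M)) :=
    IsAlgClosed.algebraMap_bijective_of_isIntegral
  let e : ℂ ≃ₐ[ℂ] (B ⧸ M) := AlgEquiv.ofBijective (Algebra.ofId ℂ (B ⧸ M)) hbij
  refine ⟨e.symm.toAlgHom.comp (Ideal.Quotient.mkₐ ℂ M), fun f => ?_⟩
  show _ ↔ e.symm (Ideal.Quotient.mk M f) = 0
  rw [map_eq_zero_iff _ e.symm.injective, Ideal.Quotient.eq_zero_iff_mem]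

/-- Restriction of functions to a subset. -/
def restrictHom (S : Set Y) : (Y → ℂ) →ₐ[ℂ] (S → ℂ) where
  toFun f s := f s.1
  map_one' := rfl
  map_mul' _ _ := rfl
  map_zero' := rfl
  map_add' _ _ := rfl
  commutes' _ := rfl

theorem nonempty_quotient_equiv {Z : Set Y} :
    Nonempty ((A ⧸ vIdeal A Z) ≃+* A.map (restrictHom Z)) := by
  let r : A →ₐ[ℂ] A.map (restrictHom Z) :=
    ((restrictHom Z).comp A.val).codRestrict _ fun a => ⟨a.1, a.2, rfl⟩
  have hr : Function.Surjective r := by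
    rintro ⟨_, f, hf, rfl⟩
    exact ⟨⟨f, hf⟩, rfl⟩
  have hk : vIdeal A Z = RingHom.ker r := by
    ext f
    rw [RingHom.mem_ker]
    constructor
    · intro h
      exact Subtype.ext (funext fun z => h z.1 z.2)
    · intro h z hz
      exact congrFun (Subtype.ext_iff.1 h) ⟨z, hz⟩
  exact ⟨(Ideal.quotEquivOfEq hk).trans (RingHom.quotientKerEquivOfSurjective hr)⟩

variable [TopologicalSpace Y]

namespace IsAffineModel

theorem isClosed_zLocus (hA : IsAffineModel A) (p : Ideal A) : IsClosed (zLocus A p) := by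
  refine (hA.closed _).2 fun x hx => ?_
  rw [mem_zLocus] at hx
  push Not at hx
  obtain ⟨f, hf, hfx⟩ := hx
  exact ⟨f.1, f.2, hfx, fun y hy => hy f hf⟩

theorem zLocus_vIdeal (hA : IsAffineModel A) {C : Set Y} (hC : IsClosed C) :
    zLocus A (vIdeal A C) = C := by
  refine Set.Subset.antisymm (fun x hx => ?_) fun x hx f hf => hf x hx
  by_contra hcon
  obtain ⟨f, hf, hfx, hfC⟩ := (hA.closed C).1 hC x hcon
  exact hfx (hx ⟨f, hf⟩ hfC)

theorem exists_point (hA : IsAffineModel A) (M : Ideal A) [M.IsMaximal] :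
    ∃ y, ∀ f : A, f ∈ M ↔ f.1 y = 0 := by
  have := hA.fg
  obtain ⟨χ, hχ⟩ := exists_algHom_of_isMaximal M
  obtain ⟨y, hy⟩ := hA.point χ
  exact ⟨y, fun f => by rw [hχ, hy]⟩

/-- The Nullstellensatz for primes: in a Jacobson ring a prime is the intersection of the maximal
ideals above it, and each of these is the ideal of a point. -/
theorem vIdeal_zLocus (hA : IsAffineModel A) (p : Ideal A) [p.IsPrime] :
    vIdeal A (zLocus A p) = p := by
  have := hA.fg
  have hJ : IsJacobsonRing A := isJacobsonRing_of_finiteType (A := ℂ)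
  refine le_antisymm (fun f hf => ?_) fun f hf y hy => hy f hf
  rw [← IsJacobsonRing.out hJ (Ideal.IsPrime.isRadical (I := p) inferInstance), Ideal.jacobson,
    Ideal.mem_sInf]
  rintro M ⟨hpM, hM⟩
  obtain ⟨y, hy⟩ := hA.exists_point M
  exact (hy f).2 (hf y fun g hg => (hy g).1 (hpM hg))

theorem isPrime_vIdeal (hA : IsAffineModel A) {Z : Set Y} (hZ : IsIrreducible Z) :
    (vIdeal A Z).IsPrime := by
  refine ⟨?_, fun {f g} hfg => ?_⟩
  · rw [Ne, Ideal.eq_top_iff_one]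
    intro h
    obtain ⟨z, hz⟩ := hZ.nonempty
    exact one_ne_zero (α := ℂ) (h z hz)
  · have hc : ∀ f : A, IsClosed {y : Y | f.1 y = 0} := fun f =>
      (hA.closed _).2 fun x hx => ⟨f.1, f.2, hx, fun y hy => hy⟩
    rcases isPreirreducible_iff_isClosed_union_isClosed.1 hZ.isPreirreducible _ _ (hc f) (hc g)
      (fun z hz => mul_eq_zero.1 (hfg z hz)) with h | h
    · exact Or.inl h
    · exact Or.inr h

theorem isIrreducible_zLocus (hA : IsAffineModel A) (p : Ideal A) [hp : p.IsPrime] :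
    IsIrreducible (zLocus A p) := by
  have h0 := hA.vIdeal_zLocus p
  refine ⟨?_, isPreirreducible_iff_isClosed_union_isClosed.2 fun C D hC hD hCD => ?_⟩
  · rw [Set.nonempty_iff_ne_empty]
    intro h
    rw [h] at h0
    exact hp.ne_top (h0 ▸ (Ideal.eq_top_iff_one _).2 fun y hy => hy.elim)
  · by_contra hcon
    push Not at hcon
    obtain ⟨⟨x, hx, hxC⟩, ⟨y, hy, hyD⟩⟩ := Set.not_subset.1 hcon.1, Set.not_subset.1 hcon.2
    obtain ⟨f, hf, hfx, hfC⟩ := (hA.closed C).1 hC x hxC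
    obtain ⟨g, hg, hgy, hgD⟩ := (hA.closed D).1 hD y hyD
    have hmul : (⟨f, hf⟩ * ⟨g, hg⟩ : A) ∈ p := by
      rw [← h0]
      intro z hz
      show f z * g z = 0
      rcases hCD hz with h | h
      · rw [hfC z h, zero_mul]
      · rw [hgD z h, mul_zero]
    rcases hp.mem_or_mem hmul with h | h
    · exact hfx (hx _ h)
    · exact hgy (hy _ h)

/-- Irreducible closed subsets correspond to prime ideals. -/
def orderIso (hA : IsAffineModel A) : IrreducibleCloseds Y ≃o (PrimeSpectrum A)ᵒᵈ where
  toFun Z := OrderDual.toDual ⟨vIdeal A Z, hA.isPrime_vIdeal Z.isIrreducible⟩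
  invFun p := ⟨zLocus A (OrderDual.ofDual p).asIdeal, hA.isIrreducible_zLocus _,
    hA.isClosed_zLocus _⟩
  left_inv Z := IrreducibleCloseds.ext (hA.zLocus_vIdeal Z.isClosed)
  right_inv p := by
    show OrderDual.toDual _ = OrderDual.toDual (OrderDual.ofDual p)
    congr 1
    exact PrimeSpectrum.ext (hA.vIdeal_zLocus _)
  map_rel_iff' := by
    intro Z W
    constructor
    · intro h
      have h' : vIdeal A (W : Set Y) ≤ vIdeal A (Z : Set Y) := h
      show (Z : Set Y) ⊆ W
      rw [← hA.zLocus_vIdeal Z.isClosed, ← hA.zLocus_vIdeal W.isClosed]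
      exact fun y hy f hf => hy f (h' hf)
    · intro h f hf y hy
      exact hf y (h hy)

theorem coheight_eq (hA : IsAffineModel A) (Z : IrreducibleCloseds Y) :
    Order.coheight Z = (vIdeal A (Z : Set Y)).height := by
  rw [← Order.coheight_orderIso hA.orderIso Z]
  have := hA.isPrime_vIdeal Z.isIrreducible
  exact (PrimeSpectrum.height_eq_orderHeight ⟨vIdeal A (Z : Set Y), this⟩).symm

end IsAffineModel

/-- The closure of a point. -/
def ptClosure (y : Y) : IrreducibleCloseds Y :=
  ⟨closure {y}, isIrreducible_singleton.closure, isClosed_closure⟩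

variable (Y) in
/-- All points have codimension `d`. -/
def LocDim (d : ℕ) : Prop := ∀ y : Y, Order.coheight (ptClosure y) = d

/-- Codimension is insensitive to passing to an open neighbourhood. This is why dimension is
formulated by codimensions of points: the Krull dimension of a space can drop on an open subset. -/
theorem coheight_ptClosure_map {U : Type v} [TopologicalSpace U] {f : U → Y}
    (hf : IsOpenEmbedding f) (u : U) :
    Order.coheight (ptClosure (f u)) = Order.coheight (ptClosure u) := by
  rw [← hf.coheight_map (ptClosure u)]
  congr 1
  refine IrreducibleCloseds.ext ?_
  show closure {f u} = closure (f '' closure {u})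
  rw [closure_image_closure hf.continuous, Set.image_singleton]

theorem LocDim.of_isOpenEmbedding {U : Type v} [TopologicalSpace U] {f : U → Y}
    (hf : IsOpenEmbedding f) {d : ℕ} (h : LocDim Y d) : LocDim U d := fun u => by
  rw [← coheight_ptClosure_map hf]
  exact h _

theorem LocDim.of_cover {d : ℕ} (h : ∀ y : Y, ∃ (U : Type v) (_ : TopologicalSpace U)
    (f : U → Y), IsOpenEmbedding f ∧ y ∈ Set.range f ∧ LocDim U d) : LocDim Y d := fun y => by
  obtain ⟨U, _, f, hf, ⟨u, rfl⟩, hU⟩ := h y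
  rw [coheight_ptClosure_map hf]
  exact hU u

/-- Every irreducible closed set contains the closure of a point, so chains starting at point
closures are the longest ones. -/
theorem LocDim.topologicalKrullDim_eq [Nonempty Y] {d : ℕ} (h : LocDim Y d) :
    topologicalKrullDim Y = d := by
  refine le_antisymm ?_ ?_
  · rw [topologicalKrullDim, Order.krullDim_eq_iSup_coheight]
    refine iSup_le fun Z => ?_
    obtain ⟨z, hz⟩ := Z.isIrreducible.nonempty
    have h1 : ptClosure z ≤ Z :=
      closure_minimal (Set.singleton_subset_iff.2 hz) Z.isClosed
    have h2 := Order.coheight_anti h1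
    rw [h z] at h2
    exact_mod_cast h2
  · obtain ⟨y⟩ := ‹Nonempty Y›
    have := Order.coheight_le_krullDim (ptClosure y)
    rw [h y] at this
    exact_mod_cast this

theorem LocDim.unique [Nonempty Y] {d e : ℕ} (h : LocDim Y d) (h' : LocDim Y e) : d = e := by
  obtain ⟨y⟩ := ‹Nonempty Y›
  exact_mod_cast (h y).symm.trans (h' y)

namespace IsAffineModel

/-- For `f` in a maximal ideal `M` above it, `f - f(y)` vanishes on the closure and so lies in `M`.
Hence the constant `f(y)` lies in `M` and is zero. -/
theorem isMaximal_vIdeal_ptClosure (hA : IsAffineModel A) (y : Y) :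
    (vIdeal A (ptClosure y : Set Y)).IsMaximal := by
  have hprime := hA.isPrime_vIdeal (ptClosure y).isIrreducible
  obtain ⟨M, hM, hle⟩ := Ideal.exists_le_maximal _ hprime.ne_top
  convert hM
  refine le_antisymm hle fun f hf => ?_
  let c : A := algebraMap ℂ A (f.1 y)
  have hc : f - c ∈ vIdeal A (ptClosure y : Set Y) := by
    have hcl : IsClosed {z : Y | (f - c).1 z = 0} :=
      (hA.closed _).2 fun x hx => ⟨_, (f - c).2, hx, fun z hz => hz⟩
    exact closure_minimal (Set.singleton_subset_iff.2 (sub_self (f.1 y))) hcl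
  have h1 : c ∈ M := by
    have := M.sub_mem hf (hle hc)
    rwa [sub_sub_cancel] at this
  have h2 : f.1 y = 0 := by
    by_contra hne
    exact hM.ne_top (Ideal.eq_top_of_isUnit_mem M h1 ((IsUnit.mk0 _ hne).map (algebraMap ℂ A)))
  have h3 : c = 0 := by
    show algebraMap ℂ A (f.1 y) = 0
    rw [h2, map_zero]
  rwa [h3, sub_zero] at hc

theorem locDim_of_maxHeights (hA : IsAffineModel A) {d : ℕ} (h : MaxHeights A d) : LocDim Y d :=
  fun y => by rw [hA.coheight_eq]; exact h _ (hA.isMaximal_vIdeal_ptClosure y)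

theorem maxHeights_of_locDim (hA : IsAffineModel A) {d : ℕ} (h : LocDim Y d) : MaxHeights A d := by
  intro M hM
  obtain ⟨y, hy⟩ := hA.exists_point M
  rw [← h y, hA.coheight_eq]
  congr 1
  refine hM.eq_of_le (hA.isMaximal_vIdeal_ptClosure y).ne_top fun f hf => ?_
  have hcl : IsClosed {z : Y | f.1 z = 0} :=
    (hA.closed _).2 fun x hx => ⟨_, f.2, hx, fun z hz => hz⟩
  exact closure_minimal (Set.singleton_subset_iff.2 ((hy f).1 hf)) hcl

theorem isDomain [IrreducibleSpace Y] (hA : IsAffineModel A) : IsDomain A := by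
  have h := hA.isPrime_vIdeal (IrreducibleSpace.isIrreducible_univ Y)
  have h0 : vIdeal A (Set.univ : Set Y) = ⊥ := by
    rw [eq_bot_iff]
    exact fun f hf => Subtype.ext (funext fun y => hf y trivial)
  rw [h0] at h
  have := Ideal.Quotient.isDomain (⊥ : Ideal A)
  exact (RingEquiv.quotientBot A).symm.isDomain

theorem exists_locDim [IrreducibleSpace Y] (hA : IsAffineModel A) : ∃ d, LocDim Y d := by
  have := hA.isDomain
  have := hA.fg
  obtain ⟨d, hd⟩ := exists_maxHeights ℂ A
  exact ⟨d, hA.locDim_of_maxHeights hd⟩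

theorem restrict (hA : IsAffineModel A) {Z : Set Y} (hZ : IsClosed Z) :
    IsAffineModel (A.map (restrictHom Z)) := by
  have hfg := hA.fg
  refine ⟨?_, fun C => ⟨fun hC x hx => ?_, fun h => ?_⟩, fun χ => ?_⟩
  · let r : A →ₐ[ℂ] A.map (restrictHom Z) :=
      ((restrictHom Z).comp A.val).codRestrict _ fun a => ⟨a.1, a.2, rfl⟩
    refine hfg.of_surjective r ?_
    rintro ⟨_, f, hf, rfl⟩
    exact ⟨⟨f, hf⟩, rfl⟩
  · obtain ⟨f, hf, hfx, hfC⟩ := (hA.closed (Subtype.val '' C)).1 (hZ.isClosedMap_subtype_val _ hC)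
      x.1 (fun ⟨y, hy, h⟩ => hx (Subtype.ext h ▸ hy))
    exact ⟨_, ⟨f, hf, rfl⟩, hfx, fun y hy => hfC _ ⟨y, hy, rfl⟩⟩
  · rw [← isOpen_compl_iff, isOpen_iff_forall_mem_open]
    intro x hx
    obtain ⟨_, ⟨f, hf, rfl⟩, hfx, hfC⟩ := h x hx
    have hcl : IsClosed {z : Y | f z = 0} :=
      (hA.closed _).2 fun x hx => ⟨_, hf, hx, fun z hz => hz⟩
    exact ⟨{y : Z | f y.1 ≠ 0}, fun y hy hyC => hy (hfC y hyC),
      hcl.isOpen_compl.preimage continuous_subtype_val, hfx⟩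
  · let r : A →ₐ[ℂ] A.map (restrictHom Z) :=
      ((restrictHom Z).comp A.val).codRestrict _ fun a => ⟨a.1, a.2, rfl⟩
    obtain ⟨y, hy⟩ := hA.point (χ.comp r)
    -- Composed with restriction, the character is evaluation at some point `y` of `Y`. It kills all
    -- functions that vanish on `Z`, so `y` lies on the closed set `Z`.
    have hyZ : y ∈ Z := by
      rw [← hA.zLocus_vIdeal hZ]
      intro f hf
      rw [← hy f]
      have : r f = 0 := Subtype.ext (funext fun z => hf z.1 z.2)
      show χ (r f) = 0
      rw [this, map_zero]
    refine ⟨⟨y, hyZ⟩, ?_⟩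
    rintro ⟨_, f, hf, rfl⟩
    exact hy ⟨f, hf⟩

/-- The codimension formula. -/
theorem coheight_add [IrreducibleSpace Y] (hA : IsAffineModel A) {d e : ℕ} (hd : LocDim Y d)
    (Z : IrreducibleCloseds Y) (he : LocDim (Z : Set Y) e) : Order.coheight Z + e = d := by
  have := hA.isDomain
  have := hA.fg
  have := hA.isPrime_vIdeal Z.isIrreducible
  obtain ⟨i⟩ := nonempty_quotient_equiv (A := A) (Z := (Z : Set Y))
  rw [hA.coheight_eq]
  exact height_add_maxHeights (k := ℂ) (hA.maxHeights_of_locDim hd) _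
    (((hA.restrict Z.isClosed).maxHeights_of_locDim he).of_ringEquiv i.symm)

end IsAffineModel

end Model

/-! ### Affine space: polynomial functions, dimension, irreducibility, smoothness -/

namespace FSpace

section AffineSpace

variable {E : Type u} [AddCommGroup E] [Module ℂ E]

/-- Polynomials as functions on `E`, by means of a basis. -/
def polyMap {ι : Type*} (b : Basis ι ℂ E) : MvPolynomial ι ℂ →ₐ[ℂ] (E → ℂ) :=
  MvPolynomial.aeval fun i v => b.repr v i

theorem polyMap_apply {ι : Type*} (b : Basis ι ℂ E) (p : MvPolynomial ι ℂ) (v : E) :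
    polyMap b p v = MvPolynomial.eval (fun i => b.repr v i) p := by
  have : ((Pi.evalAlgHom ℂ (fun _ : E => ℂ) v).comp (polyMap b)) =
      MvPolynomial.aeval fun i => b.repr v i := by
    ext i
    simp [polyMap]
  have h := congrArg (fun f => f p) this
  simpa [MvPolynomial.aeval_eq_eval] using h

theorem polyMap_injective {ι : Type*} [Finite ι] (b : Basis ι ℂ E) :
    Function.Injective (polyMap b) := by
  intro p q h
  refine MvPolynomial.funext fun x => ?_
  have h1 := congrFun h (b.equivFun.symm x)
  rw [polyMap_apply, polyMap_apply] at h1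
  have h2 : (fun i => b.repr (b.equivFun.symm x) i) = x := b.equivFun.apply_symm_apply x
  rwa [h2] at h1

theorem range_polyMap {ι : Type*} [Finite ι] (b : Basis ι ℂ E) :
    (polyMap b).range = polyFun E := by
  have := Fintype.ofFinite ι
  rw [polyMap, ← Algebra.adjoin_range_eq_range_aeval]
  refine le_antisymm (Algebra.adjoin_mono ?_) (Algebra.adjoin_le ?_)
  · rintro _ ⟨i, rfl⟩
    exact ⟨b.coord i, rfl⟩
  · rintro _ ⟨φ, rfl⟩
    have : (φ : E → ℂ) = ∑ i, φ (b i) • fun v => b.repr v i := by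
      funext v
      conv_lhs => rw [← b.sum_repr v]
      rw [map_sum, Finset.sum_apply]
      exact Finset.sum_congr rfl fun i _ => by
        rw [map_smul, Pi.smul_apply, smul_eq_mul, smul_eq_mul, mul_comm]
    refine (congrArg (· ∈ Algebra.adjoin ℂ _) this).mpr <| Subalgebra.sum_mem _ fun i _ => Subalgebra.smul_mem _ ?_ _
    exact Algebra.subset_adjoin ⟨i, rfl⟩

theorem exists_polyMap_eq {ι : Type*} [Finite ι] (b : Basis ι ℂ E) {f : E → ℂ}
    (hf : f ∈ polyFun E) : ∃ p, polyMap b p = f := by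
  rw [← range_polyMap b] at hf
  exact hf

theorem polyMap_mem {ι : Type*} [Finite ι] (b : Basis ι ℂ E) (p : MvPolynomial ι ℂ) :
    polyMap b p ∈ polyFun E := by
  rw [← range_polyMap b]
  exact ⟨p, rfl⟩

/-- The algebra of polynomial functions is a polynomial algebra. -/
def polyEquiv {ι : Type*} [Finite ι] (b : Basis ι ℂ E) : MvPolynomial ι ℂ ≃ₐ[ℂ] polyFun E :=
  (AlgEquiv.ofInjective (polyMap b) (polyMap_injective b)).trans
    (Subalgebra.equivOfEq _ _ (range_polyMap b))

/-- The topology is only generated by non-vanishing loci; induction on the generation shows that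
these are a basis, a product of functions taking care of an intersection. -/
theorem exists_polyFun_of_isOpen {U : Set (affine E)} (hU : IsOpen U) :
    ∀ x ∈ U, ∃ f ∈ polyFun E, f x ≠ 0 ∧ ∀ y, y ∉ U → f y = 0 := by
  induction hU with
  | basic s hs =>
    obtain ⟨_, h, hh, rfl⟩ := hs
    exact fun x hx => ⟨h, hh, hx.2, fun y hy => by_contra fun hn => hy ⟨trivial, hn⟩⟩
  | univ => exact fun x _ => ⟨1, one_mem _, one_ne_zero (α := ℂ), fun y hy => (hy trivial).elim⟩
  | inter s t _ _ hs ht =>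
    intro x hx
    obtain ⟨f, hf, hfx, hfs⟩ := hs x hx.1
    obtain ⟨g, hg, hgx, hgs⟩ := ht x hx.2
    refine ⟨f * g, mul_mem hf hg, mul_ne_zero hfx hgx, fun y hy => ?_⟩
    by_cases h : y ∈ s
    · exact mul_eq_zero_of_right _ (hgs y fun h' => hy ⟨h, h'⟩)
    · exact mul_eq_zero_of_left (hfs y h) _
  | sUnion S _ ih =>
    rintro x ⟨s, hs, hx⟩
    obtain ⟨f, hf, hfx, hfs⟩ := ih s hs x hx
    exact ⟨f, hf, hfx, fun y hy => hfs y fun h => hy ⟨s, hs, h⟩⟩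

variable [FiniteDimensional ℂ E]

variable (E) in
theorem isAffineModel_affine : @IsAffineModel E (affine E).top (polyFun E) := by
  let _ : TopologicalSpace E := (affine E).top
  refine ⟨?_, fun C => ⟨fun hC x hx => ?_, fun h => ?_⟩, fun χ => ?_⟩
  · exact Algebra.FiniteType.equiv inferInstance (polyEquiv (finBasis ℂ E))
  · obtain ⟨f, hf, hfx, hfC⟩ := exists_polyFun_of_isOpen hC.isOpen_compl x hx
    exact ⟨f, hf, hfx, fun y hy => hfC y fun h => h hy⟩
  · refine isClosed_of_local fun x hx => ?_
    obtain ⟨f, hf, hfx, hfC⟩ := h x hx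
    exact ⟨{y | f y ≠ 0}, isOpen_ne_zero fun y => regAt_polyFun hf y, hfx,
      fun y hy hyC => hy (hfC y hyC)⟩
  -- Restricted to linear forms, a character is an element of the double dual, hence evaluation at a
  -- vector; the two characters then agree on all polynomials.
  · let ψ : Dual ℂ (Dual ℂ E) :=
      { toFun := fun φ => χ ⟨φ, Algebra.subset_adjoin ⟨φ, rfl⟩⟩
        map_add' := fun φ φ' => by
          rw [← map_add]
          rfl
        map_smul' := fun c φ => by
          rw [RingHom.id_apply, ← map_smul]
          rfl }
    obtain ⟨y, hy⟩ := (evalEquiv ℂ E).surjective ψ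
    have key : ∀ f (hf : f ∈ polyFun E), χ ⟨f, hf⟩ = f y := by
      intro f hf
      induction hf using Algebra.adjoin_induction with
      | mem f hf =>
        obtain ⟨φ, rfl⟩ := hf
        exact (LinearMap.congr_fun hy φ).symm
      | algebraMap c => exact χ.commutes c
      | add f g hf hg h1 h2 =>
        show _ = f y + g y
        rw [← h1, ← h2, ← map_add]
        rfl
      | mul f g hf hg h1 h2 =>
        show _ = f y * g y
        rw [← h1, ← h2, ← map_mul]
        rfl
    exact ⟨y, fun f => key f.1 f.2⟩

theorem isAffineModel_sub {Z : Set (affine E)} (hZ : IsClosed Z) :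
    @IsAffineModel (Z : Set E) ((affine E).sub Z).top ((polyFun E).map (restrictHom (Z : Set E))) :=
  @IsAffineModel.restrict E _ (affine E).top (isAffineModel_affine E) Z hZ

variable (E)

theorem maxHeights_polyFun : MaxHeights (polyFun E) (finrank ℂ E) :=
  (maxHeights_mvPolynomial ℂ _).of_ringEquiv (polyEquiv (finBasis ℂ E)).toRingEquiv

theorem locDim_affine : LocDim (affine E) (finrank ℂ E) :=
  @IsAffineModel.locDim_of_maxHeights E _ (affine E).top (isAffineModel_affine E) _
    (maxHeights_polyFun E)

theorem irreducibleSpace_affine : IrreducibleSpace (affine E) := by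
  have : IsDomain (polyFun E) := (polyEquiv (finBasis ℂ E)).symm.toMulEquiv.isDomain _
  let _ : TopologicalSpace E := (affine E).top
  have h := (isAffineModel_affine E).isIrreducible_zLocus (⊥ : Ideal (polyFun E))
  have h0 : zLocus (polyFun E) (⊥ : Ideal (polyFun E)) = Set.univ := by
    refine Set.eq_univ_of_forall fun y f hf => ?_
    have : f = 0 := hf
    rw [this]
    rfl
  rw [h0] at h
  have h1 : @PreirreducibleSpace E (affine E).top := ⟨h.isPreirreducible⟩
  exact @IrreducibleSpace.mk E (affine E).top h1 ⟨0⟩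

/-- The local ring is the localisation of a polynomial ring at the kernel of evaluation at the
point, and polynomial rings over a field are regular. -/
theorem isSmooth_affine : IsSmooth (affine E) := by
  intro x
  let b := finBasis ℂ E
  let R := MvPolynomial (Fin (finrank ℂ E)) ℂ
  let P : Ideal R := RingHom.ker (MvPolynomial.eval fun i => b.repr x i)
  have hP : P.IsPrime := RingHom.ker_isPrime _
  let ev : R → (affine E → ℂ) := fun p => polyMap b p
  have hPx : ∀ p : R, p ∈ P ↔ ev p x = 0 := fun p =>
    RingHom.mem_ker.trans (iff_of_eq (congrArg (· = 0) (polyMap_apply b p x).symm))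
  have hreg : ∀ p : R, (affine E).RegAt (ev p) x := fun p => regAt_polyFun (polyMap_mem b p) x
  have hmul : ∀ p q : R, ev (p * q) = ev p * ev q := map_mul (polyMap b)
  let φ : R →+* (affine E).localRing x :=
    { toFun := fun p => ⟨_, ev p, hreg p, rfl⟩
      map_one' := Subtype.ext (congrArg (fun f : affine E → ℂ => (f : Filter.Germ (𝓝 x) ℂ))
        (map_one (polyMap b)))
      map_zero' := Subtype.ext (congrArg (fun f : affine E → ℂ => (f : Filter.Germ (𝓝 x) ℂ))
        (map_zero (polyMap b)))
      map_mul' := fun p q => Subtype.ext (congrArg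
        (fun f : affine E → ℂ => (f : Filter.Germ (𝓝 x) ℂ)) (hmul p q))
      map_add' := fun p q => Subtype.ext (congrArg
        (fun f : affine E → ℂ => (f : Filter.Germ (𝓝 x) ℂ)) (map_add (polyMap b) p q)) }
  algebraize [φ]
  have hloc : IsLocalization.AtPrime ((affine E).localRing x) P := by
    refine ⟨?_, ?_, ?_⟩
    · rintro ⟨p, hp⟩
      have hp0 : ev p x ≠ 0 := fun h => hp ((hPx p).2 h)
      refine IsUnit.of_mul_eq_one
        (⟨_, (ev p)⁻¹, (affine E).regAt_inv (hreg p) hp0, rfl⟩ :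
        (affine E).localRing x) (Subtype.ext (Filter.Germ.coe_eq.2 ?_))
      filter_upwards [(affine E).eventually_ne (hreg p) hp0] with y hy
      exact mul_inv_cancel₀ hy
    · rintro ⟨_, f, ⟨i, -, a, ha, c, hc, hcx, hf⟩, rfl⟩
      obtain ⟨p, hp⟩ := exists_polyMap_eq b ha
      obtain ⟨q, hq⟩ := exists_polyMap_eq b hc
      subst hp
      subst hq
      refine ⟨⟨p, q, fun h => hcx ((hPx q).1 h)⟩, Subtype.ext (Filter.Germ.coe_eq.2 ?_)⟩
      filter_upwards [hf, (affine E).eventually_ne (hreg q) hcx] with y hy hy'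
      show f y * ev q y = ev p y
      rw [hy]
      exact div_mul_cancel₀ _ hy'
    · intro p q h
      have h1 : ev p =ᶠ[𝓝 x] ev q := Filter.Germ.coe_eq.1 (Subtype.ext_iff.1 h)
      -- Polynomials with the same germ agree on an open `U`. Multiplying by a polynomial that
      -- vanishes off `U` but not at `x` makes them equal everywhere.
      obtain ⟨U, hU, hUo, hxU⟩ := eventually_nhds_iff.1 h1
      obtain ⟨f, hf, hfx, hfU⟩ := exists_polyFun_of_isOpen hUo x hxU
      obtain ⟨c, rfl⟩ := exists_polyMap_eq b hf
      refine ⟨⟨c, fun h => hfx ((hPx c).1 h)⟩, polyMap_injective b ?_⟩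
      refine (hmul c p).trans (Eq.trans (funext fun y => ?_) (hmul c q).symm)
      show ev c y * ev p y = ev c y * ev q y
      by_cases hy : y ∈ U
      · exact congrArg (ev c y * ·) (hU y hy)
      · have : ev c y = 0 := hfU y hy
        rw [this, zero_mul, zero_mul]
  have hreg : IsRegularLocalRing (Localization.AtPrime P) :=
    IsRegularRing.isRegularLocalRing_localization P
  exact IsRegularLocalRing.of_ringEquiv
    (IsLocalization.algEquiv P.primeCompl (Localization.AtPrime P)
      ((affine E).localRing x)).toRingEquiv

end AffineSpace

section Dim

variable {X : FSpace.{u}} {Y : FSpace.{v}}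

theorem hasDim_of_locDim [Nonempty X] {d : ℕ} {m : ℤ} (h : LocDim X d) (hm : (d : ℤ) = m) :
    HasDim X m := ⟨d, hm, h.topologicalKrullDim_eq⟩

theorem locDim_of_iso {d : ℕ} (h : Iso X Y) (hY : LocDim Y d) : LocDim X d := by
  obtain ⟨f, hf⟩ := h
  exact hY.of_isOpenEmbedding hf.isHomeomorph.isOpenEmbedding

theorem locDim_of_cover {d : ℕ} (h : ∀ x : X, ∃ U : Set X, IsOpen U ∧ x ∈ U ∧
    LocDim (X.sub U) d) : LocDim X d := by
  refine LocDim.of_cover fun x => ?_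
  obtain ⟨U, hU, hx, hd⟩ := h x
  exact ⟨U, _, Subtype.val, hU.isOpenEmbedding_subtypeVal, ⟨⟨x, hx⟩, rfl⟩, hd⟩

theorem locDim_open {d : ℕ} (h : LocDim X d) {U : Set X} (hU : IsOpen U) : LocDim (X.sub U) d :=
  h.of_isOpenEmbedding hU.isOpenEmbedding_subtypeVal

end Dim

end FSpace

/-! ### Elimination theory -/

namespace FSpace

section Elimination

open MvPolynomial

variable {σ ι : Type*} [Fintype σ]

/-- Evaluation of polynomials whose coefficients are polynomials. -/
def eval₂C (F : MvPolynomial σ (MvPolynomial ι ℂ)) (v : σ → ℂ) (t : ι → ℂ) : ℂ :=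
  eval v (map (eval t) F)

omit [Fintype σ] in
theorem homogeneousComponent_map {R S : Type*} [CommSemiring R] [CommSemiring S] (φ : R →+* S)
    (d : ℕ) (F : MvPolynomial σ R) :
    homogeneousComponent d (map φ F) = map φ (homogeneousComponent d F) := by
  ext m
  rw [coeff_homogeneousComponent, coeff_map, coeff_map, coeff_homogeneousComponent]
  split_ifs <;> simp

theorem eval_smul_of_isHomogeneous {F : MvPolynomial σ ℂ} {d : ℕ} (hF : F.IsHomogeneous d) (c : ℂ)
    (v : σ → ℂ) : eval (c • v) F = c ^ d * eval v F := by
  rw [eval_eq', eval_eq', Finset.mul_sum]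
  refine Finset.sum_congr rfl fun m hm => ?_
  have h1 := hF (mem_support_iff.1 hm)
  rw [Finsupp.weight_apply, Finsupp.sum_fintype _ _ (by simp)] at h1
  simp only [Pi.smul_apply, smul_eq_mul, mul_pow, Finset.prod_mul_distrib, Finset.prod_pow_eq_pow_sum]
  have h2 : ∑ i, m i = d := by simpa using h1
  rw [h2]
  ring

/-- The value at `c • v` is a polynomial in `c` whose coefficients are the values of the homogeneous
components at `v`. A polynomial that vanishes on all of `ℂ` is zero. -/
theorem eval_homogeneousComponent_eq_zero {F : MvPolynomial σ ℂ} {v : σ → ℂ}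
    (h : ∀ c : ℂ, eval (c • v) F = 0) (d : ℕ) : eval v (homogeneousComponent d F) = 0 := by
  by_cases hd : F.totalDegree < d
  · rw [homogeneousComponent_eq_zero _ _ hd, map_zero]
  let p : Polynomial ℂ := ∑ i ∈ Finset.range (F.totalDegree + 1),
    Polynomial.C (eval v (homogeneousComponent i F)) * Polynomial.X ^ i
  have hp : p = 0 := by
    refine Polynomial.funext fun c => ?_
    rw [Polynomial.eval_zero, ← h c]
    conv_rhs => rw [← sum_homogeneousComponent F]
    rw [map_sum, Polynomial.eval_finsetSum]
    refine Finset.sum_congr rfl fun i _ => ?_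
    rw [eval_smul_of_isHomogeneous (homogeneousComponent_isHomogeneous i F)]
    rw [Polynomial.eval_mul, Polynomial.eval_C, Polynomial.eval_pow, Polynomial.eval_X, mul_comm]
  have h1 := congrArg (fun q => Polynomial.coeff q d) hp
  simpa [p, Polynomial.finsetSum_coeff, Polynomial.coeff_C_mul, Polynomial.coeff_X_pow,
    Nat.lt_succ_iff.2 (not_lt.1 hd)] using h1

variable {E : Type u} [AddCommGroup E] [Module ℂ E]

theorem exists_eval₂C_eq {N : ℕ} [Finite ι] (b : Basis ι ℂ E) {f : (Fin N → ℂ) × E → ℂ}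
    (hf : f ∈ polyFun ((Fin N → ℂ) × E)) :
    ∃ F : MvPolynomial (Fin N) (MvPolynomial ι ℂ),
      ∀ v e, f (v, e) = eval₂C F v (fun i => b.repr e i) := by
  have := Fintype.ofFinite ι
  induction hf using Algebra.adjoin_induction with
  | mem f hf =>
    obtain ⟨φ, rfl⟩ := hf
    refine ⟨∑ i, C (C (φ (Pi.single i 1, 0))) * X i + C (∑ j, C (φ (0, b j)) * X j),
      fun v e => ?_⟩
    have h1 : (v, e) = ∑ i, v i • ((Pi.single i 1 : Fin N → ℂ), (0 : E)) +
        ∑ j, b.repr e j • ((0 : Fin N → ℂ), b j) := by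
      have h2 : v = ∑ i, v i • (Pi.single i 1 : Fin N → ℂ) := by
        conv_lhs => rw [← (Pi.basisFun ℂ (Fin N)).sum_repr v]
        simp
      refine Prod.ext ?_ ?_
      · simpa [Prod.fst_sum, Prod.snd_sum] using h2
      · simp [Prod.snd_sum, b.sum_repr]
    show φ (v, e) = _
    rw [h1, map_add, map_sum, map_sum]
    simp only [map_smul, smul_eq_mul]
    simp [eval₂C, mul_comm]
  | algebraMap c => exact ⟨C (C c), fun v e => by simp [eval₂C]⟩
  | add f g hf hg h1 h2 =>
    obtain ⟨F, hF⟩ := h1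
    obtain ⟨G, hG⟩ := h2
    refine ⟨F + G, fun v e => ?_⟩
    rw [Pi.add_apply, hF, hG]
    simp [eval₂C]
  | mul f g hf hg h1 h2 =>
    obtain ⟨F, hF⟩ := h1
    obtain ⟨G, hG⟩ := h2
    refine ⟨F * G, fun v e => ?_⟩
    rw [Pi.mul_apply, hF, hG]
    simp [eval₂C]

/-- A power of the irrelevant ideal is contained in every ideal without non-trivial zeros. -/
theorem exists_monomial_mem {J : Ideal (MvPolynomial σ ℂ)}
    (h : ∀ v : σ → ℂ, (∀ F ∈ J, eval v F = 0) → v = 0) :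
    ∃ D : ℕ, 0 < D ∧ ∀ m : σ →₀ ℕ, ∑ i, m i = D → monomial m (1 : ℂ) ∈ J := by
  have h1 : ∀ i : σ, ∃ k : ℕ, (X i : MvPolynomial σ ℂ) ^ k ∈ J := by
    intro i
    have h2 : (X i : MvPolynomial σ ℂ) ∈ vanishingIdeal ℂ (zeroLocus ℂ J) := by
      intro v hv
      have : v = 0 := h v fun F hF => by simpa [aeval_eq_eval] using hv F hF
      simp [this]
    rw [vanishingIdeal_zeroLocus_eq_radical] at h2
    exact h2
  choose k hk using h1
  -- In this degree some exponent of a monomial reaches the corresponding `k i`. The summand `1`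
  -- also makes the degree positive.
  refine ⟨∑ i, k i + 1, Nat.succ_pos _, fun m hm => ?_⟩
  obtain ⟨i, hi⟩ : ∃ i, k i ≤ m i := by
    by_contra hcon
    push Not at hcon
    have := Finset.sum_le_sum fun i (_ : i ∈ Finset.univ) => (hcon i).le
    omega
  rw [monomial_eq, C_1, one_mul, Finsupp.prod_fintype _ _ (by simp)]
  refine Ideal.mem_of_dvd _ ((pow_dvd_pow _ hi).trans
    (Finset.dvd_prod_of_mem (fun j => (X j : MvPolynomial σ ℂ) ^ m j) (Finset.mem_univ i))) (hk i)

/-- The main theorem of elimination theory. -/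
theorem isClosed_elimination {N : ℕ} [FiniteDimensional ℂ E] {K : Set (affine ((Fin N → ℂ) × E))}
    (hK : IsClosed K)
    (hsmul : ∀ (c : ℂ) (v : Fin N → ℂ) (e : E), ((v, e) : (Fin N → ℂ) × E) ∈ K →
      ((c • v, e) : (Fin N → ℂ) × E) ∈ K) :
    IsClosed {e : affine E | ∃ v : Fin N → ℂ, v ≠ 0 ∧ ((v, e) : (Fin N → ℂ) × E) ∈ K} := by
  refine isClosed_of_local fun (e₀ : E) he₀ => ?_
  let b := finBasis ℂ E
  let co : E → Fin (finrank ℂ E) → ℂ := fun e i => b.repr e i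
  let I : Ideal (MvPolynomial (Fin N) (MvPolynomial (Fin (finrank ℂ E)) ℂ)) :=
    { carrier := {F | ∀ v e, ((v, e) : (Fin N → ℂ) × E) ∈ K → eval₂C F v (co e) = 0}
      add_mem' := fun {F G} hF hG v e h => by
        have h1 := hF v e h
        have h2 := hG v e h
        unfold eval₂C at h1 h2 ⊢
        rw [map_add, map_add, h1, h2, add_zero]
      zero_mem' := fun v e h => by simp [eval₂C]
      smul_mem' := fun c F hF v e h => by
        have h1 := hF v e h
        unfold eval₂C at h1 ⊢
        rw [smul_eq_mul, map_mul, map_mul, h1, mul_zero] }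
  have hI : ∀ F, F ∈ I ↔ ∀ v e, ((v, e) : (Fin N → ℂ) × E) ∈ K → eval₂C F v (co e) = 0 :=
    fun F => Iff.rfl
  -- As `K` is a cone in the first variable, the ideal of `K` is homogeneous in it.
  have hIhom : ∀ F ∈ I, ∀ d, homogeneousComponent d F ∈ I := by
    intro F hF d v e h
    show eval v (map (eval (co e)) (homogeneousComponent d F)) = 0
    rw [← homogeneousComponent_map]
    exact eval_homogeneousComponent_eq_zero (fun c => hF _ e (hsmul c v e h)) d
  let φ : MvPolynomial (Fin N) (MvPolynomial (Fin (finrank ℂ E)) ℂ) →+* MvPolynomial (Fin N) ℂ :=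
    map (eval (co e₀))
  have hφ : Function.Surjective φ := map_surjective _ fun c => ⟨C c, by simp⟩
  -- Since the fibre over `e₀` has no non-zero point, the ideal specialised at `e₀` has no
  -- non-trivial zero, hence contains all monomials of some degree `D`.
  obtain ⟨D, hD0, hD⟩ := exists_monomial_mem (J := I.map φ) (fun v hv => by
    by_contra hv0
    refine he₀ ⟨v, hv0, ?_⟩
    by_contra hvK
    obtain ⟨f, hf, hfv, hfK⟩ := exists_polyFun_of_isOpen hK.isOpen_compl _ hvK
    obtain ⟨F, hF⟩ := exists_eval₂C_eq b hf
    refine hfv ((hF v e₀).trans (hv (φ F) (Ideal.mem_map_of_mem φ fun v' e' h' => ?_)))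
    rw [← hF]
    exact hfK _ fun h => h h')
  let s := Finset.finsuppAntidiag (Finset.univ : Finset (Fin N)) D
  have hs : ∀ m, m ∈ s ↔ ∑ i, m i = D := fun m => by simp [s, Finset.mem_finsuppAntidiag]
  -- Each of these monomials lifts to an element of the ideal of `K`; taking a component makes the
  -- lift homogeneous of degree `D`.
  have key : ∀ m : s, ∃ G ∈ I, G.IsHomogeneous D ∧ φ G = monomial m.1 1 := by
    intro m
    obtain ⟨F, hF, hFm⟩ := (Ideal.mem_map_iff_of_surjective φ hφ).1 (hD m.1 ((hs _).1 m.2))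
    refine ⟨homogeneousComponent D F, hIhom F hF D, homogeneousComponent_isHomogeneous D F, ?_⟩
    show map _ _ = _
    rw [← homogeneousComponent_map]
    show homogeneousComponent D (φ F) = _
    rw [hFm]
    refine homogeneousComponent_eq_self (isHomogeneous_monomial _ ?_)
    rw [Finsupp.degree_apply, Finset.sum_subset (Finset.subset_univ _) (by simp)]
    exact (hs _).1 m.2
  choose G hGI hGh hGφ using key
  -- The coefficient matrix of the lifts is the identity at `e₀`, so it stays invertible on a
  -- neighbourhood.
  let M : E → Matrix s s ℂ := fun e => Matrix.of fun m m' => eval (co e) (coeff m'.1 (G m))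
  have hM : ∀ e, (affine E).RegAt (fun e => (M e).det) e := fun e =>
    regAt_det fun m m' => by
      have h1 := regAt_polyFun (polyMap_mem b (coeff m'.1 (G m))) e
      have h2 : (polyMap b (coeff m'.1 (G m)) : E → ℂ) = fun e => M e m m' :=
        funext fun e => polyMap_apply b _ e
      exact h2 ▸ h1
  have hM1 : M e₀ = 1 := by
    ext m m'
    have h1 := congrArg (coeff m'.1) (hGφ m)
    rw [show φ (G m) = map (eval (co e₀)) (G m) from rfl, coeff_map, coeff_monomial] at h1
    show eval (co e₀) (coeff m'.1 (G m)) = _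
    rw [h1, Matrix.one_apply]
    simp only [Subtype.ext_iff]
  have hMe₀ : (M e₀).det ≠ 0 := by rw [hM1, Matrix.det_one]; exact one_ne_zero
  refine ⟨{e | (M e).det ≠ 0}, isOpen_ne_zero hM, hMe₀, ?_⟩
  rintro e he ⟨v, hv, hvK⟩
  -- At a point of `K` over `e` the lifts vanish, that is, `M e` kills the vector of monomials of
  -- degree `D` in `v`. Invertibility makes all of them zero, among them the powers `v i ^ D`.
  have h1 : (M e).mulVec (fun m : s => ∏ i, v i ^ m.1 i) = 0 := by
    funext m
    have h2 := hGI m v e hvK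
    rw [eval₂C, eval_eq'] at h2
    rw [Pi.zero_apply, ← h2, Matrix.mulVec, dotProduct]
    have hsub : (map (eval (co e)) (G m)).support ⊆ s := by
      intro m' hm'
      have h3 := ((hGh m).map (eval (co e))) (mem_support_iff.1 hm')
      rw [Finsupp.weight_apply, Finsupp.sum_fintype _ _ (by simp)] at h3
      exact (hs _).2 (by simpa using h3)
    rw [Finset.sum_subset hsub fun m' _ hm' => by rw [notMem_support_iff.1 hm', zero_mul],
      ← Finset.sum_coe_sort s]
    refine Finset.sum_congr rfl fun m' _ => ?_
    rw [coeff_map]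
    rfl
  have h2 := Matrix.eq_zero_of_mulVec_eq_zero he h1
  refine hv (funext fun i => ?_)
  have h3 := congrFun h2 ⟨Finsupp.single i D, (hs _).2 (by simp [Finsupp.single_apply])⟩
  rw [Pi.zero_apply, Finset.prod_eq_single i (fun j _ hj => by
    rw [Finsupp.single_eq_of_ne hj, pow_zero]) (by simp),
    Finsupp.single_eq_same] at h3
  exact pow_eq_zero_iff hD0.ne' |>.1 h3

end Elimination

end FSpace

/-! ### Cones and projective space -/

namespace FSpace

theorem morAt_of_nhds {X : FSpace.{u}} {Y : FSpace.{v}} {U : Set X} {f : X → Y} {z : X.sub U}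
    (hU : U ∈ 𝓝 z.1) (h : MorAt (fun y : X.sub U => f y.1) z) : MorAt f z.1 := by
  obtain ⟨O, hOU, hO, hz⟩ := mem_nhds_iff.1 hU
  let i : X.sub O → X.sub U := fun y => ⟨y.1, hOU y.2⟩
  have hi : MorAt i ⟨z.1, hz⟩ := morAt_sub_iff.2 (morAt_val _)
  exact morAt_of_open hO (z := ⟨z.1, hz⟩) (MorAt.comp (f := i) h hi)

/-- The projection of a cone along a projective space is closed. -/
theorem isClosed_cone_projection {E : Type u} [AddCommGroup E] [Module ℂ E] [FiniteDimensional ℂ E]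
    {N : ℕ} {C D : Set (affine ((Fin N → ℂ) × E))} (hD : IsClosed D)
    (hCD : ∀ (v : Fin N → ℂ) (e : E), v ≠ 0 →
      (((v, e) : (Fin N → ℂ) × E) ∈ C ↔ ((v, e) : (Fin N → ℂ) × E) ∈ D))
    (hsmul : ∀ (c : ℂ) (v : Fin N → ℂ) (e : E), c ≠ 0 → v ≠ 0 → ((v, e) : (Fin N → ℂ) × E) ∈ C →
      ((c • v, e) : (Fin N → ℂ) × E) ∈ C) :
    IsClosed {e : affine E | ∃ v : Fin N → ℂ, v ≠ 0 ∧ ((v, e) : (Fin N → ℂ) × E) ∈ C} := by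
  have h0 : IsClosed {z : affine ((Fin N → ℂ) × E) | (z : (Fin N → ℂ) × E).1 = 0} := by
    refine isClosed_of_locally_zeros fun z => ⟨Set.univ, isOpen_univ, trivial, Fin N,
      fun i z => (z : (Fin N → ℂ) × E).1 i, fun i y _ => ?_, fun y _ => ?_⟩
    · exact regAt_dual (LinearMap.proj i ∘ₗ LinearMap.fst ℂ (Fin N → ℂ) E) y
    · exact funext_iff (f := (y : (Fin N → ℂ) × E).1) (g := 0)
  -- The closed set `D` is controlled only away from `v = 0`. Adding the locus `v = 0` gives a
  -- closed cone with the same non-zero points.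
  have h1 := isClosed_elimination (hD.union h0) (fun c v e h => by
    by_cases hc : c = 0
    · right
      show c • v = 0
      rw [hc, zero_smul]
    by_cases hv : v = 0
    · right
      show c • v = 0
      rw [hv, smul_zero]
    · left
      refine (hCD _ _ (smul_ne_zero hc hv)).1 (hsmul c v e hc hv ((hCD v e hv).2 ?_))
      exact h.resolve_right hv)
  convert h1 using 1
  ext e
  refine exists_congr fun v => and_congr_right fun hv => ?_
  rw [hCD v e hv]
  exact ⟨Or.inl, fun h => h.resolve_right hv⟩

section Projective

variable {N : ℕ}

/-- The ratio of two homogeneous coordinates. -/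
def ratio (a j : Fin (N + 1)) (y : projectiveSpace N) : ℂ :=
  Projectivization.rep (K := ℂ) (V := Fin (N + 1) → ℂ) y a /
    Projectivization.rep (K := ℂ) (V := Fin (N + 1) → ℂ) y j

/-- The point of projective space with given homogeneous coordinates. -/
def pmk (v : Fin (N + 1) → ℂ) (hv : v ≠ 0) : projectiveSpace N := Projectivization.mk ℂ v hv

/-- The chart where a coordinate does not vanish. -/
def pchart (j : Fin (N + 1)) : Set (projectiveSpace N) := {y | ratio j j y ≠ 0}

theorem pmk_surjective (y : projectiveSpace N) : ∃ v hv, pmk v hv = y :=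
  ⟨_, Projectivization.rep_nonzero _, Projectivization.mk_rep (K := ℂ) (V := Fin (N + 1) → ℂ) y⟩

theorem pmk_eq_iff {v w : Fin (N + 1) → ℂ} {hv : v ≠ 0} {hw : w ≠ 0} :
    pmk v hv = pmk w hw ↔ ∃ c : ℂ, c ≠ 0 ∧ w = c • v := by
  refine (Projectivization.mk_eq_mk_iff' ℂ v w hv hw).trans ⟨?_, ?_⟩
  · rintro ⟨c, rfl⟩
    have hc : c ≠ 0 := fun h => hv (by rw [h, zero_smul])
    exact ⟨c⁻¹, inv_ne_zero hc, by rw [smul_smul, inv_mul_cancel₀ hc, one_smul]⟩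
  · rintro ⟨c, hc, rfl⟩
    exact ⟨c⁻¹, by rw [smul_smul, inv_mul_cancel₀ hc, one_smul]⟩

theorem ratio_pmk (a j : Fin (N + 1)) (v : Fin (N + 1) → ℂ) (hv : v ≠ 0) :
    ratio a j (pmk v hv) = v a / v j := by
  obtain ⟨c, hc⟩ := Projectivization.exists_smul_eq_mk_rep ℂ v hv
  unfold ratio pmk
  rw [← hc]
  show (c : ℂ) * v a / ((c : ℂ) * v j) = _
  exact mul_div_mul_left _ _ c.ne_zero

/-- With division by zero equal to zero, the ratio of a coordinate by itself is `1` or `0` and so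
detects whether it vanishes. -/
theorem pmk_mem_pchart {j : Fin (N + 1)} {v : Fin (N + 1) → ℂ} {hv : v ≠ 0} :
    pmk v hv ∈ pchart j ↔ v j ≠ 0 := by
  show ratio j j (pmk v hv) ≠ 0 ↔ _
  rw [ratio_pmk]
  by_cases h : v j = 0 <;> simp [h]

theorem isMorphism_pmk : IsMorphism (X := (affine (Fin (N + 1) → ℂ)).sub
    {v : Fin (N + 1) → ℂ | v ≠ 0}) (Y := projectiveSpace N) (fun v => pmk v.1 v.2) :=
  isMorphism_quotient_mk

theorem isOpen_ne_zero_affine : IsOpen (X := affine (Fin (N + 1) → ℂ))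
    {v : Fin (N + 1) → ℂ | v ≠ 0} := by
  have : {v : Fin (N + 1) → ℂ | v ≠ 0} = ⋃ i, {v : Fin (N + 1) → ℂ | v i ≠ 0} := by
    ext v
    simp [funext_iff]
  exact this ▸ isOpen_iUnion (X := affine (Fin (N + 1) → ℂ)) fun i =>
    isOpen_ne_zero fun v => regAt_dual (LinearMap.proj i) v

theorem regAt_coord {S : Set (affine (Fin (N + 1) → ℂ))} (i : Fin (N + 1))
    (v : (affine (Fin (N + 1) → ℂ)).sub S) :
    ((affine (Fin (N + 1) → ℂ)).sub S).RegAt (fun w => (w.1 : Fin (N + 1) → ℂ) i) v :=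
  (morAt_val v).regAt (regAt_dual (LinearMap.proj i) _)

theorem isOpen_pchart (j : Fin (N + 1)) : IsOpen (pchart j) := by
  refine isOpen_quotient.2 ?_
  have h : (Projectivization.mk' ℂ (V := Fin (N + 1) → ℂ)) ⁻¹' (pchart j) =
      {v | v.1 j ≠ 0} := Set.ext fun v => pmk_mem_pchart
  exact h ▸ isOpen_ne_zero fun v => regAt_coord j v

theorem regAt_ratio (a j : Fin (N + 1)) {y : projectiveSpace N} (hy : y ∈ pchart j) :
    (projectiveSpace N).RegAt (ratio a j) y := by
  refine regAt_quotient (isOpen_pchart j) (fun x hx => ?_) hy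
  have hx' := pmk_mem_pchart.1 hx
  have h : (fun v : (affine (Fin (N + 1) → ℂ)).sub {v : Fin (N + 1) → ℂ | v ≠ 0} =>
      ratio a j (pmk v.1 v.2)) = fun v => (v.1 : Fin (N + 1) → ℂ) a / (v.1 : Fin (N + 1) → ℂ) j :=
    funext fun v => ratio_pmk a j v.1 v.2
  exact h ▸ regAt_div (regAt_coord a x) (regAt_coord j x) hx'

theorem exists_mem_pchart (y : projectiveSpace N) : ∃ j, y ∈ pchart j := by
  obtain ⟨v, hv, rfl⟩ := pmk_surjective y
  simp only [pmk_mem_pchart]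
  exact Function.ne_iff.1 hv

theorem ratio_self {j : Fin (N + 1)} {y : projectiveSpace N} (hy : y ∈ pchart j) :
    ratio j j y = 1 := by
  obtain ⟨v, hv, rfl⟩ := pmk_surjective y
  rw [ratio_pmk, div_self (pmk_mem_pchart.1 hy)]

theorem ratio_ne_zero {j : Fin (N + 1)} {y : projectiveSpace N} (hy : y ∈ pchart j) :
    (fun a => ratio a j y) ≠ 0 := fun h => by
  have := congrFun h j
  rw [ratio_self hy] at this
  exact one_ne_zero this

theorem pmk_ratio {j : Fin (N + 1)} {y : projectiveSpace N} (hy : y ∈ pchart j) :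
    pmk (fun a => ratio a j y) (ratio_ne_zero hy) = y := by
  obtain ⟨v, hv, rfl⟩ := pmk_surjective y
  refine pmk_eq_iff.2 ⟨v j, pmk_mem_pchart.1 hy, ?_⟩
  funext a
  rw [Pi.smul_apply, ratio_pmk, smul_eq_mul, mul_div_cancel₀ _ (pmk_mem_pchart.1 hy)]

/-- Proportionality is the vanishing of the two-by-two minors. Two different charts are allowed
because a pair of points need not be seen in a common one; this gives the equations of the diagonal.
-/
theorem eq_iff_ratio {j k : Fin (N + 1)} {y z : projectiveSpace N} (hy : y ∈ pchart j)
    (hz : z ∈ pchart k) :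
    y = z ↔ ∀ i : Fin (N + 1) × Fin (N + 1),
      ratio i.1 j y * ratio i.2 k z - ratio i.2 j y * ratio i.1 k z = 0 := by
  obtain ⟨v, hv, rfl⟩ := pmk_surjective y
  obtain ⟨w, hw, rfl⟩ := pmk_surjective z
  have hvj := pmk_mem_pchart.1 hy
  have hwk := pmk_mem_pchart.1 hz
  simp only [ratio_pmk]
  constructor
  · rw [pmk_eq_iff]
    rintro ⟨c, hc, rfl⟩ i
    simp only [Pi.smul_apply, smul_eq_mul]
    ring
  · intro h
    have h1 : ∀ a b, v a * w b = v b * w a := by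
      intro a b
      have := h (a, b)
      simp only at this
      field_simp at this
      linear_combination this
    have h2 : w j ≠ 0 := by
      intro h0
      have := h1 k j
      rw [h0, mul_zero] at this
      exact mul_ne_zero hvj hwk this.symm
    refine pmk_eq_iff.2 ⟨w j / v j, div_ne_zero h2 hvj, funext fun a => ?_⟩
    rw [Pi.smul_apply, smul_eq_mul]
    field_simp
    linear_combination h1 j a

theorem isSep_projectiveSpace : IsSep (projectiveSpace N) := by
  refine isClosed_of_locally_zeros fun z => ?_
  obtain ⟨j, hj⟩ := exists_mem_pchart z.1
  obtain ⟨k, hk⟩ := exists_mem_pchart z.2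
  refine ⟨{z | z.1 ∈ pchart j ∧ z.2 ∈ pchart k},
    ((isOpen_pchart j).preimage isMorphism_fst.1).inter ((isOpen_pchart k).preimage isMorphism_snd.1),
    ⟨hj, hk⟩, Fin (N + 1) × Fin (N + 1), fun i z =>
      ratio i.1 j z.1 * ratio i.2 k z.2 - ratio i.2 j z.1 * ratio i.1 k z.2, fun i y hy => ?_,
    fun y hy => eq_iff_ratio hy.1 hy.2⟩
  have h1 : ∀ a, ((projectiveSpace N).prod (projectiveSpace N)).RegAt
      (fun z => ratio a j z.1) y := fun a => (isMorphism_fst.morAt y).regAt (regAt_ratio a j hy.1)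
  have h2 : ∀ a, ((projectiveSpace N).prod (projectiveSpace N)).RegAt
      (fun z => ratio a k z.2) y := fun a => (isMorphism_snd.morAt y).regAt (regAt_ratio a k hy.2)
  exact regAt_sub (regAt_mul' (h1 _) (h2 _)) (regAt_mul' (h1 _) (h2 _))

/-- Maps to projective space given by homogeneous coordinates. -/
theorem morAt_projectiveSpace {X : FSpace.{u}} {f : X → projectiveSpace N}
    {g : X → Fin (N + 1) → ℂ} {x : X} (hg : ∀ i, X.RegAt (fun y => g y i) x) (hx : g x ≠ 0)
    (hf : ∀ y (hy : g y ≠ 0), f y = pmk (g y) hy) : MorAt f x := by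
  have hg' : MorAt (Y := affine (Fin (N + 1) → ℂ)) g x := morAt_affine_pi.2 hg
  refine morAt_of_nhds (U := {y | g y ≠ 0}) (z := ⟨x, hx⟩)
    (hg'.1.preimage_mem_nhds (isOpen_ne_zero_affine.mem_nhds hx)) ?_
  have h1 : MorAt (X := X.sub {y | g y ≠ 0}) (Y := (affine (Fin (N + 1) → ℂ)).sub
      {v : Fin (N + 1) → ℂ | v ≠ 0}) (fun y => ⟨g y.1, y.2⟩) ⟨x, hx⟩ :=
    morAt_sub_iff.2 (MorAt.restrict (S := {y | g y ≠ 0}) (z := ⟨x, hx⟩) hg')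
  refine ((isMorphism_pmk.morAt _).comp h1).congr (Filter.Eventually.of_forall fun y => ?_)
  exact (hf y.1 y.2).symm

/-- A chart is identified with the hyperplane `v j = 1` of the space of homogeneous coordinates,
which avoids renumbering the remaining ones. -/
theorem isVariety_projectiveSpace : IsVariety (projectiveSpace N) := by
  refine ⟨isSep_projectiveSpace, N + 1, pchart, fun j => ⟨isOpen_pchart j, ?_⟩,
    Set.eq_univ_of_forall fun y => Set.mem_iUnion.2 (exists_mem_pchart y)⟩
  let Z : Set (affine (Fin (N + 1) → ℂ)) := {v : Fin (N + 1) → ℂ | v j = 1}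
  have hZ : IsClosed Z := by
    refine isClosed_of_locally_zeros fun z => ⟨Set.univ, isOpen_univ, trivial, Unit,
      fun _ v => (v : Fin (N + 1) → ℂ) j - 1, fun _ y _ => ?_, fun y _ => ?_⟩
    · exact regAt_sub (regAt_dual (LinearMap.proj j) y) (FSpace.regAt_const _ 1 y)
    · rw [forall_const, sub_eq_zero]
      rfl
  have hne : ∀ v : Fin (N + 1) → ℂ, v j = 1 → v ≠ 0 := fun v hv h => by
    rw [h] at hv
    exact zero_ne_one hv
  refine (isAffineVariety_closed hZ).of_iso ⟨fun y => ⟨fun a => ratio a j y.1, ratio_self y.2⟩,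
    .mk' (g := fun v => ⟨pmk v.1 (hne _ v.2), pmk_mem_pchart.2 (by
      have h : (v.1 : Fin (N + 1) → ℂ) j = 1 := v.2
      rw [h]
      exact one_ne_zero)⟩) ?_ ?_ ?_ ?_⟩
  · refine isMorphism_sub_iff.2 (isMorphism_iff.2 fun y => morAt_affine_pi.2 fun a => ?_)
    exact (morAt_val y).regAt (regAt_ratio a j y.2)
  · refine isMorphism_sub_iff.2 (isMorphism_iff.2 fun v => morAt_projectiveSpace
      (X := (affine (Fin (N + 1) → ℂ)).sub Z) (g := fun v => v.1) (fun i => regAt_coord i v) (hne _ v.2) fun y hy => rfl)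
  · exact fun y => Subtype.ext (pmk_ratio y.2)
  · rintro ⟨v, hv⟩
    refine Subtype.ext (funext fun a => ?_)
    have h : (v : Fin (N + 1) → ℂ) j = 1 := hv
    exact (ratio_pmk a j v _).trans (by rw [h, div_one])

end Projective

end FSpace

/-! ### Linear algebra: normalised matrices and adapted bases -/

section LinearAlgebra

/-- Indices below `D`. -/
abbrev Ix (d D : ℕ) : Type := {j : Fin d // (j : ℕ) < D}

/-- The matrix with the same column space as `G` in which the rows `p` form an identity matrix. -/
def nrm {J I : Type*} [Fintype I] [DecidableEq I] (p : I → J) (G : Matrix J I ℂ) : Matrix J I ℂ :=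
  G * (G.submatrix p id)⁻¹

theorem submatrix_mul {J I K : Type*} [Fintype I] (G : Matrix J I ℂ) (T : Matrix I I ℂ) (p : K → J) :
    (G * T).submatrix p id = G.submatrix p id * T := by
  ext i j
  rfl

section nrm

variable {J I : Type*} [Fintype I] [DecidableEq I] {p : I → J} {G : Matrix J I ℂ}

theorem nrm_submatrix (h : (G.submatrix p id).det ≠ 0) : (nrm p G).submatrix p id = 1 := by
  have h1 : (nrm p G).submatrix p id = G.submatrix p id * (G.submatrix p id)⁻¹ := by
    ext i j
    rfl
  rw [h1, Matrix.mul_nonsing_inv _ (isUnit_iff_ne_zero.2 h)]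

theorem nrm_apply (h : (G.submatrix p id).det ≠ 0) (a c : I) :
    nrm p G (p a) c = if a = c then 1 else 0 := by
  have := congrFun (congrFun (nrm_submatrix h) a) c
  rwa [Matrix.one_apply] at this

/-- Right multiplication by `T` changes the basis of the column space, and the two occurrences of
`T` cancel. So normalisation depends on the column space only. -/
theorem nrm_mul {T : Matrix I I ℂ} (hT : T.det ≠ 0) : nrm p (G * T) = nrm p G := by
  rw [nrm, nrm, submatrix_mul, Matrix.mul_inv_rev, Matrix.mul_assoc, ← Matrix.mul_assoc T,
    Matrix.mul_nonsing_inv _ (isUnit_iff_ne_zero.2 hT), Matrix.one_mul]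

/-- A vector of the column space is determined by its entries in the rows `p`. -/
theorem mulVec_eq_nrm (h : (G.submatrix p id).det ≠ 0) {x : I → ℂ} {a : I}
    (hx : ∀ c, G.mulVec x (p c) = if c = a then 1 else 0) (m : J) :
    G.mulVec x m = nrm p G m a := by
  have h1 : (G.submatrix p id).mulVec x = Pi.single a 1 := by
    funext c
    rw [Pi.single_apply]
    exact hx c
  have h2 : x = (G.submatrix p id)⁻¹.mulVec (Pi.single a 1) := by
    rw [← h1, Matrix.mulVec_mulVec, Matrix.nonsing_inv_mul _ (isUnit_iff_ne_zero.2 h),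
      Matrix.one_mulVec]
  conv_lhs => rw [h2]
  rw [Matrix.mulVec_mulVec, Matrix.mulVec_single_one]
  rfl

end nrm

variable {W : Type u} [AddCommGroup W] [Module ℂ W] {d : ℕ}

/-- The matrix of the first `D` vectors of a family. -/
def colMat (β : Basis (Fin d) ℂ W) (b : Fin d → W) (D : ℕ) : Matrix (Fin d) (Ix d D) ℂ :=
  Matrix.of fun m c => β.repr (b c.1) m

theorem colMat_mulVec (β : Basis (Fin d) ℂ W) (b : Fin d → W) (D : ℕ) (x : Ix d D → ℂ)
    (m : Fin d) : (colMat β b D).mulVec x m = β.repr (∑ c, x c • b c.1) m := by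
  simp [colMat, Matrix.mulVec, dotProduct, map_sum, Finsupp.finsetSum_apply, mul_comm]

theorem mem_span_lt {b : Fin d → W} {D : ℕ} {w : W} :
    w ∈ Submodule.span ℂ (b '' {j | (j : ℕ) < D}) ↔ ∃ x : Ix d D → ℂ, ∑ c, x c • b c.1 = w := by
  have h : b '' {j | (j : ℕ) < D} = Set.range fun c : Ix d D => b c.1 := by
    ext y
    constructor
    · rintro ⟨j, hj, rfl⟩
      exact ⟨⟨j, hj⟩, rfl⟩
    · rintro ⟨c, rfl⟩
      exact ⟨c.1, c.2, rfl⟩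
  rw [h, Submodule.mem_span_range_iff_exists_fun]

theorem mem_span_lt_iff_repr (B : Basis (Fin d) ℂ W) {D : ℕ} {w : W} :
    w ∈ Submodule.span ℂ (B '' {j | (j : ℕ) < D}) ↔ ∀ m : Fin d, D ≤ m → B.repr w m = 0 := by
  rw [B.mem_span_image]
  constructor
  · intro h m hm
    by_contra hne
    have h1 : (m : ℕ) < D := h (Finsupp.mem_support_iff.2 hne)
    omega
  · intro h m hm
    by_contra hne
    exact (Finsupp.mem_support_iff.1 hm) (h m (not_lt.1 hne))

theorem sum_Ix {M : Type*} [AddCommMonoid M] {D : ℕ} (f : Fin d → M)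
    (h : ∀ m : Fin d, D ≤ m → f m = 0) : ∑ c : Ix d D, f c.1 = ∑ m, f m := by
  rw [← Finset.sum_subtype (Finset.univ.filter fun m : Fin d => (m : ℕ) < D) (by simp)]
  refine Finset.sum_subset (Finset.subset_univ _) fun m _ hm => h m ?_
  simpa using hm

/-- Equality of the spans makes all coordinates of index at least `D` vanish, so the truncated base
change matrices in the two directions are inverse to each other. -/
theorem exists_colMat_eq_mul (β B B' : Basis (Fin d) ℂ W) {D : ℕ}
    (h : Submodule.span ℂ (B '' {j | (j : ℕ) < D}) = Submodule.span ℂ (B' '' {j | (j : ℕ) < D})) :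
    ∃ T : Matrix (Ix d D) (Ix d D) ℂ, T.det ≠ 0 ∧ colMat β B' D = colMat β B D * T := by
  let T : Matrix (Ix d D) (Ix d D) ℂ := Matrix.of fun c c' => B.repr (B' c'.1) c.1
  let T' : Matrix (Ix d D) (Ix d D) ℂ := Matrix.of fun c c' => B'.repr (B c'.1) c.1
  have h1 : ∀ c : Ix d D, ∀ m : Fin d, D ≤ m → B.repr (B' c.1) m = 0 := fun c =>
    (mem_span_lt_iff_repr B).1 (h ▸ Submodule.subset_span ⟨c.1, c.2, rfl⟩)
  have hexp : ∀ c : Ix d D, ∑ c' : Ix d D, B.repr (B' c.1) c'.1 • B c'.1 = B' c.1 := fun c => by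
    rw [sum_Ix (fun m => B.repr (B' c.1) m • B m) fun m hm => by rw [h1 c m hm, zero_smul]]
    exact B.sum_repr _
  have hexp' : ∀ c : Ix d D, ∑ c' : Ix d D, B'.repr (B c.1) c'.1 • B' c'.1 = B c.1 := fun c => by
    rw [sum_Ix (fun m => B'.repr (B c.1) m • B' m) fun m hm => by
      rw [(mem_span_lt_iff_repr B').1 (h ▸ Submodule.subset_span ⟨c.1, c.2, rfl⟩) m hm, zero_smul]]
    exact B'.sum_repr _
  have hTT : T * T' = 1 := by
    ext a c
    have h2 := congrArg (fun w => B.repr w a.1) (hexp' c)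
    simp only [map_sum, map_smul, Finsupp.finsetSum_apply, Finsupp.smul_apply, smul_eq_mul,
      Basis.repr_self, Finsupp.single_apply] at h2
    simp only [T, T', Matrix.mul_apply, Matrix.of_apply, Matrix.one_apply]
    rw [show (if a = c then (1 : ℂ) else 0) = if c.1 = a.1 then 1 else 0 by
      simp only [Subtype.ext_iff, eq_comm], ← h2]
    exact Finset.sum_congr rfl fun _ _ => mul_comm _ _
  refine ⟨T, fun h0 => ?_, ?_⟩
  · have := congrArg Matrix.det hTT
    rw [Matrix.det_mul, h0, zero_mul, Matrix.det_one] at this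
    exact zero_ne_one this
  · ext m c
    have h2 := congrArg (fun w => β.repr w m) (hexp c)
    simp only [map_sum, map_smul, Finsupp.finsetSum_apply, Finsupp.smul_apply, smul_eq_mul] at h2
    simp only [colMat, T, Matrix.mul_apply, Matrix.of_apply]
    rw [← h2]
    exact Finset.sum_congr rfl fun _ _ => mul_comm _ _

/-- A family which is unitriangular in a basis is a basis. -/
theorem linearIndependent_of_triangular (β : Basis (Fin d) ℂ W) {v : Fin d → W}
    (h1 : ∀ j, β.repr (v j) j = 1) (h0 : ∀ j m, m < j → β.repr (v j) m = 0) :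
    LinearIndependent ℂ v := by
  have hdet : β.det v = 1 := by
    rw [β.det_apply, Matrix.det_of_isLowerTriangular]
    · exact Finset.prod_eq_one fun j _ => h1 j
    · intro i j hij
      exact h0 j i hij
  exact ((β.is_basis_iff_det).2 (hdet ▸ isUnit_one)).1

theorem det_submatrix_val_of_triangular (β : Basis (Fin d) ℂ W) {v : Fin d → W}
    (h1 : ∀ j, β.repr (v j) j = 1) (h0 : ∀ j m, m < j → β.repr (v j) m = 0) (D : ℕ) :
    ((colMat β v D).submatrix Subtype.val id).det = 1 := by
  rw [Matrix.det_of_isLowerTriangular]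
  · exact Finset.prod_eq_one fun j _ => h1 j.1
  · intro i j hij
    exact h0 j.1 i.1 hij

/-- Every flag of subspaces is spanned by the initial parts of a family of vectors. -/
theorem exists_adapted_family [FiniteDimensional ℂ W] (S : ℕ → Submodule ℂ W)
    (hS0 : S 0 = ⊥) (hS : Monotone S) (l : ℕ) :
    ∃ f : ℕ → W, ∀ k ≤ l, Submodule.span ℂ (f '' {j | j < finrank ℂ (S k)}) = S k := by
  induction l with
  | zero =>
    refine ⟨0, fun k hk => ?_⟩
    obtain rfl : k = 0 := by omega
    simp [hS0]
  | succ l ih =>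
    obtain ⟨f, hf⟩ := ih
    -- A basis of a complement of `S l` in `S (l + 1)` is appended right after the first `finrank (S
    -- l)` vectors, so the earlier steps are not disturbed.
    obtain ⟨C, hC⟩ := exists_isCompl (Submodule.comap (S (l + 1)).subtype (S l))
    let c := finBasis ℂ (Submodule.map (S (l + 1)).subtype C)
    have hSl : Submodule.map (S (l + 1)).subtype (Submodule.comap (S (l + 1)).subtype (S l)) =
        S l := by
      rw [Submodule.map_comap_subtype, inf_eq_right.2 (hS l.le_succ)]
    have hsup : S l ⊔ Submodule.map (S (l + 1)).subtype C = S (l + 1) := by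
      rw [← hSl, ← Submodule.map_sup, hC.sup_eq_top, Submodule.map_top, Submodule.range_subtype]
    have hdim : finrank ℂ (S l) + finrank ℂ (Submodule.map (S (l + 1)).subtype C) =
        finrank ℂ (S (l + 1)) := by
      rw [← Submodule.finrank_add_eq_of_isCompl hC,
        ← LinearEquiv.finrank_eq (Submodule.equivMapOfInjective (S (l + 1)).subtype
          (Submodule.injective_subtype _) C)]
      congr 1
      conv_lhs => rw [← hSl]
      exact (LinearEquiv.finrank_eq (Submodule.equivMapOfInjective (S (l + 1)).subtype
          (Submodule.injective_subtype _) _)).symm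
    let f' : ℕ → W := fun j => if j < finrank ℂ (S l) then f j else
      if h : j - finrank ℂ (S l) < finrank ℂ (Submodule.map (S (l + 1)).subtype C) then
        (c ⟨j - finrank ℂ (S l), h⟩ : W) else 0
    have hf' : ∀ k ≤ l, f' '' {j | j < finrank ℂ (S k)} = f '' {j | j < finrank ℂ (S k)} := by
      intro k hk
      refine Set.image_congr fun j hj => if_pos (lt_of_lt_of_le hj ?_)
      exact Submodule.finrank_mono (hS hk)
    refine ⟨f', fun k hk => ?_⟩
    rcases Nat.lt_or_eq_of_le hk with hk | rfl
    · rw [hf' k (by omega), hf k (by omega)]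
    have hc : Submodule.span ℂ (Set.range fun a => (c a : W)) =
        Submodule.map (S (l + 1)).subtype C := by
      have h1 := congrArg (Submodule.map (Submodule.subtype _)) c.span_eq
      rwa [Submodule.map_span, ← Set.range_comp, Submodule.map_top, Submodule.range_subtype] at h1
    have hset : f' '' {j | j < finrank ℂ (S (l + 1))} =
        f' '' {j | j < finrank ℂ (S l)} ∪ Set.range fun a => (c a : W) := by
      ext y
      constructor
      · rintro ⟨j, hj, rfl⟩
        have hj : j < finrank ℂ (S (l + 1)) := hj
        by_cases h : j < finrank ℂ (S l)
        · exact Or.inl ⟨j, h, rfl⟩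
        · refine Or.inr ⟨⟨j - finrank ℂ (S l), by omega⟩, ?_⟩
          simp only [f', if_neg h]
          rw [dif_pos]
      · rintro (⟨j, hj, rfl⟩ | ⟨a, rfl⟩)
        · exact ⟨j, lt_of_lt_of_le hj (Submodule.finrank_mono (hS l.le_succ)), rfl⟩
        · refine ⟨finrank ℂ (S l) + a, ?_, ?_⟩
          · have := a.2
            show finrank ℂ (S l) + (a : ℕ) < finrank ℂ (S (l + 1))
            omega
          · have h1 : ¬ finrank ℂ (S l) + (a : ℕ) < finrank ℂ (S l) := by omega
            have h2 : finrank ℂ (S l) + (a : ℕ) - finrank ℂ (S l) <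
                finrank ℂ (Submodule.map (S (l + 1)).subtype C) := by have := a.2; omega
            simp only [f', if_neg h1, dif_pos h2]
            congr 2
            exact Fin.ext (by simp)
    rw [hset, Submodule.span_union, hc, hf' l le_rfl, hf l le_rfl, hsup]

end LinearAlgebra

/-! ### Column counts of the diagrams -/

namespace CyclicQuiver
open FSpace

section Columns
variable {n : ℕ} [NeZero n] (lam : ZMod n → YoungDiagram)

/-- The number of boxes labelled `i` in the first `k` columns. -/
abbrev colDim (k : ℕ) (i : ZMod n) : ℕ := dimVec (firstCols lam k) i

theorem colDim_mono (i : ZMod n) : Monotone fun k => colDim lam k i := by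
  intro k k' hk
  refine dimVec_mono (fun j c hc => ?_) i
  simp only [firstCols, Finset.mem_filter] at hc ⊢
  exact ⟨hc.1, lt_of_lt_of_le hc.2 hk⟩

theorem colDim_zero (i : ZMod n) : colDim lam 0 i = 0 := by simp [dimVec, firstCols]

theorem colDim_numCols (i : ZMod n) : colDim lam (numCols lam) i = dimVec lam i := by
  rw [colDim, firstCols_numCols]

theorem colDim_le (k : ℕ) (i : ZMod n) : colDim lam k i ≤ dimVec lam i :=
  dimVec_mono (fun _ => Finset.filter_subset _ _) i

/-- The smallest `k` such that the first `k` columns contain more than `j` boxes labelled `i`. -/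
def blk (i : ZMod n) (j : ℕ) : ℕ := sInf {k | j < colDim lam k i}

variable {lam}

/-- The bound on `j` makes the defining set of `blk` non-empty; beyond it `blk` takes the value `0`,
the infimum of the empty set, and the equivalence fails. -/
theorem blk_le_iff {i : ZMod n} {j k : ℕ} (hj : j < dimVec lam i) :
    blk lam i j ≤ k ↔ j < colDim lam k i := by
  constructor
  · intro h
    have h1 : j < colDim lam (blk lam i j) i := Nat.sInf_mem (s := {k | j < colDim lam k i})
      ⟨numCols lam, show j < colDim lam _ i by rwa [colDim_numCols]⟩
    exact lt_of_lt_of_le h1 (colDim_mono lam i h)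
  · intro h
    exact Nat.sInf_le h

theorem lt_colDim_blk {i : ZMod n} {j : ℕ} (hj : j < dimVec lam i) :
    j < colDim lam (blk lam i j) i := (blk_le_iff hj).1 le_rfl

theorem blk_le_numCols {i : ZMod n} {j : ℕ} (hj : j < dimVec lam i) :
    blk lam i j ≤ numCols lam := (blk_le_iff hj).2 (by rwa [colDim_numCols])

end Columns

/-! ### Frames, cells and normal forms of flags -/

section Flags

variable {n : ℕ} [NeZero n] {V : ZMod n → Type u} [∀ i, AddCommGroup (V i)] [∀ i, Module ℂ (V i)]

variable (V) in
/-- Families of vectors. -/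
abbrev FrameSpace : Type u := ∀ i, Fin (finrank ℂ (V i)) → V i

variable [∀ i, FiniteDimensional ℂ (V i)]

/-- The bases of a frame. -/
def fbasis (b : frames V) (i : ZMod n) : Basis (Fin (finrank ℂ (V i))) ℂ (V i) :=
  Basis.mk (v := b.1 i) (b.2 i)
    (LinearIndependent.span_eq_top_of_card_eq_finrank' (b.2 i) (Fintype.card_fin _)).ge

theorem fbasis_apply (b : frames V) (i : ZMod n) (j : Fin (finrank ℂ (V i))) :
    fbasis b i j = b.1 i j := by
  rw [fbasis, Basis.mk_apply]

theorem coe_fbasis (b : frames V) (i : ZMod n) : (fbasis b i : _ → V i) = b.1 i :=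
  funext (fbasis_apply b i)

theorem isOpen_frames : IsOpen (X := affine (FrameSpace V))
    {b : FrameSpace V | ∀ i, LinearIndependent ℂ (b i)} := by
  have h : {b : FrameSpace V | ∀ i, LinearIndependent ℂ (b i)} =
      {b : FrameSpace V | ∏ i, (finBasis ℂ (V i)).det (b i) ≠ 0} := by
    ext b
    simp only [Set.mem_ofPred_eq, Finset.prod_ne_zero_iff, Finset.mem_univ, true_implies]
    refine forall_congr' fun i => ?_
    rw [← isUnit_iff_ne_zero, ← Basis.is_basis_iff_det]
    exact ⟨fun h => ⟨h, LinearIndependent.span_eq_top_of_card_eq_finrank' h (Fintype.card_fin _)⟩,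
      And.left⟩
  refine (congrArg (@IsOpen _ (affine (FrameSpace V)).top) h).mpr ?_
  refine isOpen_ne_zero (X := affine (FrameSpace V)) fun b => regAt_prod _ fun i _ => ?_
  refine regAt_det (X := affine (FrameSpace V)) fun m j => ?_
  exact regAt_dual (E := FrameSpace V)
    (((finBasis ℂ (V i)).coord m) ∘ₗ LinearMap.proj j ∘ₗ LinearMap.proj i) b

theorem regAt_frames (b0 : frames V) (i : ZMod n) (m j : Fin (finrank ℂ (V i))) (b : frames V) :
    (frames V).RegAt (fun b => (fbasis b0 i).repr (b.1 i j) m) b :=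
by
  let φ : Dual ℂ (FrameSpace V) :=
    ((fbasis b0 i).coord m) ∘ₗ LinearMap.proj j ∘ₗ LinearMap.proj i
  have h : (frames V).RegAt (fun b => φ b.1) b :=
    (isMorphism_val.morAt b).regAt (regAt_dual φ b.1)
  have h2 : ∀ b : frames V, φ b.1 = (fbasis b0 i).repr (b.1 i j) m := fun _ => rfl
  exact (frames V).regAt_congr (Filter.Eventually.of_forall h2) h

theorem morAt_frameSpace {X : FSpace.{v}} (b0 : frames V) {f : X → affine (FrameSpace V)} {x : X}
    (h : ∀ i j m, X.RegAt (fun y => (fbasis b0 i).repr ((f y : FrameSpace V) i j) m) x) :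
    MorAt f x := by
  have key : ∀ (v : FrameSpace V) i j m, (fbasis b0 i).repr (v i j) m =
      (Pi.basis fun i : ZMod n => Pi.basis fun _ : Fin (finrank ℂ (V i)) => fbasis b0 i).repr v
        ⟨i, j, m⟩ := by
    intro v i j m
    simp
  refine (morAt_affine_basis (Pi.basis fun i : ZMod n =>
    Pi.basis fun _ : Fin (finrank ℂ (V i)) => fbasis b0 i)).2 ?_
  rintro ⟨i, j, m⟩
  exact X.regAt_congr (Filter.Eventually.of_forall fun y => key _ i j m) (h i j m)

variable {lam : ZMod n → YoungDiagram} (hlam : ∀ i, dimVec lam i = finrank ℂ (V i))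

theorem GradedFlag.ext' {A B : GradedFlag V lam} (h : ∀ k i, A.W k i = B.W k i) : A = B := by
  cases A
  cases B
  congr
  exact funext fun k => funext fun i => h k i

theorem flagOfFrame_W (b : frames V) (k : Fin (numCols lam + 1)) (i : ZMod n) :
    (flagOfFrame lam hlam b).W k i =
      Submodule.span ℂ (b.1 i '' {j | (j : ℕ) < colDim lam k i}) := rfl

theorem flagOfFrame_surjective : Function.Surjective (flagOfFrame (V := V) lam hlam) := by
  intro W
  -- The truncation `min k (numCols lam)` extends the flag to all natural indices as eventually
  -- constant.
  have hex : ∀ i, ∃ f : ℕ → V i, ∀ k ≤ numCols lam, Submodule.span ℂ (f '' {j |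
      j < finrank ℂ (W.W ⟨min k (numCols lam), by omega⟩ i)}) =
        W.W ⟨min k (numCols lam), by omega⟩ i := by
    intro i
    refine exists_adapted_family (fun k => W.W ⟨min k (numCols lam), by omega⟩ i) ?_ ?_ _
    · exact congrFun W.zero i
    · intro k k' hk
      exact W.mono (by simp only [Fin.mk_le_mk]; omega) i
  choose f hf using hex
  have hspan : ∀ (k : Fin (numCols lam + 1)) i, Submodule.span ℂ
      ((fun j : Fin (finrank ℂ (V i)) => f i j) '' {j | (j : ℕ) < colDim lam k i}) = W.W k i := by
    intro k i
    have h1 := hf i k (by omega)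
    have h2 : (⟨min (k : ℕ) (numCols lam), by omega⟩ : Fin (numCols lam + 1)) = k :=
      Fin.ext (min_eq_left (by omega))
    rw [h2, W.finrank_eq] at h1
    rw [← h1]
    congr 1
    ext y
    constructor
    · rintro ⟨j, hj, rfl⟩
      exact ⟨j, hj, rfl⟩
    · rintro ⟨j, hj, rfl⟩
      exact ⟨⟨j, lt_of_lt_of_le hj ((colDim_le lam k i).trans (hlam i).le)⟩, hj, rfl⟩
  have hli : ∀ i, LinearIndependent ℂ fun j : Fin (finrank ℂ (V i)) => f i j := by
    intro i
    refine linearIndependent_of_top_le_span_of_card_eq_finrank ?_ (Fintype.card_fin _)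
    refine (congrFun W.last i).symm.trans_le ?_
    rw [← hspan (Fin.last _) i]
    exact Submodule.span_mono (Set.image_subset_range _ _)
  exact ⟨⟨fun i j => f i j, hli⟩, GradedFlag.ext' fun k i => hspan k i⟩

/-- A frame spanning a given flag. -/
def frameOf (W : flagVariety lam hlam) : frames V := (flagOfFrame_surjective hlam W).choose

theorem flagOfFrame_frameOf (W : flagVariety lam hlam) :
    flagOfFrame lam hlam (frameOf hlam W) = W := (flagOfFrame_surjective hlam W).choose_spec

/-- The frame spanning the same flag as `b` with normalised coordinates in the frame `b0`. -/
def normFrame (b0 : frames V) (b : FrameSpace V) : FrameSpace V := fun i j =>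
  ∑ m, nrm Subtype.val (colMat (fbasis b0 i) (b i) (colDim lam (blk lam i j) i)) m
    ⟨j, lt_colDim_blk (j.2.trans_eq (hlam i).symm)⟩ • fbasis b0 i m

/-- The frames whose flag is in the cell of `b0`. -/
def InCell (lam : ZMod n → YoungDiagram) (b0 : frames V) (b : FrameSpace V) : Prop :=
  ∀ (k : Fin (numCols lam + 1)) (i : ZMod n),
    ((colMat (fbasis b0 i) (b i) (colDim lam k i)).submatrix Subtype.val id).det ≠ 0

/-- The frames in normal form with respect to `b0`. -/
def IsNormal (lam : ZMod n → YoungDiagram) (b0 : frames V) (b : FrameSpace V) : Prop :=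
  ∀ i (j m : Fin (finrank ℂ (V i))), (m : ℕ) < colDim lam (blk lam i j) i →
    (fbasis b0 i).repr (b i j) m = if m = j then 1 else 0

theorem repr_normFrame (b0 : frames V) (b : FrameSpace V) (i : ZMod n)
    (j m : Fin (finrank ℂ (V i))) : (fbasis b0 i).repr (normFrame hlam b0 b i j) m =
      nrm Subtype.val (colMat (fbasis b0 i) (b i) (colDim lam (blk lam i j) i)) m
        ⟨j, lt_colDim_blk (j.2.trans_eq (hlam i).symm)⟩ := by
  simp [normFrame, Finsupp.single_apply]

theorem exists_colMat_eq (b0 : frames V) {b b' : frames V}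
    (h : flagOfFrame lam hlam b = flagOfFrame lam hlam b') (k : Fin (numCols lam + 1))
    (i : ZMod n) : ∃ T : Matrix (Ix (finrank ℂ (V i)) (colDim lam k i))
      (Ix (finrank ℂ (V i)) (colDim lam k i)) ℂ, T.det ≠ 0 ∧
      colMat (fbasis b0 i) (b'.1 i) (colDim lam k i) =
        colMat (fbasis b0 i) (b.1 i) (colDim lam k i) * T := by
  have h1 := exists_colMat_eq_mul (fbasis b0 i) (fbasis b i) (fbasis b' i) (D := colDim lam k i)
  rw [coe_fbasis, coe_fbasis] at h1
  exact h1 (congrFun (congrFun (congrArg GradedFlag.W h) k) i)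

/-- Frames of the same flag differ, step by step, by invertible matrices on the right, which
normalisation ignores. Thus the normal frame is a function of the flag. -/
theorem normFrame_congr (b0 : frames V) {b b' : frames V}
    (h : flagOfFrame lam hlam b = flagOfFrame lam hlam b') :
    normFrame hlam b0 b.1 = normFrame hlam b0 b'.1 := by
  funext i j
  obtain ⟨T, hT, hT'⟩ := exists_colMat_eq hlam b0 h
    ⟨blk lam i j, Nat.lt_succ_of_le (blk_le_numCols (j.2.trans_eq (hlam i).symm))⟩ i
  simp only [normFrame]
  rw [hT', nrm_mul hT]

theorem InCell.congr {b0 : frames V} {b b' : frames V} (hb : InCell lam b0 b.1)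
    (h : flagOfFrame lam hlam b = flagOfFrame lam hlam b') : InCell lam b0 b'.1 := by
  intro k i
  obtain ⟨T, hT, hT'⟩ := exists_colMat_eq hlam b0 h k i
  rw [hT', submatrix_mul, Matrix.det_mul]
  exact mul_ne_zero (hb k i) hT

include hlam in
theorem InCell.det_blk {b0 : frames V} {b : FrameSpace V} (hb : InCell lam b0 b) (i : ZMod n)
    (j : Fin (finrank ℂ (V i))) : ((colMat (fbasis b0 i) (b i)
      (colDim lam (blk lam i j) i)).submatrix Subtype.val id).det ≠ 0 :=
  hb ⟨blk lam i j, Nat.lt_succ_of_le (blk_le_numCols (j.2.trans_eq (hlam i).symm))⟩ i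

theorem isNormal_normFrame {b0 : frames V} {b : FrameSpace V} (hb : InCell lam b0 b) :
    IsNormal lam b0 (normFrame hlam b0 b) := by
  intro i j m hm
  rw [repr_normFrame]
  have := nrm_apply (hb.det_blk hlam i j) ⟨m, hm⟩
    ⟨j, lt_colDim_blk (j.2.trans_eq (hlam i).symm)⟩
  simpa [Subtype.ext_iff] using this

theorem IsNormal.repr_self {b0 : frames V} {b : FrameSpace V} (hb : IsNormal lam b0 b)
    (hlam : ∀ i, dimVec lam i = finrank ℂ (V i)) {i : ZMod n} (j : Fin (finrank ℂ (V i))) :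
    (fbasis b0 i).repr (b i j) j = 1 := by
  rw [hb i j j (lt_colDim_blk (j.2.trans_eq (hlam i).symm)), if_pos rfl]

theorem IsNormal.repr_lt {b0 : frames V} {b : FrameSpace V} (hb : IsNormal lam b0 b)
    (hlam : ∀ i, dimVec lam i = finrank ℂ (V i)) {i : ZMod n} (j m : Fin (finrank ℂ (V i)))
    (h : m < j) : (fbasis b0 i).repr (b i j) m = 0 := by
  rw [hb i j m (lt_trans (show (m : ℕ) < j from h)
    (lt_colDim_blk (j.2.trans_eq (hlam i).symm))), if_neg h.ne]

theorem IsNormal.linearIndependent {b0 : frames V} {b : FrameSpace V} (hb : IsNormal lam b0 b)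
    (hlam : ∀ i, dimVec lam i = finrank ℂ (V i)) (i : ZMod n) : LinearIndependent ℂ (b i) :=
  linearIndependent_of_triangular (fbasis b0 i) (fun j => hb.repr_self hlam j)
    (fun j m h => hb.repr_lt hlam j m h)

/-- A normal frame is unitriangular with respect to `b0`, so all the relevant minors equal `1`. -/
theorem IsNormal.inCell {b0 : frames V} {b : FrameSpace V} (hb : IsNormal lam b0 b)
    (hlam : ∀ i, dimVec lam i = finrank ℂ (V i)) : InCell lam b0 b := by
  intro k i
  rw [det_submatrix_val_of_triangular (fbasis b0 i) (fun j => hb.repr_self hlam j)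
    (fun j m h => hb.repr_lt hlam j m h)]
  exact one_ne_zero

/-- Uniqueness of the normal frame: in the span of a step, a vector is determined by its leading
coordinates, and those of a normal frame are already the required ones. -/
theorem IsNormal.normFrame_eq {b0 : frames V} {b : FrameSpace V} (hb : IsNormal lam b0 b)
    (hlam : ∀ i, dimVec lam i = finrank ℂ (V i)) : normFrame hlam b0 b = b := by
  funext i j
  refine (fbasis b0 i).repr.injective (Finsupp.ext fun m => ?_)
  rw [repr_normFrame]
  have hj := lt_colDim_blk (j.2.trans_eq (hlam i).symm)
  have h1 : ∀ m, (colMat (fbasis b0 i) (b i) (colDim lam (blk lam i j) i)).mulVec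
      (Pi.single ⟨j, hj⟩ 1) m = (fbasis b0 i).repr (b i j) m := by
    intro m
    rw [Matrix.mulVec_single_one]
    rfl
  rw [← h1 m]
  refine (mulVec_eq_nrm ((hb.inCell hlam).det_blk hlam i j) (fun c => ?_) m).symm
  rw [h1, hb i j c.1 c.2]
  simp [Subtype.ext_iff]

theorem normFrame_mem (b0 : frames V) (b : FrameSpace V) (i : ZMod n)
    (j : Fin (finrank ℂ (V i))) : normFrame hlam b0 b i j ∈
      Submodule.span ℂ (b i '' {m | (m : ℕ) < colDim lam (blk lam i j) i}) := by
  have hj := lt_colDim_blk (j.2.trans_eq (hlam i).symm)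
  refine mem_span_lt.2 ⟨fun c => ((colMat (fbasis b0 i) (b i)
    (colDim lam (blk lam i j) i)).submatrix Subtype.val id)⁻¹ c ⟨j, hj⟩, ?_⟩
  refine (fbasis b0 i).repr.injective (Finsupp.ext fun m => ?_)
  rw [repr_normFrame, ← colMat_mulVec]
  rfl

/-- The normalised frame. -/
def toNormal {b0 : frames V} {b : FrameSpace V} (hb : InCell lam b0 b) : frames V :=
  ⟨normFrame hlam b0 b, (isNormal_normFrame hlam hb).linearIndependent hlam⟩

/-- The normalised vector `j` is a combination of the vectors of the first step that contains `j`.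
So the new steps lie in the old ones, and the dimensions agree. -/
theorem flagOfFrame_toNormal {b0 b : frames V} (hb : InCell lam b0 b.1) :
    flagOfFrame lam hlam (toNormal hlam hb) = flagOfFrame lam hlam b := by
  refine GradedFlag.ext' fun k i => Submodule.eq_of_le_of_finrank_eq ?_ ?_
  · rw [flagOfFrame_W, Submodule.span_le]
    rintro _ ⟨j, hj, rfl⟩
    refine Submodule.span_mono (Set.image_mono fun m hm => ?_) (normFrame_mem hlam b0 b.1 i j)
    exact lt_of_lt_of_le hm (colDim_mono lam i
      ((blk_le_iff (j.2.trans_eq (hlam i).symm)).2 hj))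
  · rw [GradedFlag.finrank_eq, GradedFlag.finrank_eq]

theorem isOpen_inCell (b0 : frames V) :
    IsOpen (X := frames V) {b : frames V | InCell lam b0 b.1} := by
  simp only [InCell, Set.ofPred_forall]
  refine isOpen_iInter_of_finite fun k => isOpen_iInter_of_finite fun i => ?_
  refine isOpen_ne_zero (X := frames V) fun b => regAt_det (X := frames V) fun m j => ?_
  exact regAt_frames b0 i m.1 j.1 b

theorem regAt_normFrame {b0 b : frames V} (hb : InCell lam b0 b.1) (i : ZMod n)
    (j m : Fin (finrank ℂ (V i))) :
    (frames V).RegAt (fun b => (fbasis b0 i).repr (normFrame hlam b0 b.1 i j) m) b := by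
  refine (frames V).regAt_congr
    (Filter.Eventually.of_forall fun b => (repr_normFrame hlam b0 b.1 i j m).symm) ?_
  have hM : ∀ m c, (frames V).RegAt (fun b => colMat (fbasis b0 i) (b.1 i)
      (colDim lam (blk lam i j) i) m c) b := fun m c => regAt_frames b0 i m c.1 b
  have hM' : ∀ m c : Ix (finrank ℂ (V i)) (colDim lam (blk lam i j) i), (frames V).RegAt (fun b => ((colMat (fbasis b0 i) (b.1 i)
      (colDim lam (blk lam i j) i)).submatrix Subtype.val id) m c) b :=
    fun m c => regAt_frames b0 i m.1 c.1 b
  exact regAt_matrix_mul hM (fun m c => regAt_matrix_inv hM' (hb.det_blk hlam i j) m c) m _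

/-- The cell of the frame `b0`. -/
def cell (b0 : frames V) : Set (flagVariety lam hlam) :=
  {W | InCell lam b0 (frameOf hlam W).1}

/-- The cell is defined by a chosen frame of each flag; the condition does not depend on the choice.
-/
theorem mem_cell {b0 b : frames V} :
    (flagOfFrame lam hlam b : flagVariety lam hlam) ∈ cell hlam b0 ↔ InCell lam b0 b.1 :=
  ⟨fun h => h.congr hlam (flagOfFrame_frameOf hlam _),
    fun h => h.congr hlam (flagOfFrame_frameOf hlam _).symm⟩

theorem isOpen_cell (b0 : frames V) : IsOpen (X := flagVariety lam hlam) (cell hlam b0) := by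
  refine isOpen_quotient.2 ?_
  have h : flagOfFrame lam hlam ⁻¹' cell hlam b0 = {b : frames V | InCell lam b0 b.1} :=
    Set.ext fun b => mem_cell hlam
  rw [h]
  exact isOpen_inCell b0

theorem isNormal_self (b0 : frames V) : IsNormal lam b0 b0.1 := by
  intro i j m _
  rw [← fbasis_apply, Basis.repr_self, Finsupp.single_apply]
  simp only [eq_comm]

theorem self_mem_cell (b0 : frames V) :
    (flagOfFrame lam hlam b0 : flagVariety lam hlam) ∈ cell hlam b0 :=
  (mem_cell hlam).2 ((isNormal_self b0).inCell hlam)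

theorem exists_mem_cell (W : flagVariety lam hlam) : ∃ b0 : frames V, W ∈ cell hlam b0 :=
  ⟨frameOf hlam W, by
    have := self_mem_cell hlam (frameOf hlam W)
    rwa [flagOfFrame_frameOf] at this⟩

/-- The normalised frames spanning the flags of a cell. -/
def sec (b0 : frames V) (W : flagVariety lam hlam) : FrameSpace V :=
  normFrame hlam b0 (frameOf hlam W).1

theorem sec_flagOfFrame (b0 b : frames V) :
    sec hlam b0 (flagOfFrame lam hlam b) = normFrame hlam b0 b.1 :=
  normFrame_congr hlam b0 (flagOfFrame_frameOf hlam _)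

theorem isNormal_sec {b0 : frames V} {W : flagVariety lam hlam} (hW : W ∈ cell hlam b0) :
    IsNormal lam b0 (sec hlam b0 W) := isNormal_normFrame hlam hW

theorem flagOfFrame_sec {b0 : frames V} {W : flagVariety lam hlam} (hW : W ∈ cell hlam b0) :
    flagOfFrame lam hlam ⟨sec hlam b0 W, (isNormal_sec hlam hW).linearIndependent hlam⟩ = W :=
  (flagOfFrame_toNormal hlam hW).trans (flagOfFrame_frameOf hlam W)

/-- Regularity on the quotient is tested on frames, where the section becomes normalisation, a
rational function of the frame with non-vanishing denominator. -/
theorem regAt_sec {b0 : frames V} {W : flagVariety lam hlam} (hW : W ∈ cell hlam b0)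
    (i : ZMod n) (j m : Fin (finrank ℂ (V i))) :
    (flagVariety lam hlam).RegAt (fun W => (fbasis b0 i).repr (sec hlam b0 W i j) m) W := by
  refine regAt_quotient (X := frames V) (isOpen_cell hlam b0) (fun b hb => ?_) hW
  simp only [sec_flagOfFrame]
  exact regAt_normFrame hlam ((mem_cell hlam).1 hb) i j m

theorem morAt_sec {b0 : frames V} {W : flagVariety lam hlam} (hW : W ∈ cell hlam b0) :
    MorAt (Y := affine (FrameSpace V)) (sec hlam b0) W :=
  morAt_frameSpace b0 fun i j m => regAt_sec hlam hW i j m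

theorem isMorphism_flagOfFrame :
    IsMorphism (X := frames V) (Y := flagVariety lam hlam) (flagOfFrame lam hlam) :=
  isMorphism_quotient_mk

end Flags
end CyclicQuiver

namespace FSpace

theorem irreducibleSpace_of_open {X : FSpace.{u}} [IrreducibleSpace X] {U : Set X} (hU : IsOpen U)
    (hne : U.Nonempty) : IrreducibleSpace (X.sub U) := by
  have h : IsIrreducible U :=
    ⟨hne, (PreirreducibleSpace.isPreirreducible_univ (X := X)).open_subset hU (Set.subset_univ _)⟩
  exact Subtype.irreducibleSpace h

theorem irreducibleSpace_of_surjective {X : FSpace.{u}} {Y : FSpace.{v}} [IrreducibleSpace X]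
    {f : X → Y} (hf : IsMorphism f) (hs : Function.Surjective f) : IrreducibleSpace Y := by
  have h := (IrreducibleSpace.isIrreducible_univ X).image f hf.1.continuousOn
  rw [Set.image_univ, hs.range_eq] at h
  exact irreducibleSpace_def Y |>.2 h

end FSpace

/-! ### Charts, smoothness, dimension and irreducibility of the flag variety -/

namespace CyclicQuiver
open FSpace

section FlagVariety

variable {n : ℕ} [NeZero n] {V : ZMod n → Type u} [∀ i, AddCommGroup (V i)] [∀ i, Module ℂ (V i)]

variable (V) in
/-- The indices of the coordinates of the cells of the flag variety. -/
abbrev FlagIdx (lam : ZMod n → YoungDiagram) : Type :=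
  {p : Σ i : ZMod n, Fin (finrank ℂ (V i)) × Fin (finrank ℂ (V i)) //
    colDim lam (blk lam p.1 p.2.2) p.1 ≤ p.2.1}

variable [∀ i, FiniteDimensional ℂ (V i)] {lam : ZMod n → YoungDiagram}

/-- The normalised frame with given coordinates. -/
def chartFrame (b0 : frames V) (c : FlagIdx V lam → ℂ) : FrameSpace V := fun i j =>
  fbasis b0 i j + ∑ m : Fin (finrank ℂ (V i)),
    (if h : colDim lam (blk lam i j) i ≤ m then c ⟨⟨i, m, j⟩, h⟩ else 0) • fbasis b0 i m

theorem repr_chartFrame (b0 : frames V) (c : FlagIdx V lam → ℂ) (i : ZMod n)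
    (j m : Fin (finrank ℂ (V i))) : (fbasis b0 i).repr (chartFrame b0 c i j) m =
      (if m = j then 1 else 0) +
        if h : colDim lam (blk lam i j) i ≤ m then c ⟨⟨i, m, j⟩, h⟩ else 0 := by
  rw [chartFrame, map_add, Finsupp.add_apply, Basis.repr_sum_self, Basis.repr_self,
    Finsupp.single_apply]
  simp only [eq_comm]

theorem isNormal_chartFrame (b0 : frames V) (c : FlagIdx V lam → ℂ) :
    IsNormal lam b0 (chartFrame b0 c) := by
  intro i j m hm
  rw [repr_chartFrame, dif_neg (by omega), add_zero]

/-- The coordinates of a normalised frame. -/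
def chartCoord (b0 : frames V) (b : FrameSpace V) : FlagIdx V lam → ℂ := fun t =>
  (fbasis b0 t.1.1).repr (b t.1.1 t.1.2.2) t.1.2.1

variable (hlam : ∀ i, dimVec lam i = finrank ℂ (V i))

include hlam in
theorem chartFrame_chartCoord {b0 : frames V} {b : FrameSpace V} (hb : IsNormal lam b0 b) :
    chartFrame b0 (chartCoord (lam := lam) b0 b) = b := by
  funext i j
  refine (fbasis b0 i).repr.injective (Finsupp.ext fun m => ?_)
  rw [repr_chartFrame]
  by_cases h : colDim lam (blk lam i j) i ≤ m
  · have hj := lt_colDim_blk (j.2.trans_eq (hlam i).symm)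
    rw [dif_pos h, if_neg (fun e => by rw [e] at h; omega), zero_add]
    rfl
  · rw [dif_neg h, hb i j m (by omega), add_zero]

include hlam in
theorem chartCoord_chartFrame (b0 : frames V) (c : FlagIdx V lam → ℂ) :
    chartCoord b0 (chartFrame b0 c) = c := by
  funext ⟨⟨i, m, j⟩, h⟩
  have hj := lt_colDim_blk (j.2.trans_eq (hlam i).symm)
  simp only at h
  simp only [chartCoord]
  rw [repr_chartFrame, dif_pos h, if_neg (fun e => by rw [e] at h; omega), zero_add]

theorem isMorphism_chartFrame (b0 : frames V) :
    IsMorphism (X := affine (FlagIdx V lam → ℂ)) (Y := affine (FrameSpace V))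
      (chartFrame b0) := by
  refine isMorphism_iff.2 fun c => morAt_frameSpace b0 fun i j m => ?_
  have key : ∀ c : FlagIdx V lam → ℂ, (if m = j then 1 else 0) +
      (if h : colDim lam (blk lam i j) i ≤ m then c ⟨⟨i, m, j⟩, h⟩ else 0) =
      (fbasis b0 i).repr (chartFrame b0 c i j) m := fun c => (repr_chartFrame b0 c i j m).symm
  refine (affine (FlagIdx V lam → ℂ)).regAt_congr (Filter.Eventually.of_forall key) ?_
  refine regAt_add' ((affine _).regAt_const _ _) ?_
  by_cases h : colDim lam (blk lam i j) i ≤ m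
  · have key : ∀ c : FlagIdx V lam → ℂ, c ⟨⟨i, m, j⟩, h⟩ =
      (if h : colDim lam (blk lam i j) i ≤ m then c ⟨⟨i, m, j⟩, h⟩ else 0) :=
        fun c => by rw [dif_pos h]
    exact (affine (FlagIdx V lam → ℂ)).regAt_congr (Filter.Eventually.of_forall key)
      (regAt_dual (LinearMap.proj (φ := fun _ : FlagIdx V lam => ℂ) ⟨⟨i, m, j⟩, h⟩) c)
  · have key : ∀ c : FlagIdx V lam → ℂ, 0 =
      (if h : colDim lam (blk lam i j) i ≤ m then c ⟨⟨i, m, j⟩, h⟩ else 0) :=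
        fun c => by rw [dif_neg h]
    exact (affine (FlagIdx V lam → ℂ)).regAt_congr (Filter.Eventually.of_forall key)
      ((affine _).regAt_const 0 c)

/-- The normalised frame with given coordinates, as a point of the variety of frames. -/
def chartPt (b0 : frames V) (c : FlagIdx V lam → ℂ) : frames V :=
  ⟨chartFrame b0 c, (isNormal_chartFrame b0 c).linearIndependent hlam⟩

theorem isMorphism_chartPt (b0 : frames V) :
    IsMorphism (X := affine (FlagIdx V lam → ℂ)) (Y := frames V) (chartPt hlam b0) :=
  isMorphism_sub_iff.2 (isMorphism_chartFrame b0)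

/-- The flag with given coordinates. -/
def chartFlag (b0 : frames V) (c : FlagIdx V lam → ℂ) : flagVariety lam hlam :=
  flagOfFrame lam hlam (chartPt hlam b0 c)

theorem chartFlag_mem (b0 : frames V) (c : FlagIdx V lam → ℂ) :
    chartFlag hlam b0 c ∈ cell hlam b0 :=
  (mem_cell hlam).2 ((isNormal_chartFrame b0 c).inCell hlam)

theorem sec_chartFlag (b0 : frames V) (c : FlagIdx V lam → ℂ) :
    sec hlam b0 (chartFlag hlam b0 c) = chartFrame b0 c :=
  (sec_flagOfFrame hlam b0 _).trans ((isNormal_chartFrame b0 c).normFrame_eq hlam)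

theorem chartFlag_sec {b0 : frames V} {W : flagVariety lam hlam} (hW : W ∈ cell hlam b0) :
    chartFlag hlam b0 (chartCoord b0 (sec hlam b0 W)) = W := by
  refine Eq.trans ?_ (flagOfFrame_sec hlam hW)
  exact congrArg (flagOfFrame lam hlam)
    (Subtype.ext (chartFrame_chartCoord hlam (isNormal_sec hlam hW)))

theorem isMorphism_chartFlag (b0 : frames V) :
    IsMorphism (X := affine (FlagIdx V lam → ℂ)) (chartFlag hlam b0) :=
  IsMorphism.comp (Y := frames V) (Z := flagVariety lam hlam) (isMorphism_flagOfFrame hlam)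
    (isMorphism_chartPt hlam b0)

theorem morAt_chartCoord {b0 : frames V} {W : flagVariety lam hlam} (hW : W ∈ cell hlam b0) :
    MorAt (Y := affine (FlagIdx V lam → ℂ)) (fun W => chartCoord b0 (sec hlam b0 W)) W :=
  morAt_affine_pi.2 fun t => regAt_sec hlam hW t.1.1 t.1.2.2 t.1.2.1

/-- Each flag of the cell has exactly one normal frame, and the entries of a normal frame that are
not prescribed are arbitrary. -/
theorem isIsom_cell (b0 : frames V) :
    IsIsom (X := (flagVariety lam hlam).sub (cell hlam b0)) (Y := affine (FlagIdx V lam → ℂ))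
      (fun W => chartCoord b0 (sec hlam b0 W.1)) := by
  refine .mk' (g := fun c => ⟨chartFlag hlam b0 c, chartFlag_mem hlam b0 c⟩) ?_ ?_ ?_ ?_
  · exact isMorphism_iff.2 fun W => (morAt_chartCoord hlam W.2).restrict
  · exact isMorphism_sub_iff.2 (isMorphism_chartFlag hlam b0)
  · exact fun W => Subtype.ext (chartFlag_sec hlam W.2)
  · intro c
    exact (congrArg (chartCoord b0) (sec_chartFlag hlam b0 c)).trans
      (chartCoord_chartFrame hlam b0 c)

theorem isSmooth_flagVariety : IsSmooth (flagVariety lam hlam) := by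
  refine IsSmooth.of_cover fun W => ?_
  obtain ⟨b0, hb0⟩ := exists_mem_cell hlam W
  exact ⟨cell hlam b0, isOpen_cell hlam b0, hb0, _, isSmooth_affine _, _, isIsom_cell hlam b0⟩

theorem locDim_flagVariety :
    LocDim (flagVariety lam hlam) (Fintype.card (FlagIdx V lam)) := by
  refine locDim_of_cover fun W => ?_
  obtain ⟨b0, hb0⟩ := exists_mem_cell hlam W
  refine ⟨cell hlam b0, isOpen_cell hlam b0, hb0, locDim_of_iso ⟨_, isIsom_cell hlam b0⟩ ?_⟩
  have := locDim_affine (FlagIdx V lam → ℂ)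
  rwa [finrank_pi] at this

variable (V) in
theorem nonempty_frames : Nonempty (frames V) :=
  ⟨⟨fun i => finBasis ℂ (V i), fun i => (finBasis ℂ (V i)).linearIndependent⟩⟩

variable (V) in
theorem irreducibleSpace_frames : IrreducibleSpace (frames V) := by
  have := irreducibleSpace_affine (FrameSpace V)
  obtain ⟨b⟩ := nonempty_frames V
  exact irreducibleSpace_of_open isOpen_frames ⟨b.1, b.2⟩

theorem irreducibleSpace_flagVariety : IrreducibleSpace (flagVariety lam hlam) := by
  have := irreducibleSpace_frames V
  exact irreducibleSpace_of_surjective (isMorphism_flagOfFrame hlam) (flagOfFrame_surjective hlam)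

end FlagVariety
end CyclicQuiver

/-! ### Maximal minors and their products -/

section Minors

variable {J I : Type*} [Fintype I] [DecidableEq I]

theorem nrm_mul_submatrix {p : I → J} {G : Matrix J I ℂ} (h : (G.submatrix p id).det ≠ 0) :
    nrm p G * G.submatrix p id = G := by
  rw [nrm, Matrix.mul_assoc, Matrix.nonsing_inv_mul _ (isUnit_iff_ne_zero.2 h), Matrix.mul_one]

theorem nrm_mul_submatrix_mul {I' : Type*} {p : I → J} {G : Matrix J I ℂ}
    (h : (G.submatrix p id).det ≠ 0) (B : Matrix I I' ℂ) :
    nrm p G * (G * B).submatrix p id = G * B := by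
  have h1 : (G * B).submatrix p id = G.submatrix p id * B := by
    ext i j
    rfl
  rw [h1, ← Matrix.mul_assoc, nrm_mul_submatrix h]

theorem det_nrm_submatrix {p : I → J} {G : Matrix J I ℂ} (h : (G.submatrix p id).det ≠ 0)
    (q : I → J) : ((nrm p G).submatrix q id).det =
      (G.submatrix q id).det / (G.submatrix p id).det := by
  rw [eq_div_iff h, ← Matrix.det_mul, ← submatrix_mul, nrm_mul_submatrix h]

/-- Replacing row `a` of an identity matrix by another row leaves that row's entry at `a` as
determinant. Together with `det_nrm_submatrix` this writes every entry of a normalised matrix as a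
ratio of maximal minors. -/
theorem det_nrm_submatrix_update {p : I → J} {G : Matrix J I ℂ}
    (h : (G.submatrix p id).det ≠ 0) (a : I) (m : J) :
    ((nrm p G).submatrix (Function.update p a m) id).det = nrm p G m a := by
  have h1 : (nrm p G).submatrix (Function.update p a m) id =
      (1 : Matrix I I ℂ).updateRow a (nrm p G m) := by
    rw [← nrm_submatrix h]
    ext i j
    by_cases hi : i = a
    · subst hi
      simp
    · simp [hi]
  rw [h1, ← Matrix.cramer_transpose_apply, Matrix.transpose_one, Matrix.cramer_one]
  rfl

theorem exists_submatrix_det_ne_zero [Fintype J] {G : Matrix J I ℂ}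
    (h : ∀ x, G.mulVec x = 0 → x = 0) : ∃ p : I → J, (G.submatrix p id).det ≠ 0 := by
  have hli : LinearIndependent ℂ G.transpose.row := by
    rw [Matrix.row_transpose, ← Matrix.mulVec_injective_iff]
    exact (injective_iff_map_eq_zero G.mulVecLin).2 h
  have hr : finrank ℂ (Submodule.span ℂ (Set.range G.row)) = Fintype.card I := by
    rw [← Matrix.rank_eq_finrank_span_row, ← Matrix.rank_transpose, hli.rank_matrix]
  obtain ⟨f, hf, -, hfi⟩ := Submodule.exists_fun_fin_finrank_span_eq ℂ (Set.range G.row)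
  choose q hq using hf
  let e : I ≃ Fin (finrank ℂ (Submodule.span ℂ (Set.range G.row))) :=
    Fintype.equivFinOfCardEq hr.symm
  refine ⟨q ∘ e, ?_⟩
  have h2 : LinearIndependent ℂ (G.submatrix (q ∘ e) id).row := by
    have h3 := hfi.comp e e.injective
    have h4 : (G.submatrix (q ∘ e) id).row = f ∘ e := funext fun i => hq (e i)
    exact h4 ▸ h3
  exact (Matrix.isUnit_iff_isUnit_det _).1 (Matrix.linearIndependent_rows_iff_isUnit.1 h2) |>.ne_zero

theorem mulVec_eq_zero_of_det {p : I → J} {G : Matrix J I ℂ} (h : (G.submatrix p id).det ≠ 0)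
    {x : I → ℂ} (hx : G.mulVec x = 0) : x = 0 := by
  by_contra hne
  refine h (Matrix.exists_mulVec_eq_zero_iff.1 ⟨x, hne, ?_⟩)
  funext i
  exact congrFun hx (p i)

end Minors

section MinorProd

variable {Λ : Type*} [Fintype Λ] [DecidableEq Λ] {J I : Λ → Type*} [∀ l, Fintype (I l)]
  [∀ l, DecidableEq (I l)]

/-- Products of maximal minors of a family of matrices. -/
def minorProd (M : ∀ l, Matrix (J l) (I l) ℂ) (p : ∀ l, I l → J l) : ℂ :=
  ∏ l, ((M l).submatrix (p l) id).det

theorem minorProd_ne_zero {M : ∀ l, Matrix (J l) (I l) ℂ} {p : ∀ l, I l → J l} :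
    minorProd M p ≠ 0 ↔ ∀ l, ((M l).submatrix (p l) id).det ≠ 0 := by
  simp [minorProd, Finset.prod_ne_zero_iff]

/-- A change of frame rescales the whole vector of products, so the point of projective space
depends on the flag only. -/
theorem minorProd_mul (M : ∀ l, Matrix (J l) (I l) ℂ) (T : ∀ l, Matrix (I l) (I l) ℂ) :
    minorProd (fun l => M l * T l) = (∏ l, (T l).det) • minorProd M := by
  funext p
  simp only [minorProd, submatrix_mul, Matrix.det_mul, Finset.prod_mul_distrib, Pi.smul_apply,
    smul_eq_mul, mul_comm]

/-- The family of normalised matrices recovered from ratios of products of minors. -/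
def chartMat (r : (∀ l, I l → J l) → ℂ) (p : ∀ l, I l → J l) (l : Λ) : Matrix (J l) (I l) ℂ :=
  Matrix.of fun m a => r (Function.update p l (Function.update (p l) a m))

theorem minorProd_nrm {M : ∀ l, Matrix (J l) (I l) ℂ} {p : ∀ l, I l → J l}
    (hp : minorProd M p ≠ 0) (q : ∀ l, I l → J l) :
    minorProd (fun l => nrm (p l) (M l)) q = minorProd M q / minorProd M p := by
  simp only [minorProd, ← Finset.prod_div_distrib]
  exact Finset.prod_congr rfl fun l _ => det_nrm_submatrix (minorProd_ne_zero.1 hp l) _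

/-- The choice `p` is altered in one row of one factor only. For normalised matrices all other
factors are `1`, so the product isolates a single entry. -/
theorem chartMat_eq_nrm {M : ∀ l, Matrix (J l) (I l) ℂ} {p : ∀ l, I l → J l}
    (hp : minorProd M p ≠ 0) (l : Λ) :
    chartMat (fun q => minorProd M q / minorProd M p) p l = nrm (p l) (M l) := by
  ext m a
  rw [chartMat, Matrix.of_apply, ← minorProd_nrm hp, minorProd, Finset.prod_eq_single l]
  · rw [Function.update_self, det_nrm_submatrix_update (minorProd_ne_zero.1 hp l)]
  · intro l' _ hl'
    rw [Function.update_of_ne hl', nrm_submatrix (minorProd_ne_zero.1 hp l'), Matrix.det_one]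
  · simp

end MinorProd

/-! ### The Plücker image of the flag variety and its equations -/

namespace CyclicQuiver
open FSpace

section Plucker

variable {n : ℕ} [NeZero n] {V : ZMod n → Type u} [∀ i, AddCommGroup (V i)] [∀ i, Module ℂ (V i)]

variable (V) in
/-- The indices of the Plücker coordinates. -/
abbrev PlIdx (lam : ZMod n → YoungDiagram) : Type :=
  ∀ l : ZMod n × Fin (numCols lam + 1),
    Ix (finrank ℂ (V l.1)) (colDim lam l.2 l.1) → Fin (finrank ℂ (V l.1))

instance (lam : ZMod n → YoungDiagram) : Nonempty (PlIdx V lam) := ⟨fun _ c => c.1⟩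

variable (V) in
/-- The dimension of the projective space of Plücker coordinates. -/
def plDim (lam : ZMod n → YoungDiagram) : ℕ := Fintype.card (PlIdx V lam) - 1

variable (V) in
/-- The numbering of the Plücker coordinates. -/
def plEquiv (lam : ZMod n → YoungDiagram) : PlIdx V lam ≃ Fin (plDim V lam + 1) :=
  Fintype.equivFinOfCardEq
    (by have := Fintype.card_pos (α := PlIdx V lam); unfold plDim; omega)

variable [∀ i, FiniteDimensional ℂ (V i)] (lam : ZMod n → YoungDiagram)

/-- The matrices of the members of the flag spanned by a frame. -/
def frameMat (bR : frames V) (b : FrameSpace V) (l : ZMod n × Fin (numCols lam + 1)) :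
    Matrix (Fin (finrank ℂ (V l.1))) (Ix (finrank ℂ (V l.1)) (colDim lam l.2 l.1)) ℂ :=
  colMat (fbasis bR l.1) (b l.1) (colDim lam l.2 l.1)

variable {lam}

theorem frameMat_mulVec_eq_zero (bR b : frames V) (l : ZMod n × Fin (numCols lam + 1))
    {x : Ix (finrank ℂ (V l.1)) (colDim lam l.2 l.1) → ℂ}
    (hx : (frameMat lam bR b.1 l).mulVec x = 0) : x = 0 := by
  have h1 : ∑ c, x c • b.1 l.1 c.1 = 0 := by
    refine (fbasis bR l.1).repr.injective (Finsupp.ext fun m => ?_)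
    rw [← colMat_mulVec]
    exact (congrFun hx m).trans (by simp)
  exact funext (Fintype.linearIndependent_iff.1
    (LinearIndependent.comp (b.2 l.1) Subtype.val Subtype.val_injective) x h1)

theorem exists_minorProd_frameMat_ne_zero (bR b : frames V) :
    ∃ p : PlIdx V lam, minorProd (frameMat lam bR b.1) p ≠ 0 := by
  have h := fun l => exists_submatrix_det_ne_zero (G := frameMat lam bR b.1 l)
    fun x hx => frameMat_mulVec_eq_zero bR b l hx
  choose p hp using h
  exact ⟨p, minorProd_ne_zero.2 hp⟩

/-- The vector of Plücker coordinates of a frame. -/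
def plVec (lam : ZMod n → YoungDiagram) (bR : frames V) (b : FrameSpace V) :
    Fin (plDim V lam + 1) → ℂ :=
  fun a => minorProd (frameMat lam bR b) ((plEquiv V lam).symm a)

theorem plVec_ne_zero (bR b : frames V) : plVec lam bR b.1 ≠ 0 := by
  obtain ⟨p, hp⟩ := exists_minorProd_frameMat_ne_zero (lam := lam) bR b
  intro h
  have := congrFun h (plEquiv V lam p)
  simp only [plVec, Equiv.symm_apply_apply, Pi.zero_apply] at this
  exact hp this

/-- The ratios of the coordinates of a point by the coordinate `p`. -/
def plRatio (p : PlIdx V lam) (z : projectiveSpace (plDim V lam)) : PlIdx V lam → ℂ :=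
  fun q => ratio (plEquiv V lam q) (plEquiv V lam p) z

theorem plRatio_pmk (bR b : frames V) (p q : PlIdx V lam) :
    plRatio p (pmk (plVec lam bR b.1) (plVec_ne_zero bR b)) q =
      minorProd (frameMat lam bR b.1) q / minorProd (frameMat lam bR b.1) p := by
  simp [plRatio, ratio_pmk, plVec]

theorem pmk_mem_pchart_plEquiv (bR b : frames V) (p : PlIdx V lam) :
    pmk (plVec lam bR b.1) (plVec_ne_zero bR b) ∈ pchart (plEquiv V lam p) ↔
      minorProd (frameMat lam bR b.1) p ≠ 0 := by
  rw [pmk_mem_pchart]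
  simp [plVec]

/-- The matrices recovered from Plücker coordinates. -/
def plMat (p : PlIdx V lam) (z : projectiveSpace (plDim V lam))
    (l : ZMod n × Fin (numCols lam + 1)) :
    Matrix (Fin (finrank ℂ (V l.1))) (Ix (finrank ℂ (V l.1)) (colDim lam l.2 l.1)) ℂ :=
  chartMat (plRatio p z) p l

theorem plMat_pmk (bR b : frames V) {p : PlIdx V lam}
    (hp : minorProd (frameMat lam bR b.1) p ≠ 0) (l : ZMod n × Fin (numCols lam + 1)) :
    plMat p (pmk (plVec lam bR b.1) (plVec_ne_zero bR b)) l =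
      nrm (p l) (frameMat lam bR b.1 l) := by
  rw [plMat, ← chartMat_eq_nrm hp]
  congr 1
  exact funext fun q => plRatio_pmk bR b p q

/-- The equations of the flag variety in a chart of projective space. -/
def PlGood (p : PlIdx V lam) (z : projectiveSpace (plDim V lam)) : Prop :=
  (∀ q, plRatio p z q = minorProd (plMat p z) q) ∧
  ∀ (i : ZMod n) (k : Fin (numCols lam)), plMat p z (i, k.castSucc) =
    plMat p z (i, k.succ) * (plMat p z (i, k.castSucc)).submatrix (p (i, k.succ)) id

theorem exists_frameMat_eq_mul (bR : frames V) (b : FrameSpace V) (i : ZMod n)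
    (k : Fin (numCols lam)) :
    ∃ B : Matrix (Ix (finrank ℂ (V i)) (colDim lam k.succ i))
      (Ix (finrank ℂ (V i)) (colDim lam k.castSucc i)) ℂ,
      frameMat lam bR b (i, k.castSucc) = frameMat lam bR b (i, k.succ) * B := by
  let f : Ix (finrank ℂ (V i)) (colDim lam k.castSucc i) →
      Ix (finrank ℂ (V i)) (colDim lam k.succ i) :=
    fun c => ⟨c.1, lt_of_lt_of_le c.2 (colDim_mono lam i (by simp))⟩
  refine ⟨(1 : Matrix _ _ ℂ).submatrix id f, ?_⟩
  ext m c
  simp only [Matrix.mul_apply, Matrix.submatrix_apply, id, Matrix.one_apply, mul_ite, mul_one,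
    mul_zero, Finset.sum_ite_eq', Finset.mem_univ, if_true]
  rfl

/-- Each step is a matrix product `G * B` with `G` the next step, and such a product is recovered
from its rows `p` as the normalisation of `G` times those rows. This turns inclusion of steps into
polynomial equations. -/
theorem plGood_pmk (bR b : frames V) {p : PlIdx V lam}
    (hp : minorProd (frameMat lam bR b.1) p ≠ 0) :
    PlGood p (pmk (plVec lam bR b.1) (plVec_ne_zero bR b)) := by
  constructor
  · intro q
    rw [plRatio_pmk, ← minorProd_nrm hp]
    congr 1
    exact funext fun l => (plMat_pmk bR b hp l).symm
  · intro i k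
    rw [plMat_pmk bR b hp, plMat_pmk bR b hp]
    obtain ⟨B, hB⟩ := exists_frameMat_eq_mul (lam := lam) bR b.1 i k
    have h1 : ∃ B' : Matrix (Ix (finrank ℂ (V i)) (colDim lam k.succ i))
        (Ix (finrank ℂ (V i)) (colDim lam k.castSucc i)) ℂ,
        nrm (p (i, k.castSucc)) (frameMat lam bR b.1 (i, k.castSucc)) =
        frameMat lam bR b.1 (i, k.succ) * B' := by
      refine ⟨B * ((frameMat lam bR b.1
          (i, k.castSucc)).submatrix (p (i, k.castSucc)) id)⁻¹, ?_⟩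
      refine Eq.trans ?_ (Matrix.mul_assoc _ _ _)
      rw [← hB]
      rfl
    obtain ⟨B', h1⟩ := h1
    rw [h1, nrm_mul_submatrix_mul (minorProd_ne_zero.1 hp (i, k.succ))]

variable (hlam : ∀ i, dimVec lam i = finrank ℂ (V i))

theorem exists_plVec_eq_smul (bR : frames V) {b b' : frames V}
    (h : flagOfFrame lam hlam b = flagOfFrame lam hlam b') :
    ∃ c : ℂ, c ≠ 0 ∧ plVec lam bR b'.1 = c • plVec lam bR b.1 := by
  choose T hT hT' using fun l : ZMod n × Fin (numCols lam + 1) =>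
    exists_colMat_eq hlam bR h l.2 l.1
  refine ⟨∏ l, (T l).det, Finset.prod_ne_zero_iff.2 fun l _ => hT l, ?_⟩
  have h1 : frameMat lam bR b'.1 = fun l => frameMat lam bR b.1 l * T l := funext hT'
  funext a
  change minorProd (frameMat lam bR b'.1) _ = _
  rw [h1, minorProd_mul]
  rfl

theorem card_Ix {d D : ℕ} (h : D ≤ d) : Fintype.card (Ix d D) = D := by
  rw [Fintype.card_subtype]
  have h1 : (Finset.univ.filter fun j : Fin d => (j : ℕ) < D) =
      (Finset.univ : Finset (Fin D)).map (Fin.castLEEmb h) := by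
    ext j
    simp only [Finset.mem_filter, Finset.mem_univ, true_and, Finset.mem_map]
    constructor
    · intro hj
      exact ⟨⟨j, hj⟩, rfl⟩
    · rintro ⟨j', rfl⟩
      exact j'.2
  rw [h1, Finset.card_map, Finset.card_univ, Fintype.card_fin]

include hlam in
-- The matrices read off from `z` have full rank, since the coordinate `p` equals `1` in its own
-- chart. The inclusion equations make their column spaces a flag. A frame of this flag differs from
-- them by invertible matrices, so by the product equations its Plücker vector is proportional to
-- `z`.
theorem exists_frame_of_plGood (bR : frames V) {p : PlIdx V lam}
    {z : projectiveSpace (plDim V lam)} (hz : z ∈ pchart (plEquiv V lam p)) (hg : PlGood p z) :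
    ∃ b : frames V, pmk (plVec lam bR b.1) (plVec_ne_zero bR b) = z := by
  have hp : minorProd (plMat p z) p ≠ 0 := by
    rw [← hg.1, plRatio, ratio_self hz]
    exact one_ne_zero
  have hinj : ∀ l, Function.Injective (plMat p z l).mulVecLin := fun l =>
    (injective_iff_map_eq_zero _).2 fun x hx => mulVec_eq_zero_of_det (minorProd_ne_zero.1 hp l) hx
  let L : ∀ l : ZMod n × Fin (numCols lam + 1),
      (Ix (finrank ℂ (V l.1)) (colDim lam l.2 l.1) → ℂ) →ₗ[ℂ] V l.1 := fun l =>
    (fbasis bR l.1).equivFun.symm.toLinearMap ∘ₗ (plMat p z l).mulVecLin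
  have hL : ∀ l x m, (fbasis bR l.1).repr (L l x) m = (plMat p z l).mulVec x m := by
    intro l x m
    exact congrFun ((fbasis bR l.1).equivFun.apply_symm_apply ((plMat p z l).mulVec x)) m
  have hfr : ∀ k i, finrank ℂ (LinearMap.range (L (i, k))) = colDim lam k i := by
    intro k i
    rw [LinearMap.finrank_range_of_inj, finrank_pi,
      card_Ix ((colDim_le lam k i).trans_eq (hlam i))]
    exact (fbasis bR i).equivFun.symm.injective.comp (hinj (i, k))
  let W : GradedFlag V lam :=
    { W := fun k i => LinearMap.range (L (i, k))
      zero := by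
        funext i
        refine Submodule.finrank_eq_zero.1 ?_
        rw [hfr]
        exact colDim_zero lam i
      last := by
        funext i
        refine Submodule.eq_top_of_finrank_eq ?_
        rw [hfr, Fin.val_last, colDim_numCols, hlam]
      mono := by
        refine Fin.monotone_iff_le_succ.2 fun k i => ?_
        rintro _ ⟨x, rfl⟩
        refine ⟨((plMat p z (i, k.castSucc)).submatrix (p (i, k.succ)) id).mulVec x, ?_⟩
        refine (fbasis bR i).repr.injective (Finsupp.ext fun m => ?_)
        refine (hL (i, k.succ) _ m).trans (Eq.trans ?_ (hL (i, k.castSucc) x m).symm)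
        conv_rhs => rw [hg.2 i k]
        rw [Matrix.mulVec_mulVec]
      finrank_eq := hfr }
  obtain ⟨b, hb⟩ := flagOfFrame_surjective hlam W
  refine ⟨b, ?_⟩
  have hmem : ∀ (l : ZMod n × Fin (numCols lam + 1))
      (c : Ix (finrank ℂ (V l.1)) (colDim lam l.2 l.1)), ∃ x, L l x = b.1 l.1 c.1 := by
    intro l c
    have h1 : b.1 l.1 c.1 ∈ W.W l.2 l.1 := by
      rw [← hb, flagOfFrame_W]
      exact Submodule.subset_span ⟨c.1, c.2, rfl⟩
    exact h1
  choose x hx using hmem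
  let S : ∀ l : ZMod n × Fin (numCols lam + 1),
      Matrix (Ix (finrank ℂ (V l.1)) (colDim lam l.2 l.1))
        (Ix (finrank ℂ (V l.1)) (colDim lam l.2 l.1)) ℂ := fun l => Matrix.of fun a c => x l c a
  have hS : ∀ l, frameMat lam bR b.1 l = plMat p z l * S l := by
    intro l
    ext m c
    change (fbasis bR l.1).repr (b.1 l.1 c.1) m = _
    rw [← hx l c, hL]
    rfl
  have hSdet : ∀ l, (S l).det ≠ 0 := by
    intro l h0
    obtain ⟨y, hy, hy'⟩ := Matrix.exists_mulVec_eq_zero_iff.2 h0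
    refine hy (frameMat_mulVec_eq_zero bR b l ?_)
    rw [hS, ← Matrix.mulVec_mulVec, hy', Matrix.mulVec_zero]
  have hvec : plVec lam bR b.1 = (∏ l, (S l).det) •
      fun a => ratio a (plEquiv V lam p) z := by
    funext a
    change minorProd (frameMat lam bR b.1) _ = _
    rw [show frameMat lam bR b.1 = fun l => plMat p z l * S l from funext hS,
      minorProd_mul, Pi.smul_apply, Pi.smul_apply, ← hg.1, plRatio, Equiv.apply_symm_apply]
  rw [← pmk_ratio hz]
  exact (pmk_eq_iff.2 ⟨_, Finset.prod_ne_zero_iff.2 fun l _ => hSdet l, hvec⟩).symm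

/-- The Plücker embedding. -/
def plMap (bR : frames V) (W : flagVariety lam hlam) : projectiveSpace (plDim V lam) :=
  pmk (plVec lam bR (frameOf hlam W).1) (plVec_ne_zero bR _)

theorem plMap_flagOfFrame (bR b : frames V) :
    plMap hlam bR (flagOfFrame lam hlam b) = pmk (plVec lam bR b.1) (plVec_ne_zero bR b) :=
  pmk_eq_iff.2 (exists_plVec_eq_smul hlam bR (flagOfFrame_frameOf hlam _))

theorem mem_range_plMap_iff (bR : frames V) {p : PlIdx V lam}
    {z : projectiveSpace (plDim V lam)} (hz : z ∈ pchart (plEquiv V lam p)) :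
    z ∈ Set.range (plMap hlam bR) ↔ PlGood p z := by
  constructor
  · rintro ⟨W, rfl⟩
    exact plGood_pmk bR _ ((pmk_mem_pchart_plEquiv bR _ p).1 hz)
  · intro h
    obtain ⟨b, hb⟩ := exists_frame_of_plGood hlam bR hz h
    exact ⟨flagOfFrame lam hlam b, (plMap_flagOfFrame hlam bR b).trans hb⟩

theorem regAt_plRatio (p q : PlIdx V lam) {z : projectiveSpace (plDim V lam)}
    (hz : z ∈ pchart (plEquiv V lam p)) :
    (projectiveSpace (plDim V lam)).RegAt (fun z => plRatio p z q) z := regAt_ratio _ _ hz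

theorem regAt_plMat (p : PlIdx V lam) {z : projectiveSpace (plDim V lam)}
    (hz : z ∈ pchart (plEquiv V lam p)) (l : ZMod n × Fin (numCols lam + 1))
    (m : Fin (finrank ℂ (V l.1))) (c : Ix (finrank ℂ (V l.1)) (colDim lam l.2 l.1)) :
    (projectiveSpace (plDim V lam)).RegAt (fun z => plMat p z l m c) z := regAt_plRatio p _ hz

theorem isClosed_range_plMap (bR : frames V) :
    IsClosed (X := projectiveSpace (plDim V lam)) (Set.range (plMap hlam bR)) := by
  refine isClosed_of_locally_zeros fun z => ?_
  obtain ⟨j, hj⟩ := exists_mem_pchart z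
  obtain ⟨p, rfl⟩ := (plEquiv V lam).surjective j
  refine ⟨pchart (plEquiv V lam p), isOpen_pchart _, hj,
    PlIdx V lam ⊕ Σ (i : ZMod n) (k : Fin (numCols lam)),
      Fin (finrank ℂ (V i)) × Ix (finrank ℂ (V i)) (colDim lam k.castSucc i),
    Sum.elim (fun q z => plRatio p z q - minorProd (plMat p z) q)
      (fun s z => plMat p z (s.1, s.2.1.castSucc) s.2.2.1 s.2.2.2 -
        (plMat p z (s.1, s.2.1.succ) * (plMat p z (s.1, s.2.1.castSucc)).submatrix
          (p (s.1, s.2.1.succ)) id) s.2.2.1 s.2.2.2), ?_, ?_⟩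
  · rintro (q | ⟨i, k, m, c⟩) z hz
    · refine regAt_sub (regAt_plRatio p q hz) (regAt_prod _ fun l _ => regAt_det fun a c => ?_)
      exact regAt_plMat p hz l _ _
    · refine regAt_sub (regAt_plMat p hz (i, k.castSucc) m c)
        (regAt_matrix_mul (fun a b => regAt_plMat p hz (i, k.succ) a b)
          (fun a b => ?_) m c)
      exact regAt_plMat p hz (i, k.castSucc) _ _
  · intro z hz
    rw [mem_range_plMap_iff hlam bR hz]
    constructor
    · rintro ⟨h1, h2⟩ (q | ⟨i, k, m, c⟩)
      · exact sub_eq_zero.2 (h1 q)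
      · exact sub_eq_zero.2 (congrFun (congrFun (h2 i k) m) c)
    · intro h
      refine ⟨fun q => sub_eq_zero.1 (h (Sum.inl q)), fun i k => ?_⟩
      ext m c
      exact sub_eq_zero.1 (h (Sum.inr ⟨i, k, m, c⟩))

end Plucker
end CyclicQuiver

/-! ### The Plücker map is an isomorphism onto its image -/

namespace CyclicQuiver
open FSpace

section PluckerIso

variable {n : ℕ} [NeZero n] {V : ZMod n → Type u} [∀ i, AddCommGroup (V i)] [∀ i, Module ℂ (V i)]
  [∀ i, FiniteDimensional ℂ (V i)] {lam : ZMod n → YoungDiagram}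
  (hlam : ∀ i, dimVec lam i = finrank ℂ (V i))

/-- Change of coordinates between frames. -/
def changeMat (b0 bR : frames V) (i : ZMod n) :
    Matrix (Fin (finrank ℂ (V i))) (Fin (finrank ℂ (V i))) ℂ :=
  Matrix.of fun m m' => (fbasis b0 i).repr (fbasis bR i m') m

theorem colMat_eq_changeMat_mul (b0 bR : frames V) (b : FrameSpace V) (i : ZMod n) (D : ℕ) :
    colMat (fbasis b0 i) (b i) D = changeMat b0 bR i * colMat (fbasis bR i) (b i) D := by
  ext m c
  have h := congrArg (fun w => (fbasis b0 i).repr w m) ((fbasis bR i).sum_repr (b i c.1))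
  simp only [map_sum, map_smul, Finsupp.finsetSum_apply, Finsupp.smul_apply, smul_eq_mul] at h
  simp only [colMat, changeMat, Matrix.mul_apply, Matrix.of_apply]
  rw [← h]
  exact Finset.sum_congr rfl fun _ _ => mul_comm _ _

/-- The position of `blk lam i j` as an index of a member of a flag. -/
def blkFin (i : ZMod n) (j : Fin (finrank ℂ (V i))) : Fin (numCols lam + 1) :=
  ⟨blk lam i j, Nat.lt_succ_of_le (blk_le_numCols (j.2.trans_eq (hlam i).symm))⟩

/-- The index `j` among the columns of the matrix of the member `blk lam i j` of a flag. -/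
def blkIx (i : ZMod n) (j : Fin (finrank ℂ (V i))) :
    Ix (finrank ℂ (V i)) (colDim lam (blk lam i j) i) :=
  ⟨j, lt_colDim_blk (j.2.trans_eq (hlam i).symm)⟩

/-- The matrix recovered from Plücker coordinates is that of the frame in the reference frame `bR`,
up to an invertible minor on the right; `changeMat` passes from `bR` to `b0`. Hence cell membership
and chart coordinates can be read off from Plücker coordinates. -/
theorem exists_colMat_frameOf (b0 bR : frames V) {W : flagVariety lam hlam} {p : PlIdx V lam}
    (hp : plMap hlam bR W ∈ pchart (plEquiv V lam p)) (i : ZMod n) (k : Fin (numCols lam + 1)) :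
    ∃ A : Matrix (Ix (finrank ℂ (V i)) (colDim lam k i))
      (Ix (finrank ℂ (V i)) (colDim lam k i)) ℂ, A.det ≠ 0 ∧
      colMat (fbasis b0 i) ((frameOf hlam W).1 i) (colDim lam k i) =
        changeMat b0 bR i * plMat p (plMap hlam bR W) (i, k) * A := by
  have hp' := (pmk_mem_pchart_plEquiv bR _ p).1 hp
  refine ⟨_, minorProd_ne_zero.1 hp' (i, k), ?_⟩
  rw [Matrix.mul_assoc, plMap, plMat_pmk bR _ hp',
    nrm_mul_submatrix (minorProd_ne_zero.1 hp' (i, k))]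
  exact colMat_eq_changeMat_mul b0 bR (frameOf hlam W).1 i _

theorem mem_cell_iff_plMat (b0 bR : frames V) {W : flagVariety lam hlam} {p : PlIdx V lam}
    (hp : plMap hlam bR W ∈ pchart (plEquiv V lam p)) : W ∈ cell hlam b0 ↔
      ∀ (k : Fin (numCols lam + 1)) (i : ZMod n), ((changeMat b0 bR i *
        plMat p (plMap hlam bR W) (i, k)).submatrix Subtype.val id).det ≠ 0 := by
  refine forall_congr' fun k => forall_congr' fun i => ?_
  obtain ⟨A, hA, h⟩ := exists_colMat_frameOf hlam b0 bR hp i k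
  rw [h, submatrix_mul, Matrix.det_mul]
  exact ⟨left_ne_zero_of_mul, fun h => mul_ne_zero h hA⟩

theorem repr_sec_eq_plMat (b0 bR : frames V) {W : flagVariety lam hlam} {p : PlIdx V lam}
    (hp : plMap hlam bR W ∈ pchart (plEquiv V lam p)) (i : ZMod n)
    (j m : Fin (finrank ℂ (V i))) : (fbasis b0 i).repr (sec hlam b0 W i j) m =
      nrm Subtype.val (changeMat b0 bR i * plMat p (plMap hlam bR W) (i, blkFin hlam i j)) m
        (blkIx hlam i j) := by
  obtain ⟨A, hA, h⟩ := exists_colMat_frameOf hlam b0 bR hp i (blkFin hlam i j)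
  refine (repr_normFrame hlam b0 (frameOf hlam W).1 i j m).trans ?_
  have h' : colMat (fbasis b0 i) ((frameOf hlam W).1 i) (colDim lam (blk lam i j) i) =
    changeMat b0 bR i * plMat p (plMap hlam bR W) (i, blkFin hlam i j) * A := h
  rw [h']
  exact congrFun (congrFun (nrm_mul hA) m) _

theorem plMap_injective (bR : frames V) : Function.Injective (plMap hlam bR) := by
  intro W W' h
  obtain ⟨j, hj⟩ := exists_mem_pchart (plMap hlam bR W)
  obtain ⟨p, rfl⟩ := (plEquiv V lam).surjective j
  have hj' : plMap hlam bR W' ∈ pchart (plEquiv V lam p) := h ▸ hj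
  obtain ⟨b0, hb0⟩ := exists_mem_cell hlam W
  have hb0' : W' ∈ cell hlam b0 :=
    (mem_cell_iff_plMat hlam b0 bR hj').2 (h ▸ (mem_cell_iff_plMat hlam b0 bR hj).1 hb0)
  rw [← chartFlag_sec hlam hb0, ← chartFlag_sec hlam hb0']
  congr 2
  funext i j
  refine (fbasis b0 i).repr.injective (Finsupp.ext fun m => ?_)
  rw [repr_sec_eq_plMat hlam b0 bR hj, repr_sec_eq_plMat hlam b0 bR hj', h]

theorem isMorphism_plMap (bR : frames V) :
    IsMorphism (X := flagVariety lam hlam) (plMap hlam bR) := by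
  refine isMorphism_iff.2 fun W => morAt_quotient (X := frames V) isOpen_univ (fun b _ => ?_)
    (Set.mem_univ W)
  refine morAt_projectiveSpace (X := frames V) (g := fun b => plVec lam bR b.1) (fun a => ?_)
    (plVec_ne_zero bR b) fun b hb => plMap_flagOfFrame hlam bR b
  exact regAt_prod (X := frames V) _ fun l _ => regAt_det (X := frames V)
    fun m c => regAt_frames bR l.1 _ c.1 b

theorem isIsom_plMap (bR : frames V) :
    IsIsom (X := flagVariety lam hlam)
      (Y := (projectiveSpace (plDim V lam)).sub (Set.range (plMap hlam bR)))
      (fun W => ⟨plMap hlam bR W, W, rfl⟩) := by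
  let g : (projectiveSpace (plDim V lam)).sub (Set.range (plMap hlam bR)) →
    flagVariety lam hlam := fun z => z.2.choose
  have hg : ∀ z, plMap hlam bR (g z) = z.1 := fun z => z.2.choose_spec
  refine .mk' (g := g) (isMorphism_sub_iff.2 (isMorphism_plMap hlam bR)) ?_
    (fun W => plMap_injective hlam bR (hg _)) (fun z => Subtype.ext (hg z))
  refine isMorphism_iff.2 fun z => ?_
  obtain ⟨j, hj⟩ := exists_mem_pchart z.1
  obtain ⟨p, rfl⟩ := (plEquiv V lam).surjective j
  obtain ⟨b0, hb0⟩ := exists_mem_cell hlam (g z)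
  have hdet := (mem_cell_iff_plMat hlam b0 bR ((hg z).symm ▸ hj)).1 hb0
  rw [hg] at hdet
  have hreg : ∀ (i : ZMod n) (k : Fin (numCols lam + 1)) (m : Fin (finrank ℂ (V i)))
      (c : Ix (finrank ℂ (V i)) (colDim lam k i)),
      ((projectiveSpace (plDim V lam)).sub (Set.range (plMap hlam bR))).RegAt
        (fun y => (changeMat b0 bR i * plMat p y.1 (i, k)) m c) z := by
    intro i k m c
    have h1 : ∀ a b, ((projectiveSpace (plDim V lam)).sub (Set.range (plMap hlam bR))).RegAt
        (fun y => plMat p y.1 (i, k) a b) z :=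
      fun a b => (morAt_val z).regAt (regAt_plMat p hj (i, k) a b)
    exact regAt_matrix_mul (M := fun _ => changeMat b0 bR i)
      (fun a b => FSpace.regAt_const _ _ _) h1 m c
  -- Near `z` the inverse stays in one cell and one projective chart. There it is the cell chart
  -- applied to coordinates `s` that are rational in the Plücker coordinates.
  have hev : ∀ᶠ y in 𝓝 z, g y ∈ cell hlam b0 ∧
      plMap hlam bR (g y) ∈ pchart (plEquiv V lam p) := by
    have h1 : ∀ᶠ y in 𝓝 z, y.1 ∈ pchart (plEquiv V lam p) :=
      (isMorphism_val (X := projectiveSpace (plDim V lam))).1.continuousAt.eventually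
        ((isOpen_pchart _).mem_nhds hj)
    have h2 : ∀ᶠ y in 𝓝 z, ∀ (k : Fin (numCols lam + 1)) (i : ZMod n), ((changeMat b0 bR i *
        plMat p y.1 (i, k)).submatrix Subtype.val id).det ≠ 0 := by
      refine Filter.eventually_all.2 fun k => Filter.eventually_all.2 fun i => ?_
      exact FSpace.eventually_ne _ (regAt_det (M := fun y : (projectiveSpace (plDim V lam)).sub
        (Set.range (plMap hlam bR)) => (changeMat b0 bR i * plMat p y.1 (i, k)).submatrix
          Subtype.val id) fun a c => hreg i k a.1 c) (hdet k i)
    filter_upwards [h1, h2] with y hy hy'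
    have hy1 : plMap hlam bR (g y) ∈ pchart (plEquiv V lam p) := (hg y).symm ▸ hy
    refine ⟨(mem_cell_iff_plMat hlam b0 bR hy1).2 ?_, hy1⟩
    rwa [hg]
  let s : (projectiveSpace (plDim V lam)).sub (Set.range (plMap hlam bR)) →
      affine (FlagIdx V lam → ℂ) := fun y t =>
    nrm Subtype.val (changeMat b0 bR t.1.1 * plMat p y.1 (t.1.1, blkFin hlam t.1.1 t.1.2.2))
      t.1.2.1 (blkIx hlam t.1.1 t.1.2.2)
  have hs : MorAt s z := by
    refine morAt_affine_pi.2 fun t => ?_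
    have h1 := hreg t.1.1 (blkFin hlam t.1.1 t.1.2.2)
    have h2 := regAt_matrix_inv (M := fun y : (projectiveSpace (plDim V lam)).sub
      (Set.range (plMap hlam bR)) => (changeMat b0 bR t.1.1 *
        plMat p y.1 (t.1.1, blkFin hlam t.1.1 t.1.2.2)).submatrix Subtype.val id)
      (fun a b => h1 a.1 b) (hdet (blkFin hlam t.1.1 t.1.2.2) t.1.1)
    exact regAt_matrix_mul h1 h2 t.1.2.1 (blkIx hlam t.1.1 t.1.2.2)
  refine MorAt.congr (f := fun y => chartFlag hlam b0 (s y))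
    (((isMorphism_chartFlag hlam b0).morAt _).comp hs) ?_
  filter_upwards [hev] with y hy
  have h1 : s y = chartCoord b0 (sec hlam b0 (g y)) := by
    funext t
    rw [chartCoord, repr_sec_eq_plMat hlam b0 bR hy.2, hg]
  rw [h1]
  exact chartFlag_sec hlam hy.1

theorem isProjectiveVariety_flagVariety : IsProjectiveVariety (flagVariety lam hlam) := by
  obtain ⟨bR⟩ := nonempty_frames V
  exact ⟨_, _, isClosed_range_plMap hlam bR, _, isIsom_plMap hlam bR⟩

theorem isVariety_flagVariety : IsVariety (flagVariety lam hlam) := by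
  obtain ⟨bR⟩ := nonempty_frames V
  exact (isVariety_projectiveSpace.closed_sub (isClosed_range_plMap hlam bR)).of_isIsom
    ⟨_, isIsom_plMap hlam bR⟩

end PluckerIso
end CyclicQuiver

/-! ### Regular families of linear maps; the nilpotent variety -/

namespace FSpace

section Bilinear

variable {X : FSpace.{u}} {x : X} {E₁ E₂ E₃ : Type*} [AddCommGroup E₁] [Module ℂ E₁]
  [AddCommGroup E₂] [Module ℂ E₂] [AddCommGroup E₃] [Module ℂ E₃]

theorem morAt_linear (L : E₁ →ₗ[ℂ] E₂) {f : X → E₁} (hf : MorAt (Y := affine E₁) f x) :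
    MorAt (Y := affine E₂) (fun y => L (f y)) x :=
  ((isMorphism_linearMap L).morAt _).comp hf

theorem morAt_bilin [FiniteDimensional ℂ E₁] [FiniteDimensional ℂ E₂]
    (L : E₁ →ₗ[ℂ] E₂ →ₗ[ℂ] E₃) {f : X → E₁} {g : X → E₂}
    (hf : MorAt (Y := affine E₁) f x) (hg : MorAt (Y := affine E₂) g x) :
    MorAt (Y := affine E₃) (fun y => L (f y) (g y)) x := by
  refine morAt_affine fun φ => ?_
  let b₁ := finBasis ℂ E₁
  let b₂ := finBasis ℂ E₂
  have key : ∀ y, ∑ s, ∑ t, b₁.repr (f y) s * b₂.repr (g y) t * φ (L (b₁ s) (b₂ t)) =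
      φ (L (f y) (g y)) := by
    intro y
    conv_rhs => rw [← b₁.sum_repr (f y), ← b₂.sum_repr (g y)]
    simp only [map_sum, map_smul, LinearMap.sum_apply, LinearMap.smul_apply, smul_eq_mul,
      Finset.mul_sum, mul_assoc]
    rw [Finset.sum_comm]
    exact Finset.sum_congr rfl fun _ _ => Finset.sum_congr rfl fun _ _ => by ring
  refine X.regAt_congr (Filter.Eventually.of_forall key) ?_
  refine regAt_sum _ fun s _ => regAt_sum _ fun t _ => regAt_mul' (regAt_mul' ?_ ?_)
    (X.regAt_const _ _)
  · exact (morAt_affine_basis b₁).1 hf s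
  · exact (morAt_affine_basis b₂).1 hg t

theorem morAt_pow [FiniteDimensional ℂ E₁] {f : X → Module.End ℂ E₁}
    (hf : MorAt (Y := affine (Module.End ℂ E₁)) f x) (k : ℕ) :
    MorAt (Y := affine (Module.End ℂ E₁)) (fun y => f y ^ k) x := by
  induction k with
  | zero =>
    simp only [pow_zero]
    exact morAt_const _ _
  | succ k ih =>
    simp only [pow_succ]
    exact morAt_bilin (LinearMap.mul ℂ (Module.End ℂ E₁)) ih hf

theorem regAt_dual_comp {f : X → E₁} (hf : MorAt (Y := affine E₁) f x) (φ : Dual ℂ E₁) :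
    X.RegAt (fun y => φ (f y)) x := morAt_affine_iff.1 hf φ

end Bilinear

end FSpace

namespace CyclicQuiver
open FSpace

section Reps

variable {n : ℕ} {V : ZMod n → Type u} [∀ i, AddCommGroup (V i)] [∀ i, Module ℂ (V i)]

variable (V) in
/-- The linear map `Rep.toEnd`. -/
def toEndLin : Rep V →ₗ[ℂ] Module.End ℂ (∀ i, V i) where
  toFun x := x.toEnd
  map_add' x y := by
    ext v i
    simp [Rep.toEnd]
  map_smul' c x := by
    ext v i
    simp [Rep.toEnd]

theorem toEnd_apply (x : Rep V) (v : ∀ i, V i) (i : ZMod n) : x.toEnd v i = x i (v (i + 1)) := rfl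

variable [NeZero n] [∀ i, FiniteDimensional ℂ (V i)]

/-- Cayley–Hamilton gives an exponent independent of `x`, which makes nilpotency a polynomial
condition. -/
theorem isNilpotent_iff (x : Rep V) :
    IsNilpotent x.toEnd ↔ x.toEnd ^ finrank ℂ (∀ i, V i) = 0 := by
  refine ⟨fun h => ?_, fun h => ⟨_, h⟩⟩
  have h1 := x.toEnd.aeval_self_charpoly
  rwa [IsNilpotent.charpoly_eq_X_pow_finrank h, map_pow, Polynomial.aeval_X] at h1

theorem isClosed_nilp : IsClosed (X := affine (Rep V)) {x : Rep V | IsNilpotent x.toEnd} := by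
  refine isClosed_of_locally_zeros (X := affine (Rep V)) fun x => ⟨Set.univ, isOpen_univ, trivial,
    _, fun t (x : Rep V) => (finBasis ℂ (Module.End ℂ (∀ i, V i))).repr
      (x.toEnd ^ finrank ℂ (∀ i, V i)) t, ?_, ?_⟩
  · intro t x _
    have h1 : MorAt (X := affine (Rep V)) (Y := affine (Module.End ℂ (∀ i, V i)))
      (fun x : Rep V => toEndLin V x) x := (isMorphism_linearMap (toEndLin V)).morAt x
    exact (morAt_affine_basis (finBasis ℂ (Module.End ℂ (∀ i, V i)))).1
      (morAt_pow h1 (finrank ℂ (∀ i, V i))) t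
  · have key : ∀ x : Rep V, IsNilpotent x.toEnd ↔ ∀ t,
        (finBasis ℂ (Module.End ℂ (∀ i, V i))).repr (x.toEnd ^ finrank ℂ (∀ i, V i)) t = 0 := by
      intro x
      rw [isNilpotent_iff]
      constructor
      · intro h t
        rw [h, map_zero]
        rfl
      · intro h
        refine (finBasis ℂ (Module.End ℂ (∀ i, V i))).repr.injective (Finsupp.ext fun t => ?_)
        rw [h t, map_zero]
        rfl
    exact fun x _ => key x

variable (V) in
theorem isAffineVariety_nilpVariety : IsAffineVariety (nilpVariety V) :=
  isAffineVariety_closed isClosed_nilp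

theorem morAt_rep {X : FSpace.{v}} {x : X} (b0 : frames V) {f : X → Rep V}
    (h : ∀ i m j, X.RegAt (fun y => (fbasis b0 i).repr (f y i (b0.1 (i + 1) j)) m) x) :
    MorAt (Y := affine (Rep V)) f x := by
  refine (morAt_affine_basis (Pi.basis fun i : ZMod n =>
    (fbasis b0 (i + 1)).linearMap (fbasis b0 i))).2 ?_
  rintro ⟨i, m, j⟩
  refine X.regAt_congr (Filter.Eventually.of_forall fun y => ?_) (h i m j)
  have key : ∀ g : Rep V, (fbasis b0 i).repr (g i (b0.1 (i + 1) j)) m =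
      (Pi.basis fun i : ZMod n => (fbasis b0 (i + 1)).linearMap (fbasis b0 i)).repr g
        ⟨i, m, j⟩ := by
    intro g
    rw [Pi.basis_repr, Basis.linearMap_repr_apply, ← fbasis_apply]
    exact (LinearMap.toMatrix_apply _ _ _ _ _).symm
  exact key (f y)

/-- Coordinates with respect to a varying frame. -/
theorem regAt_repr_const (i : ZMod n) (v : V i) (m : Fin (finrank ℂ (V i))) (b : frames V) :
    (frames V).RegAt (fun b => (fbasis b i).repr v m) b := by
  -- Coordinates in `b'` come from those in the fixed frame `b` by the inverse of the matrix of `b'`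
  -- in `b`, which is the identity at `b' = b`.
  have key : ∀ b' : frames V, (((fbasis b i).toMatrix (b'.1 i))⁻¹.mulVec
      ((fbasis b i).repr v)) m = (fbasis b' i).repr v m := by
    intro b'
    have h1 : (fbasis b' i).toMatrix (fbasis b i) * (fbasis b i).toMatrix (b'.1 i) = 1 := by
      rw [← coe_fbasis b', Basis.toMatrix_mul_toMatrix_flip]
    rw [Matrix.inv_eq_left_inv h1, Basis.toMatrix_mulVec_repr]
  refine (frames V).regAt_congr (Filter.Eventually.of_forall key) ?_
  change (frames V).RegAt (fun b' => ∑ c, ((fbasis b i).toMatrix (b'.1 i))⁻¹ m c *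
    (fbasis b i).repr v c) b
  refine regAt_sum (X := frames V) _ fun c _ => regAt_mul' (X := frames V) ?_
    ((frames V).regAt_const _ _)
  refine regAt_matrix_inv (X := frames V) (M := fun b' => (fbasis b i).toMatrix (b'.1 i))
    (fun a c => regAt_frames b i a c b) ?_ m c
  rw [← coe_fbasis b, Basis.toMatrix_self, Matrix.det_one]
  exact one_ne_zero

variable {X : FSpace.{v}} {x : X}

theorem regAt_repr {f : X → frames V} (hf : MorAt f x) {i : ZMod n} {g : X → V i}
    (hg : MorAt (Y := affine (V i)) g x) (m : Fin (finrank ℂ (V i))) :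
    X.RegAt (fun y => (fbasis (f y) i).repr (g y) m) x := by
  let β := finBasis ℂ (V i)
  have key : ∀ y, ∑ c, β.repr (g y) c * (fbasis (f y) i).repr (β c) m =
      (fbasis (f y) i).repr (g y) m := by
    intro y
    conv_rhs => rw [← β.sum_repr (g y)]
    simp only [map_sum, map_smul, Finsupp.finsetSum_apply, Finsupp.smul_apply, smul_eq_mul]
  refine X.regAt_congr (Filter.Eventually.of_forall key) (regAt_sum _ fun c _ => regAt_mul' ?_ ?_)
  · exact (morAt_affine_basis β).1 hg c
  · exact hf.regAt (regAt_repr_const i (β c) m (f x))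

theorem morAt_frame_vec {f : X → frames V} (hf : MorAt f x) (i : ZMod n)
    (j : Fin (finrank ℂ (V i))) : MorAt (Y := affine (V i)) (fun y => (f y).1 i j) x := by
  have h1 : MorAt (Y := affine (FrameSpace V)) (fun y => ((f y).1 : FrameSpace V)) x :=
    morAt_sub_iff.1 hf
  exact morAt_linear (LinearMap.proj j ∘ₗ LinearMap.proj i :
    FrameSpace V →ₗ[ℂ] V i) h1

theorem morAt_rep_apply {g : X → Rep V} (hg : MorAt (Y := affine (Rep V)) g x) {i : ZMod n}
    {h : X → V (i + 1)} (hh : MorAt (Y := affine (V (i + 1))) h x) :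
    MorAt (Y := affine (V i)) (fun y => g y i (h y)) x :=
  morAt_bilin (LinearMap.proj i : Rep V →ₗ[ℂ] _) hg hh

end Reps
end CyclicQuiver

/-! ### The incidence variety as a vector bundle over the flag variety -/

namespace FSpace

theorem IsIsom.prod_right {B : FSpace.{u}} {Y : FSpace.{v}} {Z : FSpace.{w}} {f : Y → Z}
    (hf : IsIsom f) : IsIsom (X := B.prod Y) (Y := B.prod Z) (fun z => (z.1, f z.2)) := by
  obtain ⟨hf, g, hg, h1, h2⟩ := hf
  exact .mk' (g := fun z => (z.1, g z.2))
    (isMorphism_prod isMorphism_fst (hf.comp isMorphism_snd))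
    (isMorphism_prod isMorphism_fst (hg.comp isMorphism_snd))
    (fun z => Prod.ext rfl (h1 z.2)) (fun z => Prod.ext rfl (h2 z.2))

theorem isMorphism_fst_val {X : FSpace.{u}} {S : Set X} {Y : FSpace.{v}} :
    IsMorphism (X := (X.sub S).prod Y) (Y := X) (fun z => z.1.1) :=
  isMorphism_val.comp isMorphism_fst

theorem morAt_comp_fst_val {X : FSpace.{u}} {S : Set X} {Y : FSpace.{v}} {Z : FSpace.{w}}
    {g : X → Z} {z : (X.sub S).prod Y} (hg : MorAt g z.1.1) :
    MorAt (X := (X.sub S).prod Y) (fun z => g z.1.1) z :=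
  MorAt.comp (X := (X.sub S).prod Y) (f := fun z => z.1.1) hg (isMorphism_fst_val.morAt z)

end FSpace

namespace CyclicQuiver
open FSpace

section Resolution

variable {n : ℕ} [NeZero n] {V : ZMod n → Type u} [∀ i, AddCommGroup (V i)] [∀ i, Module ℂ (V i)]

variable (V) in
/-- The indices of the linear coordinates of the fibres over the flag variety. -/
abbrev RepIdx (lam : ZMod n → YoungDiagram) : Type :=
  {p : Σ i : ZMod n, Fin (finrank ℂ (V i)) × Fin (finrank ℂ (V (i + 1))) //
    (p.2.1 : ℕ) < colDim lam (blk lam (p.1 + 1) p.2.2 - 1) p.1}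

variable [∀ i, FiniteDimensional ℂ (V i)] {lam : ZMod n → YoungDiagram}

/-- The representation with given coordinates in a frame. -/
def repOf (b : frames V) (c : RepIdx V lam → ℂ) : Rep V := fun i =>
  (fbasis b (i + 1)).constr ℂ fun j => ∑ m : Fin (finrank ℂ (V i)),
    (if h : (m : ℕ) < colDim lam (blk lam (i + 1) j - 1) i then c ⟨⟨i, m, j⟩, h⟩ else 0) •
      fbasis b i m

/-- The coordinates of a representation in a frame. -/
def repCoord (lam : ZMod n → YoungDiagram) (b : frames V) (x : Rep V) : RepIdx V lam → ℂ :=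
  fun t => (fbasis b t.1.1).repr (x t.1.1 (b.1 (t.1.1 + 1) t.1.2.2)) t.1.2.1

theorem repr_repOf (b : frames V) (c : RepIdx V lam → ℂ) (i : ZMod n)
    (j : Fin (finrank ℂ (V (i + 1)))) (m : Fin (finrank ℂ (V i))) :
    (fbasis b i).repr (repOf b c i (b.1 (i + 1) j)) m =
      if h : (m : ℕ) < colDim lam (blk lam (i + 1) j - 1) i then c ⟨⟨i, m, j⟩, h⟩ else 0 := by
  rw [← fbasis_apply b (i + 1) j, repOf, Basis.constr_basis, Basis.repr_sum_self]

theorem repCoord_repOf (b : frames V) (c : RepIdx V lam → ℂ) :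
    repCoord lam b (repOf b c) = c := by
  funext ⟨⟨i, m, j⟩, h⟩
  rw [repCoord, repr_repOf, dif_pos h]

/-- The condition that a representation lowers the steps of a flag. -/
def Inc (x : Rep V) (W : GradedFlag V lam) : Prop :=
  ∀ (k : Fin (numCols lam)) (i : ZMod n), ∀ w ∈ W.W k.succ (i + 1), x i w ∈ W.W k.castSucc i

theorem Inc.pow_mem {x : Rep V} {W : GradedFlag V lam} (h : Inc x W) (k : ℕ)
    (hk : k ≤ numCols lam) (v : ∀ i, V i) (i : ZMod n) :
    (x.toEnd ^ k) v i ∈ W.W ⟨numCols lam - k, by omega⟩ i := by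
  induction k generalizing i with
  | zero =>
    have h1 : W.W (Fin.last _) i = ⊤ := congrFun W.last i
    change _ ∈ W.W (Fin.last _) i
    rw [h1]
    trivial
  | succ k ih =>
    rw [pow_succ', Module.End.mul_apply, toEnd_apply]
    refine h ⟨numCols lam - (k + 1), by omega⟩ i _ ?_
    have h1 : (⟨numCols lam - (k + 1), by omega⟩ : Fin (numCols lam)).succ =
        ⟨numCols lam - k, by omega⟩ := Fin.ext (by simp; omega)
    rw [h1]
    exact ih (by omega) (i + 1)

/-- Each application of `x` lowers the step by one. So nilpotency imposes no further condition, and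
the fibres over the flag variety are full linear spaces. -/
theorem Inc.isNilpotent {x : Rep V} {W : GradedFlag V lam} (h : Inc x W) :
    IsNilpotent x.toEnd := by
  refine ⟨numCols lam, LinearMap.ext fun v => funext fun i => ?_⟩
  have h1 := h.pow_mem _ le_rfl v i
  have h2 : W.W ⟨numCols lam - numCols lam, by omega⟩ i = ⊥ := by
    have h3 : (⟨numCols lam - numCols lam, by omega⟩ : Fin (numCols lam + 1)) = 0 :=
      Fin.ext (by simp)
    rw [h3]
    exact congrFun W.zero i
  rw [h2] at h1
  exact h1

variable (hlam : ∀ i, dimVec lam i = finrank ℂ (V i))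

/-- Ensures that the subtraction in `blk - 1` is never truncated. -/
theorem one_le_blk {i : ZMod n} {j : ℕ} (hj : j < dimVec lam i) : 1 ≤ blk lam i j := by
  by_contra hcon
  have h1 := (blk_le_iff (k := 0) hj).1 (by omega)
  rw [colDim_zero] at h1
  omega

/-- It suffices to test each frame vector at the first step that contains it: the later conditions
follow because the steps increase. -/
theorem inc_flagOfFrame_iff (b : frames V) (x : Rep V) : Inc x (flagOfFrame lam hlam b) ↔
    ∀ i (j : Fin (finrank ℂ (V (i + 1)))) (m : Fin (finrank ℂ (V i))),
      colDim lam (blk lam (i + 1) j - 1) i ≤ m →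
        (fbasis b i).repr (x i (b.1 (i + 1) j)) m = 0 := by
  constructor
  · intro h i j m hm
    have hj := j.2.trans_eq (hlam (i + 1)).symm
    have h1 := one_le_blk hj
    have h2 := blk_le_numCols hj
    have h3 := lt_colDim_blk hj
    have h4 := h ⟨blk lam (i + 1) j - 1, by omega⟩ i (b.1 (i + 1) j) (by
      rw [flagOfFrame_W]
      refine Submodule.subset_span ⟨j, ?_, rfl⟩
      show (j : ℕ) < colDim lam (blk lam (i + 1) j - 1 + 1) (i + 1)
      rwa [Nat.sub_add_cancel h1])
    rw [flagOfFrame_W, ← coe_fbasis b i] at h4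
    exact (mem_span_lt_iff_repr _).1 h4 m hm
  · intro h k i
    have h1 : (flagOfFrame lam hlam b).W k.succ (i + 1) ≤
        ((flagOfFrame lam hlam b).W k.castSucc i).comap (x i) := by
      rw [flagOfFrame_W, Submodule.span_le]
      rintro _ ⟨j, hj, rfl⟩
      have hj' := j.2.trans_eq (hlam (i + 1)).symm
      have h2 : blk lam (i + 1) j ≤ k + 1 := (blk_le_iff hj').2 hj
      change x i (b.1 (i + 1) j) ∈ (flagOfFrame lam hlam b).W k.castSucc i
      rw [flagOfFrame_W, ← coe_fbasis b i]
      refine (mem_span_lt_iff_repr _).2 fun m hm => h i j m ?_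
      exact (colDim_mono lam i (show blk lam (i + 1) j - 1 ≤ k by omega)).trans hm
    exact fun w hw => h1 hw

theorem inc_repOf (b : frames V) (c : RepIdx V lam → ℂ) :
    Inc (repOf b c) (flagOfFrame lam hlam b) := by
  refine (inc_flagOfFrame_iff hlam b _).2 fun i j m hm => ?_
  rw [repr_repOf, dif_neg (by omega)]

theorem repOf_repCoord {b : frames V} {x : Rep V} (h : Inc x (flagOfFrame lam hlam b)) :
    repOf b (repCoord lam b x) = x := by
  funext i
  refine (fbasis b (i + 1)).ext fun j => (fbasis b i).repr.injective (Finsupp.ext fun m => ?_)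
  rw [fbasis_apply, repr_repOf]
  by_cases hm : (m : ℕ) < colDim lam (blk lam (i + 1) j - 1) i
  · rw [dif_pos hm]
    rfl
  · rw [dif_neg hm, (inc_flagOfFrame_iff hlam b x).1 h i j m (by omega)]

/-- The point of the resolution with given coordinates in a frame. -/
def resPt (b : frames V) (c : RepIdx V lam → ℂ) : resolution lam hlam :=
  ⟨(⟨repOf b c, (inc_repOf hlam b c).isNilpotent⟩, flagOfFrame lam hlam b), inc_repOf hlam b c⟩

theorem inc_of_resolution (z : resolution lam hlam) :
    Inc (repPart lam hlam z) (projFlag lam hlam z : GradedFlag V lam) := z.2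

theorem resolution_ext {z z' : resolution lam hlam}
    (h : projFlag lam hlam z = projFlag lam hlam z')
    (h' : repPart lam hlam z = repPart lam hlam z') : z = z' :=
  Subtype.ext (Prod.ext (Subtype.ext h') h)

theorem resPt_eq {b : frames V} {z : resolution lam hlam}
    (h : flagOfFrame lam hlam b = projFlag lam hlam z) :
    resPt hlam b (repCoord lam b (repPart lam hlam z)) = z := by
  refine resolution_ext hlam h ?_
  have h1 := inc_of_resolution hlam z
  rw [← h] at h1
  exact repOf_repCoord hlam h1

section Regularity

variable {X : FSpace.{v}} {x : X}

theorem morAt_repOf {f : X → frames V} {c : X → RepIdx V lam → ℂ} (hf : MorAt f x)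
    (hc : MorAt (Y := affine (RepIdx V lam → ℂ)) c x) :
    MorAt (Y := affine (Rep V)) (fun y => repOf (f y) (c y)) x := by
  obtain ⟨b0⟩ := nonempty_frames V
  refine morAt_rep b0 fun i m0 j0 => ?_
  have key : ∀ y, ∑ j, (fbasis (f y) (i + 1)).repr (b0.1 (i + 1) j0) j *
      ∑ m : Fin (finrank ℂ (V i)),
        (if h : (m : ℕ) < colDim lam (blk lam (i + 1) j - 1) i then c y ⟨⟨i, m, j⟩, h⟩ else 0) *
          (fbasis b0 i).repr ((f y).1 i m) m0 =
      (fbasis b0 i).repr (repOf (f y) (c y) i (b0.1 (i + 1) j0)) m0 := by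
    intro y
    rw [repOf, Basis.constr_apply_fintype]
    simp only [map_sum, map_smul, Finsupp.finsetSum_apply, Finsupp.smul_apply, smul_eq_mul,
      Basis.equivFun_apply, fbasis_apply]
  refine X.regAt_congr (Filter.Eventually.of_forall key) ?_
  refine regAt_sum _ fun j _ => regAt_mul' ?_ (regAt_sum _ fun m _ => regAt_mul' ?_ ?_)
  · exact regAt_repr hf (morAt_const _ _) j
  · by_cases h : (m : ℕ) < colDim lam (blk lam (i + 1) j - 1) i
    · simp only [dif_pos h]
      exact (morAt_affine_pi.1 hc) _
    · simp only [dif_neg h]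
      exact X.regAt_const _ _
  · exact regAt_repr (morAt_const b0 x) (morAt_frame_vec hf i m) m0

theorem morAt_repCoord {f : X → frames V} {g : X → Rep V} (hf : MorAt f x)
    (hg : MorAt (Y := affine (Rep V)) g x) :
    MorAt (Y := affine (RepIdx V lam → ℂ)) (fun y => repCoord lam (f y) (g y)) x :=
  morAt_affine_pi.2 fun t =>
    regAt_repr hf (morAt_rep_apply hg (morAt_frame_vec hf (t.1.1 + 1) t.1.2.2)) t.1.2.1

theorem morAt_resolution {f : X → resolution lam hlam}
    (h1 : MorAt (Y := affine (Rep V)) (fun y => repPart lam hlam (f y)) x)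
    (h2 : MorAt (Y := flagVariety lam hlam) (fun y => projFlag lam hlam (f y)) x) :
    MorAt f x :=
  morAt_sub_iff.2 (morAt_prod (X := nilpVariety V) (Y := flagVariety lam hlam)
    (morAt_sub_iff.2 h1) h2)

end Regularity

theorem isMorphism_projRep : IsMorphism (X := resolution lam hlam) (projRep lam hlam) :=
  IsMorphism.comp (Y := (nilpVariety V).prod (flagVariety lam hlam)) (Z := nilpVariety V)
    isMorphism_fst isMorphism_val

theorem isMorphism_projFlag : IsMorphism (X := resolution lam hlam) (projFlag lam hlam) :=
  IsMorphism.comp (Y := (nilpVariety V).prod (flagVariety lam hlam)) (Z := flagVariety lam hlam)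
    isMorphism_snd isMorphism_val

theorem isMorphism_repPart :
    IsMorphism (X := resolution lam hlam) (Y := affine (Rep V)) (repPart lam hlam) :=
  IsMorphism.comp (Y := nilpVariety V) (Z := affine (Rep V)) isMorphism_val
    (isMorphism_projRep hlam)

open Classical in
/-- The normalised frame of a flag of a cell, as a frame. -/
def secPt (b0 : frames V) (W : flagVariety lam hlam) : frames V :=
  if hW : W ∈ cell hlam b0 then
    ⟨sec hlam b0 W, (isNormal_sec hlam hW).linearIndependent hlam⟩ else b0

theorem secPt_eq {b0 : frames V} {W : flagVariety lam hlam} (hW : W ∈ cell hlam b0) :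
    secPt hlam b0 W = ⟨sec hlam b0 W, (isNormal_sec hlam hW).linearIndependent hlam⟩ :=
  dif_pos hW

theorem flagOfFrame_secPt {b0 : frames V} {W : flagVariety lam hlam} (hW : W ∈ cell hlam b0) :
    flagOfFrame lam hlam (secPt hlam b0 W) = W := by
  exact (congrArg (flagOfFrame lam hlam) (secPt_eq hlam hW)).trans (flagOfFrame_sec hlam hW)

theorem morAt_secPt {b0 : frames V} {W : flagVariety lam hlam} (hW : W ∈ cell hlam b0) :
    MorAt (Y := frames V) (secPt hlam b0) W := by
  refine morAt_sub_iff.2 ((morAt_sec hlam hW).congr ?_)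
  filter_upwards [(isOpen_cell hlam b0).mem_nhds hW] with y hy
  exact (congrArg Subtype.val (secPt_eq hlam hy)).symm

theorem isClosed_inc : IsClosed (X := (nilpVariety V).prod (flagVariety lam hlam))
    {z : nilpVariety V × GradedFlag V lam | Inc z.1.1 z.2} := by
  refine isClosed_of_locally_zeros (X := (nilpVariety V).prod (flagVariety lam hlam)) fun z => ?_
  obtain ⟨b0, hb0⟩ := exists_mem_cell hlam z.2
  have hsnd := isMorphism_snd (X := nilpVariety V) (Y := flagVariety lam hlam)
  have hfst := isMorphism_fst (X := nilpVariety V) (Y := flagVariety lam hlam)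
  refine ⟨(fun z => z.2) ⁻¹' cell hlam b0, (isOpen_cell hlam b0).preimage hsnd.1, hb0,
    {p : Σ i : ZMod n, Fin (finrank ℂ (V i)) × Fin (finrank ℂ (V (i + 1))) //
      colDim lam (blk lam (p.1 + 1) p.2.2 - 1) p.1 ≤ p.2.1},
    fun t z => (fbasis (secPt hlam b0 z.2) t.1.1).repr
      (z.1.1 t.1.1 ((secPt hlam b0 z.2).1 (t.1.1 + 1) t.1.2.2)) t.1.2.1, ?_, ?_⟩
  · intro t y hy
    have h1 : MorAt (X := (nilpVariety V).prod (flagVariety lam hlam)) (Y := frames V)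
        (fun z => secPt hlam b0 z.2) y := (morAt_secPt hlam hy).comp (hsnd.morAt y)
    have h2 : MorAt (X := (nilpVariety V).prod (flagVariety lam hlam)) (Y := affine (Rep V))
        (fun z => z.1.1) y := (morAt_val _).comp (hfst.morAt y)
    exact regAt_repr h1 (morAt_rep_apply h2 (morAt_frame_vec h1 _ _)) _
  · intro y hy
    have h1 := inc_flagOfFrame_iff hlam (secPt hlam b0 y.2) y.1.1
    have h2 : flagOfFrame lam hlam (secPt hlam b0 y.2) = y.2 := flagOfFrame_secPt hlam hy
    rw [h2] at h1
    refine h1.trans ⟨fun h t => h _ _ _ t.2, fun h i j m hm => h ⟨⟨i, m, j⟩, hm⟩⟩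

theorem isVariety_resolution : IsVariety (resolution lam hlam) :=
  ((isAffineVariety_nilpVariety V).isVariety.prod (isVariety_flagVariety hlam)).closed_sub
    (isClosed_inc hlam)

/-- The trivialisation of the resolution over a cell. -/
def resTriv (b0 : frames V) (z : (flagVariety lam hlam).sub (cell hlam b0) ×
    (RepIdx V lam → ℂ)) : (resolution lam hlam).sub (projFlag lam hlam ⁻¹' cell hlam b0) :=
  ⟨resPt hlam (secPt hlam b0 z.1.1) z.2, by
    have h1 := flagOfFrame_secPt hlam z.1.2
    have h2 : projFlag lam hlam (resPt hlam (secPt hlam b0 z.1.1) z.2) = z.1.1 := h1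
    exact Set.mem_preimage.2 (h2.symm ▸ z.1.2)⟩

theorem projFlag_resTriv (b0 : frames V) (W : (flagVariety lam hlam).sub (cell hlam b0))
    (c : RepIdx V lam → ℂ) : projFlag lam hlam (resTriv hlam b0 (W, c)).1 = W.1 :=
  flagOfFrame_secPt hlam W.2

theorem isIsom_resTriv (b0 : frames V) :
    IsIsom (X := ((flagVariety lam hlam).sub (cell hlam b0)).prod (affine (RepIdx V lam → ℂ)))
      (resTriv hlam b0) := by
  refine .mk' (g := fun z => (⟨projFlag lam hlam z.1, z.2⟩,
    repCoord lam (secPt hlam b0 (projFlag lam hlam z.1)) (repPart lam hlam z.1))) ?_ ?_ ?_ ?_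
  · refine isMorphism_sub_iff.2 (isMorphism_iff.2 fun z => ?_)
    have h1 : MorAt (X := ((flagVariety lam hlam).sub (cell hlam b0)).prod
        (affine (RepIdx V lam → ℂ))) (Y := frames V) (fun z => secPt hlam b0 z.1.1) z :=
      morAt_comp_fst_val (Y := affine (RepIdx V lam → ℂ)) (z := z) (morAt_secPt hlam z.1.2)
    refine morAt_resolution hlam (morAt_repOf h1 (isMorphism_snd.morAt z)) ?_
    exact ((isMorphism_flagOfFrame hlam).morAt _).comp h1
  · refine isMorphism_prod ?_ ?_
    · exact isMorphism_sub_iff.2 (IsMorphism.comp (Y := resolution lam hlam)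
        (Z := flagVariety lam hlam) (isMorphism_projFlag hlam) isMorphism_val)
    · refine isMorphism_iff.2 fun z => ?_
      have h1 : MorAt (X := (resolution lam hlam).sub (projFlag lam hlam ⁻¹' cell hlam b0))
        (Y := flagVariety lam hlam) (fun z => projFlag lam hlam z.1) z :=
        ((isMorphism_projFlag hlam).morAt z.1).comp (morAt_val z)
      have h2 : MorAt (X := (resolution lam hlam).sub (projFlag lam hlam ⁻¹' cell hlam b0))
        (Y := affine (Rep V)) (fun z => repPart lam hlam z.1) z :=
        ((isMorphism_repPart hlam).morAt z.1).comp (morAt_val z)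
      exact morAt_repCoord (MorAt.comp (f := fun z :
        (resolution lam hlam).sub (projFlag lam hlam ⁻¹' cell hlam b0) => projFlag lam hlam z.1)
        (morAt_secPt hlam z.2) h1) h2
  · rintro ⟨W, c⟩
    have h1 := projFlag_resTriv hlam b0 W c
    refine Prod.ext (Subtype.ext h1) ?_
    change repCoord lam (secPt hlam b0 (projFlag lam hlam (resTriv hlam b0 (W, c)).1))
      (repOf (secPt hlam b0 W.1) c) = c
    rw [h1]
    exact repCoord_repOf _ c
  · intro z
    refine Subtype.ext (resPt_eq hlam ?_)
    exact flagOfFrame_secPt hlam z.2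

theorem isVectorBundle_projFlag :
    IsVectorBundle (X := resolution lam hlam) (projFlag lam hlam) (repPart lam hlam)
      (Fintype.card (RepIdx V lam)) := by
  refine ⟨isMorphism_projFlag hlam, fun z z' h h' => resolution_ext hlam h h', fun W => ?_⟩
  obtain ⟨b0, hb0⟩ := exists_mem_cell hlam W
  let e : (Fin (Fintype.card (RepIdx V lam)) → ℂ) ≃ₗ[ℂ] (RepIdx V lam → ℂ) :=
    LinearEquiv.funCongrLeft ℂ ℂ (Fintype.equivFin (RepIdx V lam))
  refine ⟨cell hlam b0, isOpen_cell hlam b0, hb0, fun z => resTriv hlam b0 (z.1, e z.2), ?_,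
    fun y c => projFlag_resTriv hlam b0 y (e c), fun y => ?_⟩
  · exact (isIsom_resTriv hlam b0).comp (IsIsom.prod_right (isIsom_linearEquiv e))
  · have h1 : IsLinearMap ℂ fun c : RepIdx V lam → ℂ => repOf (secPt hlam b0 y.1) c := by
      constructor
      · intro c c'
        funext i
        refine (fbasis (secPt hlam b0 y.1) (i + 1)).ext fun j =>
          (fbasis (secPt hlam b0 y.1) i).repr.injective (Finsupp.ext fun m => ?_)
        rw [fbasis_apply, repr_repOf, Pi.add_apply, LinearMap.add_apply, map_add,
          Finsupp.add_apply, repr_repOf, repr_repOf]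
        split_ifs <;> simp
      · intro a c
        funext i
        refine (fbasis (secPt hlam b0 y.1) (i + 1)).ext fun j =>
          (fbasis (secPt hlam b0 y.1) i).repr.injective (Finsupp.ext fun m => ?_)
        rw [fbasis_apply, repr_repOf, Pi.smul_apply, LinearMap.smul_apply, map_smul,
          Finsupp.smul_apply, repr_repOf]
        split_ifs <;> simp
    exact ⟨fun c c' => (congrArg _ (e.map_add c c')).trans (h1.1 _ _),
      fun a c => (congrArg _ (e.map_smul a c)).trans (h1.2 _ _)⟩

theorem exists_resolution_chart (z : resolution lam hlam) :
    ∃ U : Set (resolution lam hlam), IsOpen U ∧ z ∈ U ∧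
      Iso ((resolution lam hlam).sub U) (affine ((FlagIdx V lam → ℂ) × (RepIdx V lam → ℂ))) := by
  obtain ⟨b0, hb0⟩ := exists_mem_cell hlam (projFlag lam hlam z)
  refine ⟨projFlag lam hlam ⁻¹' cell hlam b0,
    (isOpen_cell hlam b0).preimage (isMorphism_projFlag hlam).1, hb0, ?_⟩
  refine Iso.trans (Iso.symm ⟨_, isIsom_resTriv hlam b0⟩) (Iso.trans ?_ iso_affine_prod)
  exact Iso.prod ⟨_, isIsom_cell hlam b0⟩ (Iso.refl _)

theorem isSmooth_resolution : IsSmooth (resolution lam hlam) := by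
  refine IsSmooth.of_cover fun z => ?_
  obtain ⟨U, hU, hz, h⟩ := exists_resolution_chart hlam z
  exact ⟨U, hU, hz, _, isSmooth_affine _, h⟩

theorem locDim_resolution : LocDim (resolution lam hlam)
    (Fintype.card (FlagIdx V lam) + Fintype.card (RepIdx V lam)) := by
  refine locDim_of_cover fun z => ?_
  obtain ⟨U, hU, hz, h⟩ := exists_resolution_chart hlam z
  refine ⟨U, hU, hz, locDim_of_iso h ?_⟩
  have := locDim_affine ((FlagIdx V lam → ℂ) × (RepIdx V lam → ℂ))
  rwa [finrank_prod, finrank_pi, finrank_pi] at this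

/-- The pairs of a frame and linear coordinates form a non-empty open subset of a vector space, and
they map onto the whole incidence variety. -/
theorem irreducibleSpace_resolution : IrreducibleSpace (resolution lam hlam) := by
  have h0 := irreducibleSpace_affine (FrameSpace V × (RepIdx V lam → ℂ))
  let U : Set (affine (FrameSpace V × (RepIdx V lam → ℂ))) :=
    {z : FrameSpace V × (RepIdx V lam → ℂ) | ∀ i, LinearIndependent ℂ (z.1 i)}
  have hfst : IsMorphism (X := affine (FrameSpace V × (RepIdx V lam → ℂ)))
    (Y := affine (FrameSpace V)) (fun z : FrameSpace V × (RepIdx V lam → ℂ) => z.1) :=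
    isMorphism_linearMap (LinearMap.fst ℂ (FrameSpace V) (RepIdx V lam → ℂ))
  have hsnd : IsMorphism (X := affine (FrameSpace V × (RepIdx V lam → ℂ)))
    (Y := affine (RepIdx V lam → ℂ)) (fun z : FrameSpace V × (RepIdx V lam → ℂ) => z.2) :=
    isMorphism_linearMap (LinearMap.snd ℂ (FrameSpace V) (RepIdx V lam → ℂ))
  have hU : IsOpen U := isOpen_frames.preimage hfst.1
  obtain ⟨b⟩ := nonempty_frames V
  have hne : U.Nonempty := ⟨((b.1, 0) : FrameSpace V × (RepIdx V lam → ℂ)), b.2⟩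
  have h1 := irreducibleSpace_of_open hU hne
  let f : (affine (FrameSpace V × (RepIdx V lam → ℂ))).sub U → frames V :=
    fun z => ⟨(z.1 : FrameSpace V × (RepIdx V lam → ℂ)).1, z.2⟩
  let c : (affine (FrameSpace V × (RepIdx V lam → ℂ))).sub U → RepIdx V lam → ℂ :=
    fun z => (z.1 : FrameSpace V × (RepIdx V lam → ℂ)).2
  have hf : IsMorphism f := isMorphism_sub_iff.2 (IsMorphism.comp
    (Y := affine (FrameSpace V × (RepIdx V lam → ℂ))) (Z := affine (FrameSpace V)) hfst
      isMorphism_val)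
  have hc : IsMorphism (Y := affine (RepIdx V lam → ℂ)) c := IsMorphism.comp
    (Y := affine (FrameSpace V × (RepIdx V lam → ℂ))) (Z := affine (RepIdx V lam → ℂ)) hsnd
      isMorphism_val
  refine irreducibleSpace_of_surjective (f := fun z => resPt hlam (f z) (c z)) ?_ ?_
  · refine isMorphism_iff.2 fun z => morAt_resolution hlam (morAt_repOf (hf.morAt z)
      (hc.morAt z)) ?_
    exact ((isMorphism_flagOfFrame hlam).morAt _).comp (hf.morAt z)
  · intro z
    obtain ⟨b, hb⟩ := flagOfFrame_surjective hlam (projFlag lam hlam z)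
    exact ⟨⟨(b.1, repCoord lam b (repPart lam hlam z)), b.2⟩, resPt_eq hlam hb⟩

end Resolution
end CyclicQuiver

/-! ### Chains of vectors adapted to a filtration -/

section JordanChains

variable {P : Type u} [AddCommGroup P] [Module ℂ P] [FiniteDimensional ℂ P]

/-- Turns independence modulo `S` into a dimension count, the form in which it enters the
construction of chains. -/
theorem linearIndependent_mkQ_iff {p : ℕ} (S : Submodule ℂ P) (v : Fin p → P) :
    LinearIndependent ℂ (fun a => S.mkQ (v a)) ↔
      finrank ℂ (S ⊔ Submodule.span ℂ (Set.range v) : Submodule ℂ P) = finrank ℂ S + p := by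
  have h1 : Submodule.span ℂ (Set.range fun a => S.mkQ (v a)) =
      LinearMap.range (S.mkQ.domRestrict (S ⊔ Submodule.span ℂ (Set.range v))) := by
    rw [LinearMap.range_domRestrict, Submodule.map_sup, Submodule.mkQ_map_self, bot_sup_eq,
      Submodule.map_span, ← Set.range_comp]
    rfl
  have h2 : finrank ℂ (LinearMap.ker
      (S.mkQ.domRestrict (S ⊔ Submodule.span ℂ (Set.range v)))) = finrank ℂ S := by
    rw [LinearMap.ker_domRestrict, Submodule.ker_mkQ]
    exact LinearEquiv.finrank_eq (Submodule.submoduleOfEquivOfLe le_sup_left)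
  have h3 := LinearMap.finrank_range_add_finrank_ker
    (S.mkQ.domRestrict (S ⊔ Submodule.span ℂ (Set.range v)))
  rw [linearIndependent_iff_card_eq_finrank_span, Set.finrank, h1, Fintype.card_fin]
  omega

theorem range_fin_eq_image {α : Type*} (v : ℕ → α) (p : ℕ) :
    (Set.range fun a : Fin p => v a) = v '' {a | a < p} := by
  ext y
  constructor
  · rintro ⟨a, rfl⟩
    exact ⟨a, a.2, rfl⟩
  · rintro ⟨a, ha, rfl⟩
    exact ⟨⟨a, ha⟩, rfl⟩

theorem exists_extension {S T : Submodule ℂ P} {p q : ℕ} (hpq : p ≤ q) (v : ℕ → P)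
    (hv : S ⊔ Submodule.span ℂ (v '' {a | a < p}) ≤ T)
    (hp : finrank ℂ (S ⊔ Submodule.span ℂ (v '' {a | a < p}) : Submodule ℂ P) =
      finrank ℂ S + p) (hq : finrank ℂ T = finrank ℂ S + q) :
    ∃ w : ℕ → P, (∀ a < p, w a = v a) ∧ S ⊔ Submodule.span ℂ (w '' {a | a < q}) = T := by
  set S₁ := S ⊔ Submodule.span ℂ (v '' {a | a < p})
  -- A family adapted to `0 ⊆ S₁ ⊆ T`. Its members with index from `finrank S + p` up to `finrank S
  -- + q` complete the given vectors.
  obtain ⟨f, hf⟩ := exists_adapted_family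
    (fun k => if k = 0 then ⊥ else if k = 1 then S₁ else T) (by simp) (by
      refine monotone_nat_of_le_succ fun k => ?_
      rcases k with _ | _ | k
      · simp
      · simpa using hv
      · simp) 2
  have hf1 : Submodule.span ℂ (f '' {j | j < finrank ℂ S₁}) = S₁ := hf 1 (by omega)
  have hf2 : Submodule.span ℂ (f '' {j | j < finrank ℂ T}) = T := hf 2 le_rfl
  rw [hp] at hf1
  rw [hq] at hf2
  refine ⟨fun a => if a < p then v a else f (finrank ℂ S + a), fun a ha => if_pos ha, ?_⟩
  have hset : (fun a => if a < p then v a else f (finrank ℂ S + a)) '' {a | a < q} =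
      v '' {a | a < p} ∪ f '' {a | finrank ℂ S + p ≤ a ∧ a < finrank ℂ S + q} := by
    ext y
    constructor
    · rintro ⟨a, ha, rfl⟩
      have ha : a < q := ha
      by_cases h : a < p
      · exact Or.inl ⟨a, h, by simp [h]⟩
      · refine Or.inr ⟨finrank ℂ S + a, ⟨by omega, by omega⟩, by simp [h]⟩
    · rintro (⟨a, ha, rfl⟩ | ⟨a, ⟨h1, h2⟩, rfl⟩)
      · have ha : a < p := ha
        exact ⟨a, lt_of_lt_of_le ha hpq, by simp [ha]⟩
      · refine ⟨a - finrank ℂ S, show a - finrank ℂ S < q by omega, ?_⟩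
        have h3 : ¬ a - finrank ℂ S < p := by omega
        simp only [h3, if_false]
        congr 1
        omega
  rw [hset, Submodule.span_union, ← sup_assoc, show S ⊔ Submodule.span ℂ (v '' {a | a < p}) = S₁
    from rfl, ← hf1, ← Submodule.span_union, ← Set.image_union]
  refine Eq.trans ?_ hf2
  congr 2
  ext a
  simp only [Set.mem_union, Set.mem_ofPred_eq]
  omega

/-- Existence of compatible systems of vectors for a map between filtration steps. -/
theorem exists_chains (f : Module.End ℂ P) (S U : ℕ → Submodule ℂ P) (hSU : ∀ b, S b ≤ U b)
    (q : ℕ → ℕ) (hq : ∀ b, finrank ℂ (U b) = finrank ℂ (S b) + q b) (hanti : Antitone q) (l : ℕ)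
    (hl : ∀ b, l ≤ b → q b = 0) (hf : ∀ b, ∀ u ∈ U (b + 1), f u ∈ U b)
    (hfS : ∀ b, ∀ u ∈ U (b + 1), f u ∈ S b → u ∈ S (b + 1)) :
    ∃ v : ℕ → ℕ → P, (∀ b, S b ⊔ Submodule.span ℂ (v b '' {a | a < q b}) = U b) ∧
      ∀ b a, a < q (b + 1) → f (v (b + 1) a) = v b a := by
  -- Descending construction: after `m` rounds the vectors of level `l - m` and above are in place.
  -- From level `l` on there is nothing to choose, as `q` vanishes.
  have key : ∀ m ≤ l, ∃ v : ℕ → ℕ → P, ∀ b, l - m ≤ b →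
      S b ⊔ Submodule.span ℂ (v b '' {a | a < q b}) = U b ∧
        ∀ a, a < q (b + 1) → f (v (b + 1) a) = v b a := by
    intro m hm
    induction m with
    | zero =>
      refine ⟨0, fun b hb => ⟨?_, fun a ha => ?_⟩⟩
      · rw [hl b (by omega)]
        simp only [not_lt_zero, Set.ofPred_false, Set.image_empty, Submodule.span_empty, sup_bot_eq]
        refine Submodule.eq_of_le_of_finrank_eq (hSU b) ?_
        rw [hq, hl b (by omega), add_zero]
      · rw [hl (b + 1) (by omega)] at ha
        omega
    | succ m ih =>
      obtain ⟨v, hv⟩ := ih (by omega)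
      set b₀ := l - (m + 1) with hb₀
      have hb₁ : l - m = b₀ + 1 := by omega
      rw [hb₁] at hv
      have hv₁ := (hv (b₀ + 1) le_rfl).1
      have hmem : ∀ a < q (b₀ + 1), v (b₀ + 1) a ∈ U (b₀ + 1) := fun a ha => by
        rw [← hv₁]
        exact Submodule.mem_sup_right (Submodule.subset_span ⟨a, ha, rfl⟩)
      have hli : LinearIndependent ℂ
          (fun a : Fin (q (b₀ + 1)) => (S (b₀ + 1)).mkQ (v (b₀ + 1) a)) := by
        rw [linearIndependent_mkQ_iff, range_fin_eq_image, hv₁, hq]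
      -- By `hfS` the map induced by `f` on the quotients is injective, so the images of a basis
      -- modulo `S (b₀ + 1)` remain independent modulo `S b₀` and can be extended.
      have hli' : LinearIndependent ℂ
          (fun a : Fin (q (b₀ + 1)) => (S b₀).mkQ (f (v (b₀ + 1) a))) := by
        refine Fintype.linearIndependent_iff.2 fun c hc => Fintype.linearIndependent_iff.1 hli c ?_
        simp only [← map_smul, ← map_sum] at hc ⊢
        have h1 := (Submodule.Quotient.mk_eq_zero _).1 hc
        refine (Submodule.Quotient.mk_eq_zero _).2 (hfS b₀ _ ?_ h1)
        exact Submodule.sum_mem _ fun a _ => Submodule.smul_mem _ _ (hmem a a.2)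
      rw [linearIndependent_mkQ_iff, range_fin_eq_image (fun a => f (v (b₀ + 1) a))] at hli'
      obtain ⟨w, hw, hw'⟩ := exists_extension (T := U b₀) (hanti (Nat.le_succ b₀))
        (fun a => f (v (b₀ + 1) a)) (sup_le (hSU b₀) (Submodule.span_le.2 (by
          rintro _ ⟨a, ha, rfl⟩
          exact hf b₀ _ (hmem a ha)))) hli' (hq b₀)
      refine ⟨Function.update v b₀ w, fun b hb => ?_⟩
      rcases Nat.lt_or_eq_of_le hb with hb | rfl
      · rw [Function.update_of_ne (by omega), Function.update_of_ne (by omega)]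
        exact hv b hb
      · rw [Function.update_self, Function.update_of_ne (by omega)]
        exact ⟨hw', fun a ha => (hw a ha).symm⟩
  obtain ⟨v, hv⟩ := key l le_rfl
  exact ⟨v, fun b => (hv b (by omega)).1, fun b => (hv b (by omega)).2⟩

end JordanChains

/-! ### Boxes and their left neighbours -/

namespace CyclicQuiver
open FSpace

section Boxes

variable {n : ℕ} [NeZero n] {lam : ZMod n → YoungDiagram}

/-- The boxes labelled `i` as members of a finite set. -/
def boxEquiv (lam : ZMod n → YoungDiagram) (i : ZMod n) :
    {s // s ∈ (Finset.univ : Finset (ZMod n)).sigma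
      fun j => (lam j).cells.filter fun c => j + (c.2 : ZMod n) = i} ≃ Box lam i where
  toFun s := ⟨(s.1.1, s.1.2), by
    have h := s.2
    simp only [Finset.mem_sigma, Finset.mem_filter] at h
    exact h.2⟩
  invFun c := ⟨⟨c.1.1, c.1.2⟩, by
    simp only [Finset.mem_sigma, Finset.mem_filter]
    exact ⟨Finset.mem_univ _, c.2⟩⟩
  left_inv _ := rfl
  right_inv _ := rfl

instance (i : ZMod n) : Fintype (Box lam i) := Fintype.ofEquiv _ (boxEquiv lam i)

instance (i : ZMod n) : DecidableEq (Box lam i) := inferInstanceAs (DecidableEq (Subtype _))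

theorem card_box (i : ZMod n) : Fintype.card (Box lam i) = dimVec lam i := by
  rw [← Fintype.card_congr (boxEquiv lam i), Fintype.card_coe, Finset.card_sigma, dimVec]

theorem mem_firstCols {k : ℕ} {j : ZMod n} {c : ℕ × ℕ} :
    c ∈ firstCols lam k j ↔ c ∈ lam j ∧ c.2 < k := by
  rw [← YoungDiagram.mem_cells, firstCols, Finset.mem_filter, YoungDiagram.mem_cells]

theorem card_box_lt (k : ℕ) (i : ZMod n) :
    Fintype.card {c : Box lam i // c.1.2.2 < k} = colDim lam k i := by
  rw [colDim, ← card_box]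
  refine Fintype.card_congr ⟨fun c => ⟨c.1.1, mem_firstCols.2 ⟨c.1.2.1, c.2⟩, c.1.2.2⟩,
    fun c => ⟨⟨c.1, (mem_firstCols.1 c.2.1).1, c.2.2⟩, (mem_firstCols.1 c.2.1).2⟩,
    fun _ => rfl, fun _ => rfl⟩

/-- With columns numbered from `0`, a box of column `k` has label `i` exactly when its diagram is
the one of index `i - k`. -/
theorem colDim_succ (k : ℕ) (i : ZMod n) :
    colDim lam (k + 1) i = colDim lam k i + (lam (i - k)).colLen k := by
  simp only [colDim, dimVec, firstCols, Finset.filter_filter]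
  have h : ∀ j : ZMod n, ((lam j).cells.filter fun c => c.2 < k + 1 ∧ j + (c.2 : ZMod n) = i).card =
      ((lam j).cells.filter fun c => c.2 < k ∧ j + (c.2 : ZMod n) = i).card +
        if j = i - k then (lam j).colLen k else 0 := by
    intro j
    have h1 : ((lam j).cells.filter fun c => c.2 < k + 1 ∧ j + (c.2 : ZMod n) = i) =
        ((lam j).cells.filter fun c => c.2 < k ∧ j + (c.2 : ZMod n) = i) ∪
          ((lam j).cells.filter fun c => c.2 = k ∧ j = i - k) := by
      rw [← Finset.filter_or]
      refine Finset.filter_congr fun c _ => ?_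
      constructor
      · rintro ⟨h1, h2⟩
        rcases Nat.lt_succ_iff_lt_or_eq.1 h1 with h3 | h3
        · exact Or.inl ⟨h3, h2⟩
        · exact Or.inr ⟨h3, by rw [← h2, h3, add_sub_cancel_right]⟩
      · rintro (⟨h1, h2⟩ | ⟨h1, h2⟩)
        · exact ⟨by omega, h2⟩
        · exact ⟨by omega, by rw [h2, h1, sub_add_cancel]⟩
    rw [h1, Finset.card_union_of_disjoint]
    · congr 1
      by_cases hj : j = i - k
      · rw [if_pos hj, YoungDiagram.colLen_eq_card, YoungDiagram.col]
        congr 1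
        exact Finset.filter_congr fun c _ => by simp [hj]
      · simp [hj]
    · refine Finset.disjoint_filter_filter' _ _ ?_
      rw [Pi.disjoint_iff]
      intro c
      simp only [Prop.disjoint_iff]
      omega
  rw [Finset.sum_congr rfl fun j _ => h j, Finset.sum_add_distrib, Finset.sum_ite_eq']
  simp

theorem colLen_eq_zero {k : ℕ} (hk : numCols lam ≤ k) (j : ZMod n) : (lam j).colLen k = 0 := by
  by_contra h
  have h1 : (0, k) ∈ lam j := YoungDiagram.mem_iff_lt_colLen.2 (Nat.pos_of_ne_zero h)
  have h2 := YoungDiagram.mem_iff_lt_rowLen.1 h1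
  have h4 : (lam j).rowLen 0 ≤ numCols lam :=
    Finset.le_sup (f := fun j => (lam j).rowLen 0) (Finset.mem_univ j)
  omega

/-- The box on the left. -/
def Box.left {i : ZMod n} (c : Box lam (i + 1)) (h : c.1.2.2 ≠ 0) : Box lam i :=
  ⟨(c.1.1, c.1.2.1, c.1.2.2 - 1), (lam c.1.1).isLowerSet (a := c.1.2)
    ⟨le_rfl, Nat.sub_le _ _⟩ c.2.1, by
      have h1 := c.2.2
      obtain ⟨b, hb⟩ := Nat.exists_eq_succ_of_ne_zero h
      rw [hb] at h1 ⊢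
      simp only [Nat.succ_eq_add_one, Nat.cast_add, Nat.cast_one] at h1
      rw [← add_assoc] at h1
      simpa using add_right_cancel h1⟩

theorem Box.eq_left {i : ZMod n} {c : Box lam (i + 1)} (h : c.1.2.2 ≠ 0) :
    c.1 = ((c.left h).1.1, (c.left h).1.2.1, (c.left h).1.2.2 + 1) := by
  refine Prod.ext rfl (Prod.ext rfl ?_)
  simp only [Box.left]
  omega

theorem Box.left_eq_iff {i : ZMod n} {c : Box lam (i + 1)} (h : c.1.2.2 ≠ 0) {c' : Box lam i} :
    c.left h = c' ↔ c.1 = (c'.1.1, c'.1.2.1, c'.1.2.2 + 1) := by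
  constructor
  · rintro rfl
    exact Box.eq_left h
  · intro h'
    refine Subtype.ext ?_
    simp only [Box.left, h', Nat.add_sub_cancel]

end Boxes

/-! ### Graded kernels of powers and Jordan bases -/

section Kernels

variable {n : ℕ} {V : ZMod n → Type u} [∀ i, AddCommGroup (V i)] [∀ i, Module ℂ (V i)]

theorem toEnd_single (x : Rep V) (i : ZMod n) (v : V (i + 1)) :
    x.toEnd (Pi.single (i + 1) v) = Pi.single i (x i v) := by
  funext i'
  rw [toEnd_apply]
  by_cases h : i' = i
  · subst h
    simp
  · rw [Pi.single_eq_of_ne h, Pi.single_eq_of_ne (fun h' => h (add_right_cancel h')), map_zero]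

/-- The component of degree `i` of the kernel of `x ^ k`. -/
def kerPow (x : Rep V) (k : ℕ) (i : ZMod n) : Submodule ℂ (V i) :=
  LinearMap.ker ((x.toEnd ^ k) ∘ₗ LinearMap.single ℂ V i)

theorem mem_kerPow {x : Rep V} {k : ℕ} {i : ZMod n} {v : V i} :
    v ∈ kerPow x k i ↔ (x.toEnd ^ k) (Pi.single i v) = 0 := Iff.rfl

theorem mem_kerPow_zero {x : Rep V} {i : ZMod n} {v : V i} : v ∈ kerPow x 0 i ↔ v = 0 := by
  rw [mem_kerPow, pow_zero, Module.End.one_apply, Pi.single_eq_zero_iff]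

theorem mem_kerPow_succ {x : Rep V} {k : ℕ} {i : ZMod n} {v : V (i + 1)} :
    v ∈ kerPow x (k + 1) (i + 1) ↔ x i v ∈ kerPow x k i := by
  rw [mem_kerPow, mem_kerPow, pow_succ, Module.End.mul_apply, toEnd_single]

theorem kerPow_mono (x : Rep V) (i : ZMod n) : Monotone fun k => kerPow x k i := by
  refine monotone_nat_of_le_succ fun k v hv => ?_
  have hv := mem_kerPow.1 hv
  refine mem_kerPow.2 ?_
  rw [pow_succ', Module.End.mul_apply, hv, map_zero]

theorem exists_add_one (i : ZMod n) : ∃ i' : ZMod n, i = i' + 1 := ⟨i - 1, by simp⟩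

variable [NeZero n] {lam : ZMod n → YoungDiagram}

theorem pow_eq_zero_of_kerPow {x : Rep V} {k : ℕ} (h : ∀ i, kerPow x k i = ⊤) :
    x.toEnd ^ k = 0 := by
  refine LinearMap.pi_ext fun i v => ?_
  have h1 : v ∈ kerPow x k i := h i ▸ Submodule.mem_top
  exact mem_kerPow.1 h1

/-- The bases of the definition of the orbit. -/
def IsJordan (x : Rep V) (e : ∀ i, Basis (Box lam i) ℂ (V i)) : Prop :=
  ∀ (i : ZMod n) (c : Box lam (i + 1)), (c.1.2.2 = 0 → x i (e (i + 1) c) = 0) ∧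
    ∀ c' : Box lam i, c.1 = (c'.1.1, c'.1.2.1, c'.1.2.2 + 1) → x i (e (i + 1) c) = e i c'

theorem IsJordan.repr_apply {x : Rep V} {e : ∀ i, Basis (Box lam i) ℂ (V i)} (h : IsJordan x e)
    (i : ZMod n) (c : Box lam (i + 1)) (c' : Box lam i) :
    (e i).repr (x i (e (i + 1) c)) c' =
      if c.1 = (c'.1.1, c'.1.2.1, c'.1.2.2 + 1) then 1 else 0 := by
  by_cases h0 : c.1.2.2 = 0
  · rw [(h i c).1 h0, map_zero, if_neg]
    · rfl
    · intro h'
      rw [h'] at h0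
      simp at h0
  · rw [(h i c).2 (c.left h0) (Box.eq_left h0), Basis.repr_self, Finsupp.single_apply]
    simp only [Box.left_eq_iff]

/-- Shifting to the left is injective on boxes outside the first column, so no cancellation occurs
and `x ^ k` kills exactly the span of the first `k` columns. -/
theorem IsJordan.mem_kerPow_iff {x : Rep V} {e : ∀ i, Basis (Box lam i) ℂ (V i)}
    (h : IsJordan x e) (k : ℕ) (i : ZMod n) (v : V i) : v ∈ kerPow x k i ↔
      ∀ c : Box lam i, k ≤ c.1.2.2 → (e i).repr v c = 0 := by
  induction k generalizing i with
  | zero =>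
    rw [mem_kerPow_zero, ← (e i).repr.map_eq_zero_iff, Finsupp.ext_iff]
    simp
  | succ k ih =>
    obtain ⟨i, rfl⟩ := exists_add_one i
    rw [mem_kerPow_succ, ih]
    have h1 : ∀ c' : Box lam i, (e i).repr (x i v) c' = ∑ c, (e (i + 1)).repr v c *
        if c.1 = (c'.1.1, c'.1.2.1, c'.1.2.2 + 1) then 1 else 0 := by
      intro c'
      conv_lhs => rw [← (e (i + 1)).sum_repr v]
      simp only [map_sum, map_smul, Finsupp.finsetSum_apply, Finsupp.smul_apply, smul_eq_mul,
        h.repr_apply]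
    constructor
    · intro h2 c hc
      have hc0 : c.1.2.2 ≠ 0 := by omega
      -- Only `c` itself contributes to the coefficient of its left neighbour.
      have h3 := h2 (c.left hc0) (by simp only [Box.left]; omega)
      rw [h1, Finset.sum_eq_single c] at h3
      · rwa [if_pos (Box.eq_left hc0), mul_one] at h3
      · intro c'' _ hne
        rw [if_neg, mul_zero]
        intro h4
        exact hne (Subtype.ext (h4.trans (Box.eq_left hc0).symm))
      · simp
    · intro h2 c' hc'
      rw [h1]
      refine Finset.sum_eq_zero fun c _ => ?_
      split_ifs with h3
      · rw [h2 c (by rw [h3]; simp only; omega), zero_mul]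
      · rw [mul_zero]

theorem IsJordan.finrank_kerPow {x : Rep V} {e : ∀ i, Basis (Box lam i) ℂ (V i)}
    (h : IsJordan x e) (k : ℕ) (i : ZMod n) : finrank ℂ (kerPow x k i) = colDim lam k i := by
  have h1 : kerPow x k i = Submodule.span ℂ (Set.range fun c : {c : Box lam i // c.1.2.2 < k} =>
      e i c.1) := by
    have h2 : (Set.range fun c : {c : Box lam i // c.1.2.2 < k} => e i c.1) =
        e i '' {c | c.1.2.2 < k} := by
      ext y
      constructor
      · rintro ⟨c, rfl⟩
        exact ⟨c.1, c.2, rfl⟩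
      · rintro ⟨c, hc, rfl⟩
        exact ⟨⟨c, hc⟩, rfl⟩
    ext v
    rw [h.mem_kerPow_iff, h2, Basis.mem_span_image]
    constructor
    · intro h3 c hc
      by_contra h4
      exact (Finsupp.mem_support_iff.1 hc) (h3 c (not_lt.1 h4))
    · intro h3 c hc
      by_contra h4
      have h5 : c.1.2.2 < k := h3 (Finsupp.mem_support_iff.2 h4)
      omega
  rw [h1, finrank_span_eq_card, card_box_lt]
  exact (e i).linearIndependent.comp _ Subtype.val_injective

/-- The representation shifting given bases to the left. -/
def shiftRep (e : ∀ i, Basis (Box lam i) ℂ (V i)) : Rep V := fun i =>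
  (e (i + 1)).constr ℂ fun c => if h : c.1.2.2 ≠ 0 then e i (c.left h) else 0

theorem isJordan_shiftRep (e : ∀ i, Basis (Box lam i) ℂ (V i)) : IsJordan (shiftRep e) e := by
  intro i c
  constructor
  · intro h
    rw [shiftRep, Basis.constr_basis, dif_neg (by simpa using h)]
  · intro c' h
    have h0 : c.1.2.2 ≠ 0 := by
      rw [h]
      simp
    rw [shiftRep, Basis.constr_basis, dif_pos h0, (Box.left_eq_iff h0).2 h]

end Kernels
end CyclicQuiver

/-! ### Characterisation of the orbit by dimensions of kernels -/

namespace CyclicQuiver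
open FSpace

section Jordan

variable {n : ℕ} [NeZero n] {V : ZMod n → Type u} [∀ i, AddCommGroup (V i)] [∀ i, Module ℂ (V i)]
  [∀ i, FiniteDimensional ℂ (V i)] {lam : ZMod n → YoungDiagram}

/-- The homogeneous elements of the kernel of `x ^ k`, in the total space. -/
def kerTot (x : Rep V) (k : ℕ) (i : ZMod n) : Submodule ℂ (∀ i, V i) :=
  (kerPow x k i).map (LinearMap.single ℂ V i)

theorem finrank_kerTot (x : Rep V) (k : ℕ) (i : ZMod n) :
    finrank ℂ (kerTot x k i) = finrank ℂ (kerPow x k i) :=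
  (LinearEquiv.finrank_eq (Submodule.equivMapOfInjective _ (Pi.single_injective i) _)).symm

theorem mem_kerTot {x : Rep V} {k : ℕ} {i : ZMod n} {p : ∀ i, V i} :
    p ∈ kerTot x k i ↔ p = Pi.single i (p i) ∧ (x.toEnd ^ k) p = 0 := by
  constructor
  · rintro ⟨v, hv, rfl⟩
    refine ⟨?_, mem_kerPow.1 hv⟩
    simp
  · rintro ⟨h1, h2⟩
    exact ⟨p i, mem_kerPow.2 (h1 ▸ h2), h1.symm⟩

theorem kerTot_mono (x : Rep V) (i : ZMod n) : Monotone fun k => kerTot x k i :=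
  fun _ _ hk => Submodule.map_mono (kerPow_mono x i hk)

theorem toEnd_mem_kerTot {x : Rep V} {k : ℕ} {i : ZMod n} {p : ∀ i, V i}
    (hp : p ∈ kerTot x (k + 1) (i + 1)) : x.toEnd p ∈ kerTot x k i := by
  obtain ⟨h1, h2⟩ := mem_kerTot.1 hp
  refine mem_kerTot.2 ⟨?_, ?_⟩
  · rw [h1, toEnd_single]
    simp
  · rwa [pow_succ, Module.End.mul_apply] at h2

/-- The representations with given dimensions of kernels of powers. -/
def KerDims (lam : ZMod n → YoungDiagram) (x : Rep V) : Prop :=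
  ∀ k i, finrank ℂ (kerPow x k i) = colDim lam k i

variable (hlam : ∀ i, dimVec lam i = finrank ℂ (V i))

include hlam in
theorem KerDims.kerPow_eq_top {x : Rep V} (h : KerDims lam x) (i : ZMod n) :
    kerPow x (numCols lam) i = ⊤ := by
  refine Submodule.eq_top_of_finrank_eq ?_
  rw [h, colDim_numCols, hlam]

include hlam in
theorem KerDims.isNilpotent {x : Rep V} (h : KerDims lam x) : IsNilpotent x.toEnd :=
  ⟨_, pow_eq_zero_of_kerPow (h.kerPow_eq_top hlam)⟩

include hlam in
/-- A representation whose kernels of powers have the right dimensions has a graded Jordan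
basis. -/
theorem KerDims.exists_isJordan {x : Rep V} (h : KerDims lam x) :
    ∃ e : ∀ i, Basis (Box lam i) ℂ (V i), IsJordan x e := by
  have hcast : ∀ (j : ZMod n) (b : ℕ), j + ((b + 1 : ℕ) : ZMod n) = j + (b : ZMod n) + 1 := by
    intro j b
    push_cast
    ring
  -- For each starting label `j`, column `b` lives in degree `j + b` and has to be a basis of `ker
  -- x^(b+1)` modulo `ker x^b` there. Since `x` lowers column and degree together, the chains for
  -- different `j` do not interact.
  have hex : ∀ j : ZMod n, ∃ v : ℕ → ℕ → (∀ i, V i),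
      (∀ b, kerTot x b (j + b) ⊔ Submodule.span ℂ (v b '' {a | a < (lam j).colLen b}) =
        kerTot x (b + 1) (j + b)) ∧
      ∀ b a, a < (lam j).colLen (b + 1) → x.toEnd (v (b + 1) a) = v b a := by
    intro j
    refine exists_chains x.toEnd (fun b => kerTot x b (j + b))
      (fun b => kerTot x (b + 1) (j + b)) (fun b => kerTot_mono x _ (Nat.le_succ b))
      (fun b => (lam j).colLen b) (fun b => ?_) (fun b b' hb => (lam j).colLen_anti _ _ hb)
      (numCols lam) (fun b hb => colLen_eq_zero hb j) (fun b u hu => ?_) (fun b u hu hu' => ?_)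
    · rw [finrank_kerTot, finrank_kerTot, h, h, colDim_succ, add_sub_cancel_right]
    · rw [hcast] at hu
      exact toEnd_mem_kerTot hu
    · refine mem_kerTot.2 ⟨(mem_kerTot.1 hu).1, ?_⟩
      rw [pow_succ, Module.End.mul_apply]
      exact (mem_kerTot.1 hu').2
  choose v hv hv' using hex
  have hmem : ∀ j b a, a < (lam j).colLen b → v j b a ∈ kerTot x (b + 1) (j + b) := by
    intro j b a ha
    rw [← hv]
    exact Submodule.mem_sup_right (Submodule.subset_span ⟨a, ha, rfl⟩)
  let e₀ : ∀ i, Box lam i → V i := fun i c => v c.1.1 c.1.2.2 c.1.2.1 i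
  have hbox : ∀ i (c : Box lam i), Pi.single i (e₀ i c) = v c.1.1 c.1.2.2 c.1.2.1 := by
    intro i c
    have h1 := (mem_kerTot.1 (hmem c.1.1 c.1.2.2 c.1.2.1
      (YoungDiagram.mem_iff_lt_colLen.1 c.2.1))).1
    rw [c.2.2] at h1
    exact h1.symm
  -- In degree `i`, passing from `ker x^k` to `ker x^(k+1)` adds column `k` of the diagram of index
  -- `i - k`. By induction the box vectors span, and their number makes them a basis.
  have hspan : ∀ i k, kerTot x k i ≤ Submodule.span ℂ (Set.range fun c : Box lam i =>
      v c.1.1 c.1.2.2 c.1.2.1) := by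
    intro i k
    induction k with
    | zero =>
      intro p hp
      have h1 := (mem_kerTot.1 hp).2
      rw [pow_zero, Module.End.one_apply] at h1
      rw [h1]
      exact Submodule.zero_mem _
    | succ k ih =>
      have h1 := hv (i - k) k
      rw [sub_add_cancel] at h1
      rw [← h1]
      refine sup_le ih (Submodule.span_le.2 ?_)
      rintro _ ⟨a, ha, rfl⟩
      exact Submodule.subset_span ⟨⟨(i - k, a, k), YoungDiagram.mem_iff_lt_colLen.2 ha,
        sub_add_cancel _ _⟩, rfl⟩
  have htop : ∀ i, ⊤ ≤ Submodule.span ℂ (Set.range (e₀ i)) := by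
    intro i w _
    have h1 : (Pi.single i w : ∀ i, V i) ∈ kerTot x (numCols lam) i :=
      ⟨w, by rw [h.kerPow_eq_top hlam]; trivial, rfl⟩
    have h2 := Submodule.mem_map_of_mem (f := LinearMap.proj (R := ℂ) (φ := V) i)
      (hspan i _ h1)
    rw [Submodule.map_span, ← Set.range_comp, LinearMap.proj_apply, Pi.single_eq_same] at h2
    exact h2
  have hcard : ∀ i, Fintype.card (Box lam i) = finrank ℂ (V i) := fun i => by
    rw [card_box, hlam]
  let e : ∀ i, Basis (Box lam i) ℂ (V i) := fun i =>
    basisOfTopLeSpanOfCardEqFinrank (e₀ i) (htop i) (hcard i)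
  have he : ∀ i c, e i c = e₀ i c := fun i c => by
    simp only [e, coe_basisOfTopLeSpanOfCardEqFinrank]
  refine ⟨e, fun i c => ⟨fun h0 => ?_, fun c' hc => ?_⟩⟩
  · rw [he]
    refine Pi.single_injective i ?_
    rw [← toEnd_single, hbox, Pi.single_zero]
    have h1 := (mem_kerTot.1 (hmem c.1.1 c.1.2.2 c.1.2.1
      (YoungDiagram.mem_iff_lt_colLen.1 c.2.1))).2
    rwa [h0, zero_add, pow_one, ← h0] at h1
  · rw [he, he]
    refine Pi.single_injective i ?_
    rw [← toEnd_single, hbox, hbox, hc]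
    refine hv' _ _ _ ?_
    have h1 := YoungDiagram.mem_iff_lt_colLen.1 c.2.1
    rwa [hc] at h1

include hlam in
-- Replaces the existence of bases by rank conditions, which can be compared with flags and are
-- semicontinuous.
theorem mem_orbit_iff (x : nilpVariety V) : x ∈ orbit V lam ↔ KerDims lam x.1 := by
  constructor
  · rintro ⟨e, he⟩ k i
    exact IsJordan.finrank_kerPow (x := x.1) (e := e) he k i
  · intro h
    exact h.exists_isJordan hlam

include hlam in
theorem orbit_nonempty : (orbit V lam).Nonempty := by
  have hcard : ∀ i, Fintype.card (Box lam i) = finrank ℂ (V i) := fun i => by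
    rw [card_box, hlam]
  let e : ∀ i, Basis (Box lam i) ℂ (V i) := fun i =>
    (finBasis ℂ (V i)).reindex (Fintype.equivFinOfCardEq (hcard i)).symm
  have h1 := isJordan_shiftRep e
  have h2 : KerDims lam (shiftRep e) := h1.finrank_kerPow
  exact ⟨⟨shiftRep e, h2.isNilpotent hlam⟩, e, h1⟩

theorem Inc.le_kerPow {x : Rep V} {W : GradedFlag V lam} (h : Inc x W)
    (k : Fin (numCols lam + 1)) (i : ZMod n) : W.W k i ≤ kerPow x k i := by
  induction k using Fin.induction generalizing i with
  | zero =>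
    rw [W.zero]
    exact bot_le
  | succ k ih =>
    obtain ⟨i, rfl⟩ := exists_add_one i
    exact fun w hw => mem_kerPow_succ.2 (ih i (h k i w hw))

/-- The step `k` is killed by `x ^ k` and has the dimension of the kernel. So a point of the orbit
carries only one admissible flag. -/
theorem Inc.eq_kerPow {x : Rep V} {W : GradedFlag V lam} (h : Inc x W) (hx : KerDims lam x)
    (k : Fin (numCols lam + 1)) (i : ZMod n) : W.W k i = kerPow x k i :=
  Submodule.eq_of_le_of_finrank_eq (h.le_kerPow k i) (by rw [W.finrank_eq, hx])

/-- The flag of kernels of powers. -/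
def kerFlag {x : Rep V} (h : KerDims lam x) : GradedFlag V lam where
  W k i := kerPow x k i
  zero := by
    funext i
    refine Submodule.finrank_eq_zero.1 ?_
    rw [h]
    exact colDim_zero lam i
  last := funext fun i => h.kerPow_eq_top hlam i
  mono k k' hk i := kerPow_mono x i hk
  finrank_eq k i := h k i

theorem inc_kerFlag {x : Rep V} (h : KerDims lam x) : Inc x (kerFlag hlam h) :=
  fun _ _ _ hw => mem_kerPow_succ.1 hw

theorem Inc.eq_kerFlag {x : Rep V} {W : GradedFlag V lam} (h : Inc x W) (hx : KerDims lam x) :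
    W = kerFlag hlam hx :=
  GradedFlag.ext' fun k i => h.eq_kerPow hx k i

end Jordan
end CyclicQuiver

/-! ### Kernels in families; the inverse of the first projection over the orbit -/

namespace FSpace

section Inverse

variable {X : FSpace.{u}} {x : X} {E : Type v} [AddCommGroup E] [Module ℂ E]
  [FiniteDimensional ℂ E]

theorem regAt_toMatrix {g : X → Module.End ℂ E} (hg : MorAt (Y := affine (Module.End ℂ E)) g x)
    (s t : Fin (finrank ℂ E)) :
    X.RegAt (fun y => LinearMap.toMatrix (finBasis ℂ E) (finBasis ℂ E) (g y) s t) x := by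
  have h1 := regAt_dual_comp hg
    (((finBasis ℂ E).coord s) ∘ₗ (LinearMap.applyₗ (R := ℂ) (finBasis ℂ E t)))
  refine X.regAt_congr (Filter.Eventually.of_forall fun y => ?_) h1
  exact (LinearMap.toMatrix_apply _ _ _ _ _).symm

theorem regAt_det_end {g : X → Module.End ℂ E}
    (hg : MorAt (Y := affine (Module.End ℂ E)) g x) :
    X.RegAt (fun y => LinearMap.det (g y)) x := by
  refine X.regAt_congr (Filter.Eventually.of_forall fun y => ?_)
    (regAt_det fun s t => regAt_toMatrix hg s t)
  exact LinearMap.det_toMatrix _ _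

/-- The solution is given by the inverse matrix. As this is zero for singular matrices, `w` is
defined everywhere, but solves the equation only where the determinant does not vanish. -/
theorem exists_morAt_inverse {g : X → Module.End ℂ E}
    (hg : MorAt (Y := affine (Module.End ℂ E)) g x) (h0 : LinearMap.det (g x) ≠ 0) (v : E) :
    ∃ w : X → E, MorAt (Y := affine E) w x ∧ ∀ y, LinearMap.det (g y) ≠ 0 → g y (w y) = v := by
  let β := finBasis ℂ E
  let M : X → Matrix (Fin (finrank ℂ E)) (Fin (finrank ℂ E)) ℂ := fun y =>
    LinearMap.toMatrix β β (g y)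
  have hM : ∀ y, (M y).det = LinearMap.det (g y) := fun y => LinearMap.det_toMatrix _ _
  refine ⟨fun y => Matrix.toLin β β (M y)⁻¹ v, ?_, fun y hy => ?_⟩
  · refine (morAt_affine_basis β).2 fun s => ?_
    have key : ∀ y, ∑ t, (M y)⁻¹ s t * β.repr v t =
        β.repr (Matrix.toLin β β (M y)⁻¹ v) s := by
      intro y
      rw [Matrix.repr_toLin]
      rfl
    refine X.regAt_congr (Filter.Eventually.of_forall key) (regAt_sum _ fun t _ => regAt_mul'
      (regAt_matrix_inv (fun s t => regAt_toMatrix hg s t) ?_ s t) (X.regAt_const _ _))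
    rw [hM]
    exact h0
  · have h1 : g y = Matrix.toLin β β (M y) := (Matrix.toLin_toMatrix β β (g y)).symm
    conv_lhs => rw [h1]
    rw [← Matrix.toLin_mul_apply, Matrix.mul_nonsing_inv _
      (isUnit_iff_ne_zero.2 ((hM y).symm ▸ hy)), Matrix.toLin_one]
    rfl

end Inverse

end FSpace

/-- Von Neumann regularity of linear maps. -/
theorem exists_weak_inverse {E F : Type*} [AddCommGroup E] [Module ℂ E] [AddCommGroup F]
    [Module ℂ F] (A : E →ₗ[ℂ] F) : ∃ L : F →ₗ[ℂ] E, ∀ v, A (L (A v)) = A v := by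
  obtain ⟨s, hs⟩ := A.rangeRestrict.exists_rightInverse_of_surjective A.range_rangeRestrict
  obtain ⟨L, hL⟩ := s.exists_extend
  refine ⟨L, fun v => ?_⟩
  have h1 : L (A v) = s (A.rangeRestrict v) := LinearMap.congr_fun hL (A.rangeRestrict v)
  rw [h1]
  exact congrArg Subtype.val (LinearMap.congr_fun hs (A.rangeRestrict v))

namespace CyclicQuiver
open FSpace

section KernelFlag

variable {n : ℕ} [NeZero n] {V : ZMod n → Type u} [∀ i, AddCommGroup (V i)] [∀ i, Module ℂ (V i)]
  [∀ i, FiniteDimensional ℂ (V i)] {lam : ZMod n → YoungDiagram}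

/-- Near `x₀`, a regular family of endomorphisms maps the kernels of the powers of `x` to those
of `x₀`. -/
theorem exists_kerPow_transport (x₀ : Rep V) (k : ℕ) (i : ZMod n) :
    ∃ B : Rep V → Module.End ℂ (V i),
      IsMorphism (X := affine (Rep V)) (Y := affine (Module.End ℂ (V i))) B ∧ B x₀ = 1 ∧
      ∀ x v, v ∈ kerPow x k i → B x v ∈ kerPow x₀ k i := by
  let A : Rep V → (V i →ₗ[ℂ] ∀ i, V i) := fun x => (x.toEnd ^ k) ∘ₗ LinearMap.single ℂ V i
  have hA : ∀ x : Rep V, MorAt (X := affine (Rep V)) (Y := affine (V i →ₗ[ℂ] ∀ i, V i)) A x := by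
    intro x
    have h1 : MorAt (X := affine (Rep V)) (Y := affine (Module.End ℂ (∀ i, V i)))
      (fun x : Rep V => toEndLin V x) x := (isMorphism_linearMap (toEndLin V)).morAt x
    exact morAt_linear (LinearMap.lcomp ℂ (∀ i, V i) (LinearMap.single ℂ V i)) (morAt_pow h1 k)
  obtain ⟨L, hL⟩ := exists_weak_inverse (A x₀)
  -- The correction `L ∘ₗ A x` vanishes on the kernel of `A x` and makes the sum `1` at `x₀`. On
  -- that kernel what remains is `1 - L ∘ₗ A x₀`, whose image lies in the kernel of `A x₀` because
  -- `A L A = A` at `x₀`.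
  refine ⟨fun x => (1 - L ∘ₗ A x₀) + L ∘ₗ A x, ?_, by simp, fun x v hv => ?_⟩
  · refine isMorphism_iff.2 fun x => morAt_affine fun φ => ?_
    have h1 := regAt_dual_comp (hA x) (φ ∘ₗ LinearMap.compRight ℂ (M := V i) L)
    have h2 := regAt_add' ((affine (Rep V)).regAt_const (φ (1 - L ∘ₗ A x₀)) x) h1
    refine (affine (Rep V)).regAt_congr (Filter.Eventually.of_forall fun y => ?_) h2
    exact (map_add φ _ _).symm
  · have h1 : A x v = 0 := hv
    have h2 : ((1 - L ∘ₗ A x₀) + L ∘ₗ A x) v = v - L (A x₀ v) := by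
      simp [h1]
    have h3 : A x₀ (((1 - L ∘ₗ A x₀) + L ∘ₗ A x) v) = 0 := by
      rw [h2, map_sub, hL, sub_self]
    exact h3

variable (V) in
/-- The representations with kernels of powers of bounded dimensions. -/
def boundedKer (lam : ZMod n → YoungDiagram) : Set (affine (Rep V)) :=
  {x : Rep V | ∀ (k : Fin (numCols lam + 1)) (i : ZMod n),
    finrank ℂ (kerPow x k i) ≤ colDim lam k i}

theorem finrank_kerPow_le {x₀ x : Rep V} {k : ℕ} {i : ZMod n} {B : Module.End ℂ (V i)}
    (hB : ∀ v, v ∈ kerPow x k i → B v ∈ kerPow x₀ k i) (hdet : LinearMap.det B ≠ 0) :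
    finrank ℂ (kerPow x k i) ≤ finrank ℂ (kerPow x₀ k i) := by
  refine LinearMap.finrank_le_finrank_of_injective (f := B.restrict hB) ?_
  intro v w h
  have h1 := congrArg Subtype.val h
  exact Subtype.ext ((LinearEquiv.ofIsUnitDet (isUnit_iff_ne_zero.2
    (by rwa [LinearMap.det_toMatrix (finBasis ℂ (V i))] : (LinearMap.toMatrix (finBasis ℂ (V i))
      (finBasis ℂ (V i)) B).det ≠ 0))).injective h1)

/-- Upper semicontinuity: the transport maps are the identity at `x₀`, hence invertible nearby, and
embed the kernels at `x` into those at `x₀`. -/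
theorem isOpen_boundedKer : IsOpen (boundedKer V lam) := by
  refine isOpen_iff_mem_nhds.2 fun x₀ hx₀ => ?_
  have h : ∀ᶠ x : affine (Rep V) in @nhds (affine (Rep V)) _ x₀, ∀ (k : Fin (numCols lam + 1)) (i : ZMod n),
      finrank ℂ (kerPow (x : Rep V) k i) ≤ finrank ℂ (kerPow (x₀ : Rep V) k i) := by
    refine Filter.eventually_all.2 fun k => Filter.eventually_all.2 fun i => ?_
    obtain ⟨B, hB, hB1, hB2⟩ := exists_kerPow_transport x₀ k i
    have h1 := (affine (Rep V)).eventually_ne (regAt_det_end (hB.morAt x₀)) (by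
      rw [hB1, map_one]
      exact one_ne_zero)
    filter_upwards [h1] with x hx
    exact finrank_kerPow_le (fun v hv => hB2 x v hv) hx
  filter_upwards [h] with x hx k i using (hx k i).trans (hx₀ k i)

variable (hlam : ∀ i, dimVec lam i = finrank ℂ (V i))

theorem colDim_of_le {k : ℕ} (hk : numCols lam ≤ k) (i : ZMod n) :
    colDim lam k i = dimVec lam i :=
  le_antisymm (colDim_le lam k i) (by
    rw [← colDim_numCols]
    exact colDim_mono lam i hk)

include hlam in
-- An admissible flag bounds the kernel dimensions from below, so over the incidence variety the
-- upper bounds, an open condition, already give equality.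
theorem kerDims_of_inc {x : Rep V} {W : GradedFlag V lam} (h : Inc x W)
    (hx : x ∈ boundedKer V lam) : KerDims lam x := by
  have h1 : ∀ (k : Fin (numCols lam + 1)) i, finrank ℂ (kerPow x k i) = colDim lam k i :=
    fun k i => le_antisymm (hx k i) ((W.finrank_eq k i).symm.trans_le (Submodule.finrank_mono (h.le_kerPow k i)))
  intro k i
  rcases Nat.lt_or_ge k (numCols lam) with hk | hk
  · exact h1 ⟨k, by omega⟩ i
  -- The bounds concern only exponents up to the number of columns; beyond it the kernel is already
  -- everything.
  · have h2 : kerPow x (numCols lam) i = ⊤ := by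
      refine Submodule.eq_top_of_finrank_eq ?_
      rw [← hlam, ← colDim_numCols]
      exact h1 (Fin.last _) i
    have h3 : kerPow x k i = ⊤ := top_le_iff.1 (h2 ▸ kerPow_mono x i hk)
    rw [h3, finrank_top, colDim_of_le hk, hlam]

theorem KerDims.mem_boundedKer {x : Rep V} (h : KerDims lam x) : x ∈ boundedKer V lam :=
  fun k i => (h k i).le

theorem projRep_mem_orbit_iff (z : resolution lam hlam) :
    projRep lam hlam z ∈ orbit V lam ↔ repPart lam hlam z ∈ boundedKer V lam :=
  (mem_orbit_iff hlam _).trans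
    ⟨fun h => h.mem_boundedKer, kerDims_of_inc hlam (inc_of_resolution hlam z)⟩

theorem isOpen_preimage_orbit : IsOpen (projRep lam hlam ⁻¹' orbit V lam) := by
  have h : projRep lam hlam ⁻¹' orbit V lam = repPart lam hlam ⁻¹' boundedKer V lam :=
    Set.ext fun z => projRep_mem_orbit_iff hlam z
  rw [h]
  exact isOpen_boundedKer.preimage (isMorphism_repPart hlam).1

/-- The flag of kernels of powers, as a map on the orbit. -/
def orbitFlag (y : (nilpVariety V).sub (orbit V lam)) : flagVariety lam hlam :=
  kerFlag hlam ((mem_orbit_iff hlam y.1).1 y.2)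

theorem morAt_orbitRep (y : (nilpVariety V).sub (orbit V lam)) :
    MorAt (X := (nilpVariety V).sub (orbit V lam)) (Y := affine (Rep V)) (fun y => y.1.1) y :=
  MorAt.comp (Y := nilpVariety V) (Z := affine (Rep V)) (morAt_val _) (morAt_val y)

/-- Near `y₀` a regular frame of the kernel flag is produced by applying the inverses of the
transport maps to a fixed frame `b₀` of the flag at `y₀`. -/
theorem isMorphism_orbitFlag :
    IsMorphism (X := (nilpVariety V).sub (orbit V lam)) (orbitFlag hlam) := by
  refine isMorphism_iff.2 fun y₀ => ?_
  have hdims : ∀ y : (nilpVariety V).sub (orbit V lam), KerDims lam y.1.1 :=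
    fun y => (mem_orbit_iff hlam y.1).1 y.2
  obtain ⟨b₀, hb₀⟩ := flagOfFrame_surjective hlam (orbitFlag hlam y₀)
  choose B hB hB1 hB2 using fun k i => exists_kerPow_transport (V := V) y₀.1.1 k i
  have hBy : ∀ k i, MorAt (X := (nilpVariety V).sub (orbit V lam))
      (Y := affine (Module.End ℂ (V i))) (fun y => B k i y.1.1) y₀ := fun k i =>
    MorAt.comp (Y := affine (Rep V)) (f := fun y : (nilpVariety V).sub (orbit V lam) => y.1.1)
      ((hB k i).morAt _) (morAt_orbitRep y₀)
  have hdet0 : ∀ k i, LinearMap.det (B k i y₀.1.1) ≠ 0 := fun k i => by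
    rw [hB1, map_one]
    exact one_ne_zero
  -- Vector `j` is moved by the transport map for the exponent `blk lam i j`, the first step that
  -- contains it.
  choose w hw hw' using fun i (j : Fin (finrank ℂ (V i))) =>
    exists_morAt_inverse (hBy (blk lam i j) i) (hdet0 (blk lam i j) i) (b₀.1 i j)
  let b' : (nilpVariety V).sub (orbit V lam) → FrameSpace V := fun y i j => w i j y
  have hb' : MorAt (Y := affine (FrameSpace V)) b' y₀ := by
    refine morAt_frameSpace b₀ fun i j m => ?_
    exact (morAt_affine_basis (fbasis b₀ i)).1 (hw i j) m
  have hb'0 : b' y₀ = b₀.1 := by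
    funext i j
    have h1 := hw' i j y₀ (hdet0 _ _)
    rwa [hB1] at h1
  have hli : ∀ᶠ y in 𝓝 y₀, ∀ i, LinearIndependent ℂ (b' y i) := by
    refine hb'.1.eventually (isOpen_frames.mem_nhds ?_)
    have h1 : ∀ i, LinearIndependent ℂ (b₀.1 i) := b₀.2
    exact hb'0 ▸ h1
  have hdet : ∀ᶠ y in 𝓝 y₀, ∀ (k : Fin (numCols lam + 1)) (i : ZMod n),
      LinearMap.det (B k i y.1.1) ≠ 0 :=
    Filter.eventually_all.2 fun k => Filter.eventually_all.2 fun i =>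
      FSpace.eventually_ne _ (regAt_det_end (hBy k i)) (hdet0 k i)
  classical
  let f : (nilpVariety V).sub (orbit V lam) → frames V := fun y =>
    if h : ∀ i, LinearIndependent ℂ (b' y i) then ⟨b' y, h⟩ else b₀
  have hf : MorAt (Y := frames V) f y₀ := by
    refine morAt_sub_iff.2 (hb'.congr ?_)
    filter_upwards [hli] with y hy
    have h1 : f y = ⟨b' y, hy⟩ := dif_pos hy
    exact (congrArg Subtype.val h1).symm
  refine MorAt.congr (((isMorphism_flagOfFrame hlam).morAt _).comp hf) ?_
  filter_upwards [hli, hdet] with y hy hy'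
  have h1 : f y = ⟨b' y, hy⟩ := dif_pos hy
  refine (congrArg (flagOfFrame lam hlam) h1).trans (GradedFlag.ext' fun k i => ?_)
  refine Submodule.eq_of_le_of_finrank_eq ?_ ?_
  · refine (flagOfFrame_W hlam ⟨b' y, hy⟩ k i).trans_le (Submodule.span_le.2 ?_)
    rintro _ ⟨j, hj, rfl⟩
    have hj' := j.2.trans_eq (hlam i).symm
    have hblk := blk_le_numCols hj'
    refine kerPow_mono y.1.1 i ((blk_le_iff hj').2 hj) ?_
    have hdetj := hy' ⟨blk lam i j, by omega⟩ i
    have h3 : b₀.1 i j ∈ kerPow y₀.1.1 (blk lam i j) i := by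
      have h4 : (flagOfFrame lam hlam b₀).W ⟨blk lam i j, by omega⟩ i =
        kerPow y₀.1.1 (blk lam i j) i := by
        rw [hb₀]
        rfl
      rw [← h4]
      refine (flagOfFrame_W hlam b₀ _ i).symm ▸ ?_
      exact Submodule.subset_span ⟨j, lt_colDim_blk hj', rfl⟩
    let e := LinearEquiv.ofIsUnitDet (f := B (blk lam i j) i y.1.1) (v := finBasis ℂ (V i))
      (v' := finBasis ℂ (V i)) (isUnit_iff_ne_zero.2
        (by rwa [LinearMap.det_toMatrix (finBasis ℂ (V i))]))
    -- Constancy of the kernel dimensions on the orbit makes the embedding of kernels onto, so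
    -- inverse images of vectors of `b₀` lie in the kernels at `y`.
    have hmap : (kerPow y.1.1 (blk lam i j) i).map (e : V i →ₗ[ℂ] V i) =
        kerPow y₀.1.1 (blk lam i j) i := by
      refine Submodule.eq_of_le_of_finrank_eq ?_ ?_
      · rintro _ ⟨v, hv, rfl⟩
        exact hB2 _ _ _ v hv
      · rw [LinearEquiv.finrank_map_eq e, hdims y, hdims y₀]
    rw [← hmap] at h3
    obtain ⟨v, hv, hv'⟩ := h3
    have h5 : e (b' y i j) = b₀.1 i j := hw' i j y hdetj
    have h6 : v = b' y i j := e.injective (hv'.trans h5.symm)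
    have h7 : b' y i j ∈ kerPow y.1.1 (blk lam i j) i := h6 ▸ hv
    exact h7
  · rw [GradedFlag.finrank_eq]
    exact (hdims y k i).symm

/-- The inverse of the first projection over the orbit. -/
def orbitSection (y : (nilpVariety V).sub (orbit V lam)) : resolution lam hlam :=
  ⟨(y.1, orbitFlag hlam y), inc_kerFlag hlam ((mem_orbit_iff hlam y.1).1 y.2)⟩

theorem isMorphism_orbitSection :
    IsMorphism (X := (nilpVariety V).sub (orbit V lam)) (orbitSection hlam) :=
  isMorphism_iff.2 fun y => morAt_resolution hlam (morAt_orbitRep y)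
    ((isMorphism_orbitFlag hlam).morAt y)

theorem orbitSection_projRep (z : resolution lam hlam)
    (hz : projRep lam hlam z ∈ orbit V lam) :
    orbitSection hlam ⟨projRep lam hlam z, hz⟩ = z :=
  resolution_ext hlam ((inc_of_resolution hlam z).eq_kerFlag hlam ((mem_orbit_iff hlam _).1 hz)).symm rfl

theorem isIsomOver_projRep :
    IsIsomOver (X := resolution lam hlam) (projRep lam hlam) (orbit V lam) := by
  refine .mk' (g := fun y => ⟨orbitSection hlam y, y.2⟩) ?_ ?_ ?_ ?_
  · exact isMorphism_sub_iff.2 (IsMorphism.comp (Y := resolution lam hlam) (Z := nilpVariety V)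
      (isMorphism_projRep hlam) isMorphism_val)
  · exact isMorphism_sub_iff.2 (isMorphism_orbitSection hlam)
  · exact fun z => Subtype.ext (orbitSection_projRep hlam z.1 z.2)
  · exact fun y => rfl

end KernelFlag
end CyclicQuiver

/-! ### Completeness of projective varieties and properness -/

namespace FSpace

section Proper

theorem isClosed_of_eq {T : Type*} [TopologicalSpace T] {S S' : Set T} (h : IsClosed S)
    (e : S = S') : IsClosed S' := e ▸ h

theorem isClosed_of_open_cover {T : Type*} [TopologicalSpace T] {C : Set T}
    (h : ∀ t, ∃ U : Set T, IsOpen U ∧ t ∈ U ∧ IsClosed (Subtype.val ⁻¹' C : Set U)) :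
    IsClosed C := by
  refine isClosed_of_local fun t ht => ?_
  obtain ⟨U, hU, htU, hC⟩ := h t
  refine ⟨Subtype.val '' (Subtype.val ⁻¹' C : Set U)ᶜ,
    hU.isOpenMap_subtype_val _ hC.isOpen_compl, ⟨⟨t, htU⟩, ht, rfl⟩, ?_⟩
  rintro _ ⟨y, hy, rfl⟩
  exact hy

/-- The pull-back of `C` to homogeneous coordinates is a cone, to which elimination theory applies.
-/
theorem isClosed_projection_projectiveSpace {N : ℕ} {E : Type u} [AddCommGroup E] [Module ℂ E]
    [FiniteDimensional ℂ E] {C : Set ((projectiveSpace N).prod (affine E))} (hC : IsClosed C) :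
    IsClosed {e : affine E | ∃ p : projectiveSpace N,
      ((p, e) : (projectiveSpace N).prod (affine E)) ∈ C} := by
  let O : Set (affine ((Fin (N + 1) → ℂ) × E)) := {z : (Fin (N + 1) → ℂ) × E | z.1 ≠ 0}
  let m : (affine ((Fin (N + 1) → ℂ) × E)).sub O → (projectiveSpace N).prod (affine E) :=
    fun z => (pmk (z.1 : (Fin (N + 1) → ℂ) × E).1 z.2, (z.1 : (Fin (N + 1) → ℂ) × E).2)
  have hfst : IsMorphism (X := affine ((Fin (N + 1) → ℂ) × E)) (Y := affine (Fin (N + 1) → ℂ))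
      (fun z : (Fin (N + 1) → ℂ) × E => z.1) := isMorphism_linearMap (LinearMap.fst ℂ (Fin (N + 1) → ℂ) E)
  have hsnd : IsMorphism (X := affine ((Fin (N + 1) → ℂ) × E)) (Y := affine E)
      (fun z : (Fin (N + 1) → ℂ) × E => z.2) := isMorphism_linearMap (LinearMap.snd ℂ (Fin (N + 1) → ℂ) E)
  have hm : IsMorphism m := by
    refine isMorphism_prod ?_ (hsnd.comp isMorphism_val)
    have h1 : IsMorphism (X := (affine ((Fin (N + 1) → ℂ) × E)).sub O)
        (Y := (affine (Fin (N + 1) → ℂ)).sub {v : Fin (N + 1) → ℂ | v ≠ 0})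
        (fun z => ⟨(z.1 : (Fin (N + 1) → ℂ) × E).1, z.2⟩) :=
      isMorphism_sub_iff.2 (hfst.comp isMorphism_val)
    exact isMorphism_pmk.comp h1
  obtain ⟨D, hD, hDC⟩ := isClosed_induced_iff.1 (hC.preimage hm.1)
  have hmem : ∀ (v : Fin (N + 1) → ℂ) (e : E) (hv : v ≠ 0),
      ((v, e) : (Fin (N + 1) → ℂ) × E) ∈ D ↔
        ((pmk v hv, e) : (projectiveSpace N).prod (affine E)) ∈ C := fun v e hv =>
    Set.ext_iff.1 hDC ⟨((v, e) : (Fin (N + 1) → ℂ) × E), hv⟩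
  refine isClosed_of_eq (isClosed_cone_projection hD (C := D) (fun _ _ _ => Iff.rfl) ?_) ?_
  · intro c v e hc hv h
    refine (hmem _ _ (smul_ne_zero hc hv)).2 ?_
    have h1 : pmk v hv = pmk (c • v) (smul_ne_zero hc hv) := pmk_eq_iff.2 ⟨c, hc, rfl⟩
    exact h1 ▸ (hmem _ _ hv).1 h
  · refine Set.ext fun e => ⟨?_, ?_⟩
    · rintro ⟨v, hv, h⟩
      exact ⟨_, (hmem _ _ hv).1 h⟩
    · rintro ⟨p, hp⟩
      obtain ⟨v, hv, rfl⟩ := pmk_surjective p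
      exact ⟨v, hv, (hmem _ _ hv).2 hp⟩

variable {F : FSpace.{u}} {B : FSpace.{v}} 

/-- Projective varieties are complete. -/
theorem IsProjectiveVariety.isClosed_projection (hF : IsProjectiveVariety F) (hB : IsVariety B)
    {C : Set (F.prod B)} (hC : IsClosed C) :
    IsClosed {b : B | ∃ f : F, ((f, b) : F.prod B) ∈ C} := by
  obtain ⟨N, T, hT, f, hf, g, hg, hgf, hfg⟩ := hF
  obtain ⟨-, r, U, hU, hcov⟩ := hB
  refine isClosed_of_open_cover fun b => ?_
  obtain ⟨j, hj⟩ := Set.mem_iUnion.1 (hcov.symm ▸ Set.mem_univ b)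
  obtain ⟨hUo, M, Z, hZ, h, hh, k, hk, hkh, hhk⟩ := hU j
  refine ⟨U j, hUo, hj, ?_⟩
  let TZ : Set ((projectiveSpace N).prod (affine (Fin M → ℂ))) := {w | w.1 ∈ T ∧ w.2 ∈ Z}
  have hTZ : IsClosed TZ := (hT.preimage isMorphism_fst.1).inter (hZ.preimage isMorphism_snd.1)
  let m : ((projectiveSpace N).prod (affine (Fin M → ℂ))).sub TZ → F.prod B :=
    fun w => (g ⟨w.1.1, w.2.1⟩, (k ⟨w.1.2, w.2.2⟩).1)
  have hm : IsMorphism m := by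
    refine isMorphism_prod ?_ ?_
    · have h1 : IsMorphism (X := ((projectiveSpace N).prod (affine (Fin M → ℂ))).sub TZ)
          (Y := (projectiveSpace N).sub T) (fun w => ⟨w.1.1, w.2.1⟩) :=
        isMorphism_sub_iff.2 (isMorphism_fst.comp isMorphism_val)
      exact hg.comp h1
    · have h1 : IsMorphism (X := ((projectiveSpace N).prod (affine (Fin M → ℂ))).sub TZ)
          (Y := (affine (Fin M → ℂ)).sub Z) (fun w => ⟨w.1.2, w.2.2⟩) :=
        isMorphism_sub_iff.2 (isMorphism_snd.comp isMorphism_val)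
      exact isMorphism_val.comp (hk.comp h1)
  have h1 : IsClosed (Subtype.val '' (m ⁻¹' C) :
      Set ((projectiveSpace N).prod (affine (Fin M → ℂ)))) :=
    hTZ.isClosedMap_subtype_val _ (hC.preimage hm.1)
  have h2 := isClosed_projection_projectiveSpace h1
  have h3 : IsMorphism (X := B.sub (U j)) (Y := affine (Fin M → ℂ)) (fun y => (h y).1) :=
    isMorphism_val.comp hh
  refine isClosed_of_eq (h2.preimage h3.1) (Set.ext fun y => ⟨?_, ?_⟩)
  · rintro ⟨p, w, hw, hw'⟩
    have e2 : w.1.2 = (h y).1 := congrArg Prod.snd hw'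
    have e3 : k ⟨w.1.2, w.2.2⟩ = y := by
      have : (⟨w.1.2, w.2.2⟩ : (affine (Fin M → ℂ)).sub Z) = h y := Subtype.ext e2
      rw [this, hkh]
    refine ⟨g ⟨w.1.1, w.2.1⟩, ?_⟩
    have h4 : m w ∈ C := hw
    exact e3 ▸ h4
  · rintro ⟨q, hq⟩
    refine ⟨(f q).1, ⟨((f q).1, (h y).1), (f q).2, (h y).2⟩, ?_, rfl⟩
    have h5 : m ⟨((f q).1, (h y).1), (f q).2, (h y).2⟩ = (q, y.1) :=
      Prod.ext (hgf q) (congrArg Subtype.val (hkh y))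
    exact (congrArg (· ∈ C) h5).mpr hq

variable {X : FSpace.{w}}

/-- After multiplying by `Z` and permuting the factors, the map is the projection of a closed subset
of `F.prod (X.prod Z)` along the complete factor. -/
theorem isProperMorphism_fst (hF : IsProjectiveVariety F) (hX : IsVariety X)
    {S : Set (X.prod F)} (hS : IsClosed S) :
    IsProperMorphism (X := (X.prod F).sub S) (Y := X) (fun z => z.1.1) := by
  refine ⟨isMorphism_fst.comp isMorphism_val, fun Z hZ C hC => ?_⟩
  have h21 : IsMorphism (X := F.prod (X.prod Z)) (Y := X) (fun w => w.2.1) :=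
    isMorphism_fst.comp isMorphism_snd
  have h22 : IsMorphism (X := F.prod (X.prod Z)) (Y := Z) (fun w => w.2.2) :=
    isMorphism_snd.comp isMorphism_snd
  let s : F.prod (X.prod Z) → X.prod F := fun w => (w.2.1, w.1)
  have hs : IsMorphism s := isMorphism_prod h21 isMorphism_fst
  let m : (F.prod (X.prod Z)).sub (s ⁻¹' S) → ((X.prod F).sub S).prod Z :=
    fun w => (⟨s w.1, w.2⟩, w.1.2.2)
  have hm : IsMorphism m := isMorphism_prod (isMorphism_sub_iff.2 (hs.comp isMorphism_val))
    (h22.comp isMorphism_val)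
  have h1 : IsClosed (Subtype.val '' (m ⁻¹' C) : Set (F.prod (X.prod Z))) :=
    (hS.preimage hs.1).isClosedMap_subtype_val _ (hC.preimage hm.1)
  refine isClosed_of_eq (hF.isClosed_projection (hX.prod hZ) h1) (Set.ext fun y => ⟨?_, ?_⟩)
  · rintro ⟨f, w, hw, hw'⟩
    refine ⟨m w, hw, ?_⟩
    exact (congrArg Prod.snd hw').symm
  · rintro ⟨z, hz, rfl⟩
    exact ⟨z.1.1.2, ⟨(z.1.1.2, (z.1.1.1, z.2)), z.1.2⟩, hz, rfl⟩

/-- Universal closedness is applied with `Z` a point, realised as `ℂ^0`. -/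
theorem IsProperMorphism.isClosed_range {f : X → B} (hf : IsProperMorphism f) :
    IsClosed (Set.range f) := by
  have hpt : IsVariety (affine (Fin 0 → ℂ)) :=
    (IsAffineVariety.of_iso (isAffineVariety_closed isClosed_univ) (iso_sub_univ _)).isVariety
  have h1 := hf.2 _ hpt Set.univ isClosed_univ
  let z : affine (Fin 0 → ℂ) := (0 : Fin 0 → ℂ)
  have h2 : IsMorphism (X := B) (Y := B.prod (affine (Fin 0 → ℂ))) (fun b => (b, z)) :=
    isMorphism_prod isMorphism_id (isMorphism_iff.2 fun x => morAt_const z x)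
  refine isClosed_of_eq (h1.preimage h2.1) (Set.ext fun b => ⟨?_, ?_⟩)
  · rintro ⟨w, -, hw⟩
    exact ⟨w.1, (congrArg Prod.fst hw).symm⟩
  · rintro ⟨x, rfl⟩
    exact ⟨(x, z), trivial, rfl⟩

theorem IsProperMorphism.codRestrict {f : X → B} (hf : IsProperMorphism f) {K : Set B}
    (hK : ∀ x, f x ∈ K) : IsProperMorphism (X := X) (Y := B.sub K) (fun x => ⟨f x, hK x⟩) := by
  refine ⟨isMorphism_sub_iff.2 hf.1, fun Z hZ C hC => ?_⟩
  have h2 : IsMorphism (X := (B.sub K).prod Z) (Y := B.prod Z) (fun w => (w.1.1, w.2)) :=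
    isMorphism_prod (isMorphism_val.comp isMorphism_fst) isMorphism_snd
  refine isClosed_of_eq ((hf.2 Z hZ C hC).preimage h2.1) (Set.ext fun w => ⟨?_, ?_⟩)
  · rintro ⟨z, hz, hw⟩
    have e2 : w.2 = z.2 := congrArg Prod.snd hw
    exact ⟨z, hz, Prod.ext (Subtype.ext (congrArg Prod.fst hw)) e2⟩
  · rintro ⟨z, hz, rfl⟩
    exact ⟨z, hz, rfl⟩

end Proper

end FSpace

/-! ### Orbit closures: image, resolution, dimension and codimension -/

namespace FSpace

theorem IsIsomOver.codRestrict {X : FSpace.{u}} {Y : FSpace.{v}} {f : X → Y} {U K : Set Y}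
    (hf : IsIsomOver f U) (hfm : IsMorphism f) (hK : ∀ x, f x ∈ K) :
    IsIsomOver (X := X) (Y := Y.sub K) (fun x => ⟨f x, hK x⟩) (Subtype.val ⁻¹' U) := by
  obtain ⟨-, g, hg, hgf, hfg⟩ := hf
  let K' : Set (Y.sub K) := Subtype.val ⁻¹' U
  have h1 : IsMorphism (X := (Y.sub K).sub K') (Y := Y.sub U) (fun y => ⟨y.1.1, y.2⟩) :=
    isMorphism_sub_iff.2 (IsMorphism.comp (Y := Y.sub K) (Z := Y) isMorphism_val isMorphism_val)
  refine .mk' (g := fun y : (Y.sub K).sub K' => g ⟨y.1.1, y.2⟩) ?_ (hg.comp h1) ?_ ?_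
  · exact isMorphism_sub_iff.2 (isMorphism_sub_iff.2 (hfm.comp isMorphism_val))
  · exact fun x => hgf x
  · intro y
    have h2 : f (g ⟨y.1.1, y.2⟩).1 = y.1.1 := congrArg Subtype.val (hfg ⟨y.1.1, y.2⟩)
    exact Subtype.ext (Subtype.ext h2)

theorem iso_sub_of_subset {X : FSpace.{u}} {S T : Set X} (h : S ⊆ T) :
    Iso ((X.sub T).sub (Subtype.val ⁻¹' S)) (X.sub S) :=
  ⟨fun x => ⟨x.1.1, x.2⟩, .mk' (g := fun x => ⟨⟨x.1, h x.2⟩, x.2⟩)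
    (isMorphism_sub_iff.2 (IsMorphism.comp (Y := X.sub T) (Z := X) isMorphism_val isMorphism_val))
    (isMorphism_sub_iff.2 (isMorphism_sub_iff.2 isMorphism_val)) (fun _ => rfl) fun _ => rfl⟩

theorem dense_preimage_val_closure {T : Type*} [TopologicalSpace T] (S : Set T) :
    Dense (Subtype.val ⁻¹' S : Set (closure S)) := by
  refine Subtype.dense_iff.2 ?_
  rw [Subtype.image_preimage_coe, Set.inter_eq_right.2 subset_closure]

theorem preimage_val_closure {T : Type*} [TopologicalSpace T] {S S' : Set T} (h : S ⊆ S') :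
    (Subtype.val ⁻¹' closure S : Set S') = closure (Subtype.val ⁻¹' S) := by
  rw [IsInducing.subtypeVal.closure_eq_preimage_closure_image, Subtype.image_preimage_coe,
    Set.inter_eq_right.2 h]

end FSpace

namespace CyclicQuiver
open FSpace

variable {n : ℕ} [NeZero n] {V : ZMod n → Type u} [∀ i, AddCommGroup (V i)] [∀ i, Module ℂ (V i)]
  [∀ i, FiniteDimensional ℂ (V i)] {lam : ZMod n → YoungDiagram}
  (hlam : ∀ i, dimVec lam i = finrank ℂ (V i))

theorem isClosed_resolution : IsClosed (X := (nilpVariety V).prod (flagVariety lam hlam))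
    {z : nilpVariety V × GradedFlag V lam | ∀ (k : Fin (numCols lam)) (i : ZMod n),
      ∀ w ∈ z.2.W k.succ (i + 1), z.1.1 i w ∈ z.2.W k.castSucc i} :=
  isClosed_inc hlam

theorem isProperMorphism_projRep : IsProperMorphism (X := resolution lam hlam) (projRep lam hlam) :=
  isProperMorphism_fst (isProjectiveVariety_flagVariety hlam)
    (isAffineVariety_nilpVariety V).isVariety (isClosed_resolution hlam)

theorem preimage_orbit_nonempty : (projRep lam hlam ⁻¹' orbit V lam).Nonempty := by
  obtain ⟨x, hx⟩ := orbit_nonempty (V := V) hlam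
  exact ⟨orbitSection hlam ⟨x, hx⟩, hx⟩

theorem dense_preimage_orbit : Dense (projRep lam hlam ⁻¹' orbit V lam) := by
  have := irreducibleSpace_resolution (V := V) hlam
  exact (isOpen_preimage_orbit hlam).dense (preimage_orbit_nonempty hlam)

/-- By properness the image is closed, and it contains the orbit. Conversely the preimage of the
orbit is dense, so the image lies in the closure. -/
theorem range_projRep : Set.range (projRep lam hlam) = closure (orbit V lam) := by
  refine Set.Subset.antisymm ?_ (closure_minimal ?_ (isProperMorphism_projRep hlam).isClosed_range)
  · rintro _ ⟨z, rfl⟩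
    exact map_mem_closure (isMorphism_projRep hlam).1 (dense_preimage_orbit hlam z) fun _ h => h
  · exact fun x hx => ⟨orbitSection hlam ⟨x, hx⟩, rfl⟩

theorem projRep_mem_closure (z : resolution lam hlam) :
    projRep lam hlam z ∈ closure (orbit V lam) :=
  range_projRep hlam ▸ Set.mem_range_self z

include hlam in
-- Every point of the closure carries an admissible flag, so within the closure the orbit is cut out
-- by the open bounds on kernel dimensions.
theorem isOpen_orbit_in_closure :
    IsOpen (X := (nilpVariety V).sub (closure (orbit V lam))) (Subtype.val ⁻¹' orbit V lam) := by
  have h1 : IsMorphism (X := (nilpVariety V).sub (closure (orbit V lam)))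
      (Y := affine (Rep V)) (fun y => y.1.1) :=
    IsMorphism.comp (Y := nilpVariety V) (Z := affine (Rep V)) isMorphism_val isMorphism_val
  have h2 : (Subtype.val ⁻¹' orbit V lam : Set ((nilpVariety V).sub (closure (orbit V lam)))) =
      (fun y => y.1.1) ⁻¹' boundedKer V lam := by
    refine Set.ext fun y => ?_
    obtain ⟨z, hz⟩ : y.1 ∈ Set.range (projRep lam hlam) :=
      (range_projRep hlam).symm.le y.2
    have h3 := projRep_mem_orbit_iff hlam z
    unfold repPart at h3
    rw [hz] at h3
    exact h3
  exact h2 ▸ isOpen_boundedKer.preimage h1.1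

theorem isResolution_projRep :
    IsResolution (X := resolution lam hlam) (Y := (nilpVariety V).sub (closure (orbit V lam)))
      (fun z => ⟨projRep lam hlam z, projRep_mem_closure hlam z⟩) := by
  refine ⟨isVariety_resolution hlam,
    ((isAffineVariety_nilpVariety V).closed_sub isClosed_closure).isVariety,
    isSmooth_resolution hlam, (isProperMorphism_projRep hlam).codRestrict _, Subtype.val ⁻¹' orbit V lam,
    isOpen_orbit_in_closure hlam, ?_, dense_preimage_orbit hlam,
    (isIsomOver_projRep hlam).codRestrict (isMorphism_projRep hlam) _⟩
  exact dense_preimage_val_closure _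

section Dimension

include hlam in
theorem locDim_orbit : LocDim ((nilpVariety V).sub (orbit V lam))
    (Fintype.card (FlagIdx V lam) + Fintype.card (RepIdx V lam)) :=
  locDim_of_iso (Iso.symm ⟨_, isIsomOver_projRep hlam⟩)
    (locDim_open (locDim_resolution hlam) (isOpen_preimage_orbit hlam))

variable (V lam) in
theorem isAffineModel_closure : ∃ A : Subalgebra ℂ (closure (orbit V lam) → ℂ), IsAffineModel A :=
  ⟨_, (isAffineModel_sub isClosed_nilp).restrict (isClosed_closure (s := orbit V lam))⟩

include hlam in
theorem irreducibleSpace_closure :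
    IrreducibleSpace ((nilpVariety V).sub (closure (orbit V lam))) := by
  have := irreducibleSpace_resolution (V := V) hlam
  refine irreducibleSpace_of_surjective (isMorphism_sub_iff.2 (isMorphism_projRep hlam) :
    IsMorphism (X := resolution lam hlam) (Y := (nilpVariety V).sub (closure (orbit V lam)))
      fun z => ⟨projRep lam hlam z, projRep_mem_closure hlam z⟩) fun y => ?_
  obtain ⟨z, hz⟩ := (range_projRep hlam).symm.le y.2
  exact ⟨z, Subtype.ext hz⟩

include hlam in
-- As an irreducible affine variety the closure has some constant local dimension, which is
-- identified on the non-empty open orbit.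
theorem locDim_closure : LocDim ((nilpVariety V).sub (closure (orbit V lam)))
    (Fintype.card (FlagIdx V lam) + Fintype.card (RepIdx V lam)) := by
  have hirr : IrreducibleSpace (closure (orbit V lam)) := irreducibleSpace_closure (V := V) hlam
  obtain ⟨A, hA⟩ := isAffineModel_closure V lam
  obtain ⟨d, hd⟩ := IsAffineModel.exists_locDim (Y := closure (orbit V lam)) hA
  have h1 := locDim_open (X := (nilpVariety V).sub (closure (orbit V lam))) hd
    (isOpen_orbit_in_closure hlam)
  have h2 : Iso (((nilpVariety V).sub (closure (orbit V lam))).sub (Subtype.val ⁻¹' orbit V lam))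
    ((nilpVariety V).sub (orbit V lam)) := iso_sub_of_subset subset_closure
  have h3 := locDim_of_iso h2 (locDim_orbit hlam)
  obtain ⟨x, hx⟩ := orbit_nonempty (V := V) hlam
  have : Nonempty (((nilpVariety V).sub (closure (orbit V lam))).sub
      (Subtype.val ⁻¹' orbit V lam)) := ⟨⟨⟨x, subset_closure hx⟩, hx⟩⟩
  exact h1.unique h3 ▸ hd

include hlam in
-- The codimension formula in the irreducible affine variety `closure (orbit V lam)`, applied to the
-- smaller orbit closure.
theorem hasCodim_orbit {mu : ZMod n → YoungDiagram} (hmu : ∀ i, dimVec mu i = finrank ℂ (V i))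
    (h : orbit V mu ⊆ closure (orbit V lam)) {c : ℤ}
    (hc : c = ((Fintype.card (FlagIdx V lam) + Fintype.card (RepIdx V lam) : ℕ) : ℤ) -
      ((Fintype.card (FlagIdx V mu) + Fintype.card (RepIdx V mu) : ℕ) : ℤ)) :
    HasCodim ((nilpVariety V).sub (closure (orbit V lam))) (Subtype.val ⁻¹' orbit V mu) c := by
  have hirr : IrreducibleSpace (closure (orbit V lam)) := irreducibleSpace_closure (V := V) hlam
  obtain ⟨A, hA⟩ := isAffineModel_closure V lam
  have hle : closure (orbit V mu) ⊆ closure (orbit V lam) := closure_minimal h isClosed_closure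
  let Z : Set ((nilpVariety V).sub (closure (orbit V lam))) :=
    Subtype.val ⁻¹' closure (orbit V mu)
  have hZ : Z = closure (Subtype.val ⁻¹' orbit V mu) := by
    exact preimage_val_closure h
  have hiso : Iso (((nilpVariety V).sub (closure (orbit V lam))).sub Z)
    ((nilpVariety V).sub (closure (orbit V mu))) := iso_sub_of_subset hle
  have hdim := locDim_of_iso hiso (locDim_closure hmu)
  have hirrZ : IsIrreducible Z := by
    obtain ⟨f, hf⟩ := hiso.symm
    have := irreducibleSpace_closure (V := V) hmu
    have h2 : IrreducibleSpace (((nilpVariety V).sub (closure (orbit V lam))).sub Z) :=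
      irreducibleSpace_of_surjective hf.1 hf.isHomeomorph.surjective
    exact isIrreducible_iff_irreducibleSpace.2 h2
  have hcl : IsClosed Z := isClosed_closure.preimage continuous_subtype_val
  refine ⟨⟨Z, hirrZ, hcl⟩, hZ, ?_⟩
  have h1 := hA.coheight_add (Y := closure (orbit V lam)) (locDim_closure hlam)
    ⟨Z, hirrZ, hcl⟩ hdim
  let N := Fintype.card (FlagIdx V lam) + Fintype.card (RepIdx V lam)
  let M := Fintype.card (FlagIdx V mu) + Fintype.card (RepIdx V mu)
  -- The coheight is an extended natural number; the equation shows that it is finite and that the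
  -- subtraction is not truncated.
  have h2 : ∀ a : ℕ∞, a + M = N → a = (N - M : ℕ) ∧ M ≤ N := by
    intro a ha
    lift a to ℕ using (by
      rintro rfl
      simp at ha)
    have h3 : a + M = N := by exact_mod_cast ha
    exact ⟨by rw [← h3, Nat.add_sub_cancel], by omega⟩
  obtain ⟨h3, h4⟩ := h2 _ h1
  exact ⟨N - M, by rw [hc, Nat.cast_sub h4], h3⟩

end Dimension

end CyclicQuiver

/-! ### Counting boxes: the dimension formulas -/

namespace CyclicQuiver

variable {n : ℕ} [NeZero n] {lam : ZMod n → YoungDiagram}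

theorem colDim_succ' (k : ℕ) (i : ZMod n) :
    colDim lam (k + 1) i = colDim lam k i + colCount lam i k := by
  rw [colCount, Nat.add_sub_cancel' (colDim_mono lam i (Nat.le_succ k))]

theorem colCount_eq (k : ℕ) (i : ZMod n) : colCount lam i k = (lam (i - k)).colLen k := by
  have h1 := colDim_succ (lam := lam) k i
  have h2 := colDim_succ' (lam := lam) k i
  omega

/-- The value `k + 1` of `blk` is taken once for each box labelled `i` in column `k`; the shift
arises because columns are numbered from `0`. -/
theorem sum_blk_colDim (i : ZMod n) (g : ℕ → ℤ) (l : ℕ) :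
    ∑ j ∈ Finset.range (colDim lam l i), g (blk lam i j) =
      ∑ k ∈ Finset.range l, (colCount lam i k : ℤ) * g (k + 1) := by
  induction l with
  | zero => rw [colDim_zero]; rfl
  | succ l ih =>
    rw [Finset.sum_range_succ, ← ih, colDim_succ', Finset.sum_range_add]
    congr 1
    rw [Finset.sum_congr rfl (g := fun _ => g (l + 1)) fun j hj => ?_]
    · simp
    · rw [Finset.mem_range] at hj
      have h1 : colDim lam l i + j < colDim lam (l + 1) i := by
        rw [colDim_succ']
        omega
      have h2 := h1.trans_le (colDim_le lam _ i)
      have h3 := (blk_le_iff h2).2 h1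
      have h4 := (blk_le_iff (k := l) h2).not.2 (by omega)
      congr 1
      omega

theorem sum_blk (i : ZMod n) (g : ℕ → ℤ) :
    ∑ j ∈ Finset.range (dimVec lam i), g (blk lam i j) =
      ∑ k ∈ Finset.range (numCols lam), (colCount lam i k : ℤ) * g (k + 1) := by
  rw [← sum_blk_colDim, colDim_numCols]

/-- The increment that makes the following sum over columns telescope, with `a` boxes already
present and `c` new ones. -/
theorem choose_two_add (a c : ℕ) :
    (((a + c).choose 2 : ℕ) : ℤ) + ((c + 1).choose 2 : ℕ) =
      (a.choose 2 : ℕ) + (c : ℤ) * ((a + c : ℕ) : ℤ) := by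
  induction c with
  | zero => simp
  | succ c ih =>
    have h1 : (a + (c + 1)).choose 2 = (a + c) + (a + c).choose 2 := by
      rw [← Nat.add_assoc, Nat.choose_succ_succ' (a + c) 1, Nat.choose_one_right]
    have h2 : (c + 1 + 1).choose 2 = (c + 1) + (c + 1).choose 2 := by
      rw [Nat.choose_succ_succ' (c + 1) 1, Nat.choose_one_right]
    rw [h1, h2]
    push_cast at ih ⊢
    linarith

theorem sum_colCount_mul_colDim (i : ZMod n) (l : ℕ) :
    ∑ k ∈ Finset.range l, (colCount lam i k : ℤ) * (colDim lam (k + 1) i : ℤ) =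
      ((colDim lam l i).choose 2 : ℤ) +
        ∑ k ∈ Finset.range l, ((colCount lam i k + 1).choose 2 : ℤ) := by
  induction l with
  | zero => simp [colDim_zero]
  | succ l ih =>
    have h := choose_two_add (colDim lam l i) (colCount lam i l)
    rw [← colDim_succ'] at h
    rw [Finset.sum_range_succ, Finset.sum_range_succ, ih]
    linarith

theorem sum_colCount (i : ZMod n) (l : ℕ) :
    ∑ k ∈ Finset.range l, (colCount lam i k : ℤ) = (colDim lam l i : ℤ) := by
  induction l with
  | zero => simp [colDim_zero]
  | succ l ih => rw [Finset.sum_range_succ, ih, colDim_succ', Nat.cast_add]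

theorem sum_colCount_mul_codim (i : ZMod n) :
    ∑ k ∈ Finset.range (numCols lam),
        (colCount lam i k : ℤ) * ((dimVec lam i : ℤ) - colDim lam (k + 1) i) =
      (dimVec lam i).choose 2 -
        ∑ k ∈ Finset.range (numCols lam), ((colCount lam i k).choose 2 : ℤ) := by
  have h1 := sum_colCount_mul_colDim (lam := lam) i (numCols lam)
  have h2 := sum_colCount (lam := lam) i (numCols lam)
  rw [colDim_numCols] at h1 h2
  have h3 : ∀ c : ℕ, (((c + 1).choose 2 : ℕ) : ℤ) = c + (c.choose 2 : ℕ) := fun c => by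
    rw [Nat.choose_succ_succ' c 1, Nat.choose_one_right, Nat.cast_add]
  have h4 := choose_two_add 0 (dimVec lam i)
  rw [h3, zero_add] at h4
  simp only [h3, Finset.sum_add_distrib, h2] at h1
  simp only [mul_sub, Finset.sum_sub_distrib, ← Finset.sum_mul, h1, h2]
  simp only [Nat.choose_zero_succ, Nat.cast_zero, zero_add] at h4
  linarith

/-- Sums over all boxes, by columns. -/
theorem sum_boxes (F : ℕ → ZMod n → ℤ) :
    ∑ j : ZMod n, ∑ c ∈ (lam j).cells, F c.2 (j + (c.2 : ZMod n)) =
      ∑ i : ZMod n, ∑ k ∈ Finset.range (numCols lam), (colCount lam i k : ℤ) * F k i := by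
  have h1 : ∀ j : ZMod n, ∑ c ∈ (lam j).cells, F c.2 (j + (c.2 : ZMod n)) =
      ∑ k ∈ Finset.range (numCols lam), ((lam j).colLen k : ℤ) * F k (j + k) := by
    intro j
    have hmaps : ∀ c ∈ (lam j).cells, c.2 ∈ Finset.range (numCols lam) := by
      intro c hc
      by_contra hcon
      have h2 := colLen_eq_zero (lam := lam) (not_lt.1 (Finset.mem_range.not.1 hcon)) j
      have h3 : (c.1, c.2) ∈ lam j := hc
      have h4 := YoungDiagram.mem_iff_lt_colLen.1 h3
      omega
    rw [← Finset.sum_fiberwise_of_maps_to hmaps]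
    refine Finset.sum_congr rfl fun k _ => ?_
    rw [YoungDiagram.colLen_eq_card, Finset.sum_congr rfl (g := fun _ => F k (j + k))]
    · rw [Finset.sum_const, nsmul_eq_mul]
      rfl
    · intro c hc
      rw [(Finset.mem_filter.1 hc).2]
  rw [Finset.sum_congr rfl fun j _ => h1 j, Finset.sum_comm, Finset.sum_comm (s := Finset.univ)]
  refine Finset.sum_congr rfl fun k _ => ?_
  refine Eq.trans ?_ (Equiv.sum_comp (Equiv.addRight (k : ZMod n)) _)
  refine Finset.sum_congr rfl fun j _ => ?_
  rw [colCount_eq, Equiv.coe_addRight, add_sub_cancel_right]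

/-- Moving one box to the right matches the boxes that have a right neighbour with those outside the
first column; the first column contributes zero by `hF`. -/
theorem sum_boxes_succ (F : ℕ → ZMod n → ℤ) (hF : ∀ i, F 0 i = 0) :
    ∑ j : ZMod n, ∑ c ∈ (lam j).cells.filter fun c => (c.1, c.2 + 1) ∈ (lam j).cells,
      F (c.2 + 1) (j + ((c.2 + 1 : ℕ) : ZMod n)) =
    ∑ j : ZMod n, ∑ c ∈ (lam j).cells, F c.2 (j + (c.2 : ZMod n)) := by
  refine Finset.sum_congr rfl fun j _ => ?_
  rw [← Finset.sum_filter_of_ne (p := fun c : ℕ × ℕ => c.2 ≠ 0) (s := (lam j).cells)]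
  · refine Finset.sum_bij (fun c _ => (c.1, c.2 + 1)) ?_ ?_ ?_ ?_
    · intro c hc
      exact Finset.mem_filter.2 ⟨(Finset.mem_filter.1 hc).2, Nat.succ_ne_zero _⟩
    · intro c _ c' _ h
      have h1 := congrArg Prod.fst h
      have h2 := congrArg Prod.snd h
      exact Prod.ext h1 (Nat.succ_injective h2)
    · intro c hc
      obtain ⟨h1, h2⟩ := Finset.mem_filter.1 hc
      have h3 : (c.1, c.2 - 1 + 1) = c := Prod.ext rfl (Nat.succ_pred_eq_of_ne_zero h2)
      refine ⟨(c.1, c.2 - 1), Finset.mem_filter.2 ⟨?_, h3.symm ▸ h1⟩, h3⟩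
      exact (lam j).isLowerSet (a := c) ⟨le_rfl, Nat.sub_le _ _⟩ h1
    · exact fun _ _ => rfl
  · intro c _ hc h0
    rw [h0, hF] at hc
    exact hc rfl

/-- Weigh each box by the number of boxes with its label up to its own column. Summed by columns
this is the right-hand side. Row ends contribute `epsilon`; for another box the weight is expressed
through its right neighbour, which gives the sum over columns on the left. -/
theorem epsilon_add (lam : ZMod n → YoungDiagram) :
    (epsilon lam : ℤ) + ∑ i : ZMod n, ∑ k ∈ Finset.range (numCols lam),
        (colCount lam (i + 1) k : ℤ) * colDim lam k i =
      ∑ i : ZMod n, (((dimVec lam i).choose 2 : ℤ) +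
        ∑ k ∈ Finset.range (numCols lam), ((colCount lam i k + 1).choose 2 : ℤ)) := by
  have h1 := sum_boxes (lam := lam) fun k i => (colDim lam (k + 1) i : ℤ)
  have h2 := sum_boxes (lam := lam) fun k i => (colDim lam k (i - 1) : ℤ)
  replace h2 := ((sum_boxes_succ (lam := lam) (fun k i => (colDim lam k (i - 1) : ℤ))
    (fun i => by rw [colDim_zero, Nat.cast_zero])).trans h2).trans
    (Equiv.sum_comp (Equiv.addRight (1 : ZMod n)) _).symm
  simp only [Equiv.coe_addRight, add_sub_cancel_right] at h2
  rw [← h2, epsilon, Nat.cast_sum, ← Finset.sum_add_distrib]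
  simp only [sum_colCount_mul_colDim, colDim_numCols] at h1
  rw [← h1]
  refine Finset.sum_congr rfl fun j _ => ?_
  rw [add_comm, Nat.cast_sum, ← Finset.sum_filter_add_sum_filter_not (lam j).cells
    fun c => (c.1, c.2 + 1) ∈ (lam j).cells]
  congr 1
  refine Finset.sum_congr rfl fun c _ => ?_
  rw [Nat.cast_succ, ← add_assoc, add_sub_cancel_right]

theorem epsilon_eq_sum_rows (lam : ZMod n → YoungDiagram) :
    epsilon lam = ∑ i : ZMod n, ∑ p ∈ Finset.range ((lam i).colLen 0),
      dimVec (firstCols lam ((lam i).rowLen p)) (i + ((lam i).rowLen p : ZMod n) - 1) := by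
  refine Finset.sum_congr rfl fun j _ => ?_
  have hlast : ∀ c ∈ (lam j).cells.filter fun c => (c.1, c.2 + 1) ∉ (lam j).cells,
      (lam j).rowLen c.1 = c.2 + 1 := by
    intro c hc
    obtain ⟨h1, h2⟩ := Finset.mem_filter.1 hc
    have h3 : (c.1, c.2) ∈ lam j := h1
    have h4 : (c.1, c.2 + 1) ∉ lam j := h2
    rw [YoungDiagram.mem_iff_lt_rowLen] at h3 h4
    omega
  refine Finset.sum_bij (fun c _ => c.1) ?_ ?_ ?_ ?_
  · intro c hc
    have h1 : c ∈ lam j := (Finset.mem_filter.1 hc).1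
    have h2 : (c.1, 0) ∈ lam j := (lam j).isLowerSet (a := c) ⟨le_rfl, Nat.zero_le _⟩ h1
    exact Finset.mem_range.2 (YoungDiagram.mem_iff_lt_colLen.1 h2)
  · intro c hc c' hc' h
    have h1 := hlast c hc
    have h2 := hlast c' hc'
    rw [h] at h1
    exact Prod.ext h (by omega)
  · intro p hp
    have h1 : (p, 0) ∈ lam j := YoungDiagram.mem_iff_lt_colLen.2 (Finset.mem_range.1 hp)
    have h2 := YoungDiagram.mem_iff_lt_rowLen.1 h1
    refine ⟨(p, (lam j).rowLen p - 1), Finset.mem_filter.2 ⟨?_, fun h3 => ?_⟩, rfl⟩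
    · exact YoungDiagram.mem_iff_lt_rowLen.2 (by omega)
    · have h4 := YoungDiagram.mem_iff_lt_rowLen.1 (show (p, (lam j).rowLen p - 1 + 1) ∈ lam j from h3)
      omega
  · intro c hc
    rw [hlast c hc, Nat.cast_succ, ← add_assoc, add_sub_cancel_right]

section Cards

variable {V : ZMod n → Type u} [∀ i, AddCommGroup (V i)] [∀ i, Module ℂ (V i)]
  [∀ i, FiniteDimensional ℂ (V i)] (hlam : ∀ i, dimVec lam i = finrank ℂ (V i))

theorem card_fin_lt {m a : ℕ} (h : a ≤ m) : Fintype.card {x : Fin m // (x : ℕ) < a} = a := by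
  rw [Fintype.card_subtype, Fin.card_filter_val_lt, min_eq_right h]

theorem card_fin_ge {m a : ℕ} (h : a ≤ m) :
    (Fintype.card {x : Fin m // a ≤ (x : ℕ)} : ℤ) = (m : ℤ) - a := by
  have h1 := Fintype.card_subtype_compl fun x : Fin m => (x : ℕ) < a
  rw [card_fin_lt h, Fintype.card_fin] at h1
  simp only [not_lt] at h1
  rw [h1, Nat.cast_sub h]

theorem card_sigma_subtype {ι : Type*} [Fintype ι] {A B : ι → Type*} [∀ i, Fintype (A i)]
    [∀ i, Fintype (B i)] (p : ∀ i, A i → B i → Prop) [∀ i a b, Decidable (p i a b)]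
    [Fintype {z : Σ i, A i × B i // p z.1 z.2.1 z.2.2}] :
    Fintype.card {z : Σ i, A i × B i // p z.1 z.2.1 z.2.2} =
      ∑ i, ∑ b, Fintype.card {a : A i // p i a b} := by
  rw [← Fintype.card_congr (α := Σ i, Σ b, {a : A i // p i a b})
    ⟨fun z => ⟨⟨z.1, z.2.2.1, z.2.1⟩, z.2.2.2⟩, fun z => ⟨z.1.1, z.1.2.2, z.1.2.1, z.2⟩,
      fun _ => rfl, fun _ => rfl⟩]
  simp only [Fintype.card_sigma]

include hlam in
-- For each vector `j` the free entries are those of index at least the dimension of its step, so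
-- the count is a sum of codimensions over `j`, grouped by columns.
theorem card_flagIdx : (Fintype.card (FlagIdx V lam) : ℤ) =
    ∑ i : ZMod n, (((finrank ℂ (V i)).choose 2 : ℤ) -
      ∑ k ∈ Finset.range (numCols lam), ((colCount lam i k).choose 2 : ℤ)) := by
  have h1 : Fintype.card (FlagIdx V lam) = _ := card_sigma_subtype
    (A := fun i => Fin (finrank ℂ (V i))) (B := fun i => Fin (finrank ℂ (V i)))
    fun i a b => colDim lam (blk lam i b) i ≤ (a : ℕ)
  rw [h1, Nat.cast_sum]
  refine Finset.sum_congr rfl fun i _ => ?_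
  rw [Nat.cast_sum, ← hlam, ← sum_colCount_mul_codim,
    ← sum_blk i fun k => (dimVec lam i : ℤ) - colDim lam k i, ← Fin.sum_univ_eq_sum_range
    (fun j => (dimVec lam i : ℤ) - colDim lam (blk lam i j) i)]
  exact Finset.sum_congr rfl fun b _ => card_fin_ge (colDim_le lam _ i)

include hlam in
-- A vector of degree `i + 1` first occurring in step `k + 1` has its image anywhere in step `k` of
-- degree `i`; the sum of these dimensions is evaluated by `epsilon_add`.
theorem card_repIdx : (Fintype.card (RepIdx V lam) : ℤ) =
    (∑ i : ZMod n, (((finrank ℂ (V i)).choose 2 : ℤ) +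
      ∑ k ∈ Finset.range (numCols lam), ((colCount lam i k + 1).choose 2 : ℤ))) - epsilon lam := by
  have h1 : Fintype.card (RepIdx V lam) = _ := card_sigma_subtype
    (A := fun i => Fin (finrank ℂ (V i))) (B := fun i => Fin (finrank ℂ (V (i + 1))))
    fun i a b => (a : ℕ) < colDim lam (blk lam (i + 1) b - 1) i
  have h2 := epsilon_add lam
  simp only [← hlam] at h1 ⊢
  rw [← h2, add_sub_cancel_left, h1, Nat.cast_sum]
  refine Finset.sum_congr rfl fun i _ => ?_
  have h3 := sum_blk (lam := lam) (i + 1) fun k => (colDim lam (k - 1) i : ℤ)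
  simp only [Nat.add_sub_cancel, hlam] at h3
  rw [← h3, Nat.cast_sum, ← Fin.sum_univ_eq_sum_range
    (fun j => (colDim lam (blk lam (i + 1) j - 1) i : ℤ))]
  exact Finset.sum_congr rfl fun b _ =>
    congrArg Nat.cast (card_fin_lt ((colDim_le lam _ i).trans_eq (hlam i)))

include hlam in
-- For each label the two brackets are sums over columns of the column count times the codimension,
-- respectively the dimension, of a step. These add up to `d` times the number `d` of boxes.
theorem card_flagIdx_add_card_repIdx :
    ((Fintype.card (FlagIdx V lam) + Fintype.card (RepIdx V lam) : ℕ) : ℤ) =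
      (∑ i : ZMod n, (finrank ℂ (V i) : ℤ) ^ 2) - epsilon lam := by
  rw [Nat.cast_add, card_flagIdx hlam, card_repIdx hlam, ← add_sub_assoc,
    ← Finset.sum_add_distrib]
  congr 1
  refine Finset.sum_congr rfl fun i _ => ?_
  have h1 := sum_colCount_mul_colDim (lam := lam) i (numCols lam)
  have h2 := sum_colCount_mul_codim (lam := lam) i
  have h3 := sum_colCount (lam := lam) i (numCols lam)
  rw [colDim_numCols] at h1 h3
  rw [← hlam, ← h1, ← h2, ← Finset.sum_add_distrib]
  simp only [← mul_add, sub_add_cancel, ← Finset.sum_mul, h3, pow_two]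

end Cards
end CyclicQuiver

end

theorem lemma4p1 {n : ℕ} [NeZero n] (V : ZMod n → Type*) [∀ i, AddCommGroup (V i)]
    [∀ i, Module ℂ (V i)] [∀ i, FiniteDimensional ℂ (V i)]
    (lam : ZMod n → YoungDiagram) (hlam : ∀ i, dimVec lam i = finrank ℂ (V i)) :
    -- the flag variety
    (IsVariety (flagVariety lam hlam) ∧ IsSmooth (flagVariety lam hlam) ∧
      IrreducibleSpace (flagVariety lam hlam) ∧ IsProjectiveVariety (flagVariety lam hlam) ∧
      HasDim (flagVariety lam hlam)
        (∑ i : ZMod n, (((finrank ℂ (V i)).choose 2 : ℤ) -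
          ∑ k ∈ Finset.range (numCols lam), ((colCount lam i k).choose 2 : ℤ)))) ∧
    -- the second projection is a vector bundle
    (∃ r : ℕ,
      (r : ℤ) = (∑ i : ZMod n, (((finrank ℂ (V i)).choose 2 : ℤ) +
          ∑ k ∈ Finset.range (numCols lam), ((colCount lam i k + 1).choose 2 : ℤ))) - epsilon lam ∧
      IsVectorBundle (projFlag lam hlam) (repPart lam hlam) r) ∧
    epsilon lam = ∑ i : ZMod n, ∑ p ∈ Finset.range ((lam i).colLen 0),
      dimVec (firstCols lam ((lam i).rowLen p)) (i + ((lam i).rowLen p : ZMod n) - 1) ∧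
    -- the first projection is a resolution
    Set.range (projRep lam hlam) = closure (orbit V lam) ∧
    IsIsomOver (projRep lam hlam) (orbit V lam) ∧
    (∃ h : ∀ z, projRep lam hlam z ∈ closure (orbit V lam),
      IsResolution (X := resolution lam hlam) (Y := (nilpVariety V).sub (closure (orbit V lam)))
        (fun z => ⟨projRep lam hlam z, h z⟩)) ∧
    HasDim ((nilpVariety V).sub (orbit V lam))
      ((∑ i : ZMod n, (finrank ℂ (V i) : ℤ) ^ 2) - epsilon lam) ∧
    HasDim ((nilpVariety V).sub (closure (orbit V lam)))
      ((∑ i : ZMod n, (finrank ℂ (V i) : ℤ) ^ 2) - epsilon lam) ∧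
    HasDim (resolution lam hlam)
      ((∑ i : ZMod n, (finrank ℂ (V i) : ℤ) ^ 2) - epsilon lam) ∧
    ∀ mu : ZMod n → YoungDiagram, (∀ i, dimVec mu i = finrank ℂ (V i)) →
      orbit V mu ⊆ closure (orbit V lam) →
      HasCodim ((nilpVariety V).sub (closure (orbit V lam)))
        (Subtype.val ⁻¹' orbit V mu) ((epsilon mu : ℤ) - epsilon lam) := by
  -- The Krull dimension is read off at a point: an empty space satisfies `LocDim` for every `d`, so
  -- non-emptiness is needed.
  have hne := (irreducibleSpace_flagVariety (V := V) hlam).toNonempty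
  have hne' := (irreducibleSpace_resolution (V := V) hlam).toNonempty
  have hneO : Nonempty ((nilpVariety V).sub (orbit V lam)) :=
    (orbit_nonempty (V := V) hlam).to_subtype
  have hneC : Nonempty ((nilpVariety V).sub (closure (orbit V lam))) :=
    (irreducibleSpace_closure (V := V) hlam).toNonempty
  have hcard := card_flagIdx_add_card_repIdx (V := V) hlam
  exact ⟨⟨isVariety_flagVariety hlam, isSmooth_flagVariety hlam,
      irreducibleSpace_flagVariety hlam, isProjectiveVariety_flagVariety hlam,
      hasDim_of_locDim (locDim_flagVariety hlam) (card_flagIdx hlam)⟩,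
    ⟨_, card_repIdx hlam, isVectorBundle_projFlag hlam⟩, epsilon_eq_sum_rows lam,
    range_projRep hlam, isIsomOver_projRep hlam,
    ⟨projRep_mem_closure hlam, isResolution_projRep hlam⟩,
    hasDim_of_locDim (locDim_orbit hlam) hcard, hasDim_of_locDim (locDim_closure hlam) hcard,
    hasDim_of_locDim (locDim_resolution hlam) hcard, fun mu hmu h =>
      hasCodim_orbit hlam hmu h (by
        rw [hcard, card_flagIdx_add_card_repIdx (V := V) hmu]
        ring)⟩
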